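/- Let $G$ be a compact connected Lie group acting smoothly and effectively on a (Hausdorff, second countable, finite-dimensional, smooth) symplectic manifold $(M,\omega)$. Suppose that the action preserves $\omega$ and is Hamiltonian with $\mathrm{Ad}^*$-equivariant moment map $\Phi:M\to\mathfrak g^*$, i.e. for every $a\in\mathfrak g$ the function $\phi_a=\langle\Phi,a\rangle$ is smooth and its Hamiltonian vector field is the vector field on $M$ generated by $a$. Here the Hamiltonian vector field $\operatorname{sgrad} f$ is defined by $df=\omega(\cdot,\operatorname{sgrad} f)$, and $\{f,g\}=\omega(\operatorname{sgrad} f,\operatorname{sgrad} g)$. A Poisson subalgebra $\mathcal F\subset C^\infty(M)$ is called *complete* if there are numbers $l,r$ with $l+r=\dim M$ and an open dense set of points $x\in M$ at which the space $F_x\subset T_x^*M$ spanned by the differentials $df(x)$, $f\in\mathcal F$, has dimension $l$ and the kernel of the restriction of the Poisson tensor to $F_x$ has dimension $r$. A Hamiltonian system $\dot x=\operatorname{sgrad}H(x)$, $H\in C^\infty(M)$, is *completely integrable* (in the non-commutative sense) if it has a complete algebra $\mathcal F$ of first integrals ($\{H,f\}=0$ for $f\in\mathcal F$). Let $H\in C^\infty(M)$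 be $G$-invariant, and suppose that $\dot x=\operatorname{sgrad}H(x)$ has a complete algebra of first integrals consisting of $G$-invariant functions. Then: 1. $G$ is a torus, i.e. it is isomorphic as a Lie group to $(S^1)^n$ for some $n\ge 0$. 2. If moreover the action is free, then for generic $\eta\in\Phi(M)$, i.e. for all $\eta$ in a residual (comeagre) subset of $\Phi(M)$, the reduced system is completely integrable: for $M_\eta=\Phi^{-1}(\eta)/G_\eta$, where $G_\eta$ is the isotropy group of $\eta$ for the coadjoint action, the level set $\Phi^{-1}(\eta)$ is an embedded submanifold of $M$, the quotient $M_\eta$ is a smooth (Hausdorff, second countable) manifold such that the projection $\pi:\Phi^{-1}(\eta)\to M_\eta$ is a submersion, it carries the reduced symplectic form $\omega_\eta$, determined by $\omega_\eta(d\pi\,\xi_1,d\pi\,\xi_2)=\omega(\xi_1,\xi_2)$ for $\xi_1,\xi_2\in T_x\Phi^{-1}(\eta)$, and the Hamiltonian system on $(M_\eta,\omega_\eta)$ with the smooth Hamiltonian $H_\eta$ given by $H_\eta\circ\pi=H|_{\Phi^{-1}(\eta)}$ is completely integrable in the non-commutative sense. -/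

import Mathlib

open Set Filter Topology
open scoped Manifold ContDiff

noncomputable section

/-! ### Symplectic manifolds, Hamiltonian vector fields and Poisson brackets -/

section Symplectic

/-- The expression of a 2-form on `M` in the preferred chart at `x₀`: the pull-back of the form
by the inverse of the chart (meaningful on the target of the chart). -/
def twoFormInChart {E M : Type*} [NormedAddCommGroup E] [NormedSpace ℝ E]
    [TopologicalSpace M] [ChartedSpace E M]
    (Ω : ∀ x : M, (TangentSpace 𝓘(ℝ, E) x) [⋀^Fin 2]→L[ℝ] ℝ) (x₀ : M) (y : E) :
    E [⋀^Fin 2]→L[ℝ] ℝ :=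
  (Ω ((extChartAt 𝓘(ℝ, E) x₀).symm y)).compContinuousLinearMap
    (mfderiv 𝓘(ℝ, E) 𝓘(ℝ, E) (extChartAt 𝓘(ℝ, E) x₀).symm y)

/-- A symplectic form on a manifold `M` (without boundary, modelled on `E`): a smooth, closed,
non-degenerate 2-form. Smoothness and closedness are expressed in charts. -/
structure SymplecticForm (E M : Type*) [NormedAddCommGroup E] [NormedSpace ℝ E]
    [TopologicalSpace M] [ChartedSpace E M] where
  /-- the underlying field of alternating forms -/
  toForm : ∀ x : M, (TangentSpace 𝓘(ℝ, E) x) [⋀^Fin 2]→L[ℝ] ℝ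
  smooth : ∀ x₀ : M,
    ContDiffOn ℝ ∞ (twoFormInChart toForm x₀) (extChartAt 𝓘(ℝ, E) x₀).target
  closed : ∀ x₀ : M, ∀ y ∈ (extChartAt 𝓘(ℝ, E) x₀).target,
    extDeriv (twoFormInChart toForm x₀) y = 0
  nondegenerate : ∀ (x : M) (v : TangentSpace 𝓘(ℝ, E) x),
    (∀ w : TangentSpace 𝓘(ℝ, E) x, toForm x ![w, v] = 0) → v = 0

variable {E M : Type*} [NormedAddCommGroup E] [NormedSpace ℝ E]
  [TopologicalSpace M] [ChartedSpace E M]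

/-- The differential `df(x)` of a real function, as a covector at `x`. -/
def differential (f : M → ℝ) (x : M) : TangentSpace 𝓘(ℝ, E) x →L[ℝ] ℝ :=
  mfderiv 𝓘(ℝ, E) 𝓘(ℝ, ℝ) f x

theorem update_pair_one {V : Type*} (u v w : V) : Function.update ![u, v] 1 w = ![u, w] := by
  ext i; fin_cases i <;> simp

namespace SymplecticForm

/-- The form `Ω` at `x`, as a bilinear form on the tangent space. -/
def bilin (Ω : SymplecticForm E M) (x : M) : LinearMap.BilinForm ℝ (TangentSpace 𝓘(ℝ, E) x) :=
  LinearMap.mk₂ ℝ (fun u v => Ω.toForm x ![u, v])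
    (fun u u' v => (Ω.toForm x).vecCons_add ![v] u u')
    (fun c u v => (Ω.toForm x).vecCons_smul ![v] c u)
    (fun u v v' => by
      have h := (Ω.toForm x).map_update_add ![u, 0] 1 v v'
      rw [update_pair_one, update_pair_one, update_pair_one] at h
      exact h)
    (fun c u v => by
      have h := (Ω.toForm x).map_update_smul ![u, 0] 1 c v
      rw [update_pair_one, update_pair_one] at h
      exact h)

@[simp] theorem bilin_apply (Ω : SymplecticForm E M) (x : M) (u v : TangentSpace 𝓘(ℝ, E) x) :
    Ω.bilin x u v = Ω.toForm x ![u, v] := rfl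

variable [FiniteDimensional ℝ E]

/-- The linear map `v ↦ Ω(·, v)` from tangent vectors to covectors. -/
def flat (Ω : SymplecticForm E M) (x : M) :
    TangentSpace 𝓘(ℝ, E) x →ₗ[ℝ] (TangentSpace 𝓘(ℝ, E) x →L[ℝ] ℝ) :=
  haveI : FiniteDimensional ℝ (TangentSpace 𝓘(ℝ, E) x) := ‹FiniteDimensional ℝ E›
  haveI : T2Space (TangentSpace 𝓘(ℝ, E) x) := inferInstanceAs (T2Space E)
  (LinearMap.toContinuousLinearMap (𝕜 := ℝ) (E := TangentSpace 𝓘(ℝ, E) x) (F' := ℝ)).toLinearMap ∘ₗ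
    (Ω.bilin x).flip

@[simp] theorem flat_apply (Ω : SymplecticForm E M) (x : M) (v w : TangentSpace 𝓘(ℝ, E) x) :
    Ω.flat x v w = Ω.toForm x ![w, v] := rfl

theorem flat_bijective (Ω : SymplecticForm E M) (x : M) : Function.Bijective (Ω.flat x) := by
  have : FiniteDimensional ℝ (TangentSpace 𝓘(ℝ, E) x) := ‹FiniteDimensional ℝ E›
  have : T2Space (TangentSpace 𝓘(ℝ, E) x) := inferInstanceAs (T2Space E)
  have hinj : Function.Injective (Ω.flat x) := by
    rw [← LinearMap.ker_eq_bot, LinearMap.ker_eq_bot']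
    intro v hv
    refine Ω.nondegenerate x v fun w => ?_
    rw [← flat_apply, hv]; rfl
  have hdim : Module.finrank ℝ (TangentSpace 𝓘(ℝ, E) x) =
      Module.finrank ℝ (TangentSpace 𝓘(ℝ, E) x →L[ℝ] ℝ) := by
    rw [← (LinearMap.toContinuousLinearMap (𝕜 := ℝ) (E := TangentSpace 𝓘(ℝ, E) x)
      (F' := ℝ)).finrank_eq]
    exact (Subspace.dual_finrank_eq (K := ℝ) (V := TangentSpace 𝓘(ℝ, E) x)).symm
  have : FiniteDimensional ℝ (TangentSpace 𝓘(ℝ, E) x →L[ℝ] ℝ) :=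
    (LinearMap.toContinuousLinearMap (𝕜 := ℝ) (E := TangentSpace 𝓘(ℝ, E) x)
      (F' := ℝ)).finiteDimensional
  exact ⟨hinj, (LinearMap.injective_iff_surjective_of_finrank_eq_finrank hdim).1 hinj⟩

/-- The inverse of `v ↦ Ω(·, v)`: it sends a covector `α` to the vector `v` with
`Ω(·, v) = α`. -/
def sharp (Ω : SymplecticForm E M) (x : M) :
    (TangentSpace 𝓘(ℝ, E) x →L[ℝ] ℝ) ≃ₗ[ℝ] TangentSpace 𝓘(ℝ, E) x :=
  (LinearEquiv.ofBijective (Ω.flat x) (Ω.flat_bijective x)).symm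

/-- The symplectic gradient (Hamiltonian vector field) of `f`, given by
`df(w) = Ω(w, sgrad f)`. -/
def sgrad (Ω : SymplecticForm E M) (f : M → ℝ) (x : M) : TangentSpace 𝓘(ℝ, E) x :=
  Ω.sharp x (differential f x)

theorem toForm_sgrad (Ω : SymplecticForm E M) (f : M → ℝ) (x : M)
    (w : TangentSpace 𝓘(ℝ, E) x) :
    Ω.toForm x ![w, Ω.sgrad f x] = differential f x w := by
  rw [← flat_apply]
  exact congrArg (fun α : TangentSpace 𝓘(ℝ, E) x →L[ℝ] ℝ => α w)
    ((LinearEquiv.ofBijective (Ω.flat x) (Ω.flat_bijective x)).apply_symm_apply _)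

/-- The Poisson tensor at `x`: the bilinear form on covectors that corresponds to `Ω`. -/
def poissonTensor (Ω : SymplecticForm E M) (x : M) :
    LinearMap.BilinForm ℝ (TangentSpace 𝓘(ℝ, E) x →L[ℝ] ℝ) :=
  (Ω.bilin x).compl₁₂ (Ω.sharp x).toLinearMap (Ω.sharp x).toLinearMap

/-- The Poisson bracket `{f, g} = Ω(sgrad f, sgrad g)`. -/
def poissonBracket (Ω : SymplecticForm E M) (f g : M → ℝ) (x : M) : ℝ :=
  Ω.poissonTensor x (differential f x) (differential g x)

end SymplecticForm

/-! ### Complete algebras of functions and non-commutative integrability -/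

/-- `F_x`: the span of the differentials at `x` of the functions in `F`. -/
def differentialSpan (F : Subalgebra ℝ C^∞⟮𝓘(ℝ, E), M; ℝ⟯) (x : M) :
    Submodule ℝ (TangentSpace 𝓘(ℝ, E) x →L[ℝ] ℝ) :=
  Submodule.span ℝ ((fun f : C^∞⟮𝓘(ℝ, E), M; ℝ⟯ => differential (⇑f) x) '' (F : Set _))

namespace SymplecticForm

variable [FiniteDimensional ℝ E]

/-- `F` is a Poisson subalgebra of `C^∞(M)`: a subalgebra closed under the Poisson bracket. -/
def IsPoissonSubalgebra (Ω : SymplecticForm E M)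
    (F : Subalgebra ℝ C^∞⟮𝓘(ℝ, E), M; ℝ⟯) : Prop :=
  ∀ f ∈ F, ∀ g ∈ F, ∃ h ∈ F, ∀ x, h x = Ω.poissonBracket f g x

/-- `F` is complete: on an open dense set the numbers `dim F_x` and `dim ker {·,·}|_{F_x}` are
constant, equal to `l` and `r`, and `l + r = dim M`. -/
def IsComplete (Ω : SymplecticForm E M) (F : Subalgebra ℝ C^∞⟮𝓘(ℝ, E), M; ℝ⟯) : Prop :=
  ∃ l r : ℕ, l + r = Module.finrank ℝ E ∧
    ∃ U : Set M, IsOpen U ∧ Dense U ∧ ∀ x ∈ U,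
      Module.finrank ℝ (differentialSpan F x) = l ∧
      Module.finrank ℝ
        (LinearMap.ker ((Ω.poissonTensor x).restrict (differentialSpan F x))) = r

/-- `F` is a complete Poisson algebra of first integrals of `ẋ = sgrad H(x)`. -/
structure IsCompleteAlgebraOfIntegrals (Ω : SymplecticForm E M) (H : C^∞⟮𝓘(ℝ, E), M; ℝ⟯)
    (F : Subalgebra ℝ C^∞⟮𝓘(ℝ, E), M; ℝ⟯) : Prop where
  poisson : Ω.IsPoissonSubalgebra F
  first_integral : ∀ f ∈ F, ∀ x : M, differential (E := E) (⇑f) x (Ω.sgrad H x) = 0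
  complete : Ω.IsComplete F

/-- The Hamiltonian system `ẋ = sgrad H(x)` is completely integrable in the non-commutative
sense. -/
def CompletelyIntegrable (Ω : SymplecticForm E M) (H : C^∞⟮𝓘(ℝ, E), M; ℝ⟯) : Prop :=
  ∃ F : Subalgebra ℝ C^∞⟮𝓘(ℝ, E), M; ℝ⟯, Ω.IsCompleteAlgebraOfIntegrals H F

end SymplecticForm

end Symplectic

/-! ### Lie groups: tori and the coadjoint action -/

section LieGroups

/-- `G` is a torus: it is isomorphic, as a Lie group, to a finite power of the circle group. -/
def IsTorus (EG G : Type*) [NormedAddCommGroup EG] [NormedSpace ℝ EG]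
    [TopologicalSpace G] [ChartedSpace EG G] [Group G] : Prop :=
  ∃ (n : ℕ) (e : G ≃* (Fin n → Circle)),
    ContMDiff 𝓘(ℝ, EG) (ModelWithCorners.pi fun _ : Fin n => 𝓡 1) ∞ e ∧
    ContMDiff (ModelWithCorners.pi fun _ : Fin n => 𝓡 1) 𝓘(ℝ, EG) ∞ e.symm

variable {EG G : Type*} [NormedAddCommGroup EG] [NormedSpace ℝ EG]
  [TopologicalSpace G] [ChartedSpace EG G] [Group G]

/-- The adjoint action of `g` on the Lie algebra `T_1 G`: the differential at `1` of
`h ↦ g h g⁻¹`. -/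
def adjointMap (g : G) :
    GroupLieAlgebra 𝓘(ℝ, EG) G →L[ℝ] GroupLieAlgebra 𝓘(ℝ, EG) G :=
  mfderiv 𝓘(ℝ, EG) 𝓘(ℝ, EG) (fun h : G => g * h * g⁻¹) 1

/-- The coadjoint action `(Ad*_g η)(a) = η(Ad_{g⁻¹} a)` on the dual of the Lie algebra. -/
def coadjointMap (g : G) (η : GroupLieAlgebra 𝓘(ℝ, EG) G →L[ℝ] ℝ) :
    GroupLieAlgebra 𝓘(ℝ, EG) G →L[ℝ] ℝ :=
  η.comp (adjointMap g⁻¹)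

theorem adjointMap_one : adjointMap (EG := EG) (1 : G) = ContinuousLinearMap.id ℝ _ := by
  have h : (fun h : G => 1 * h * (1 : G)⁻¹) = id := by ext; simp
  unfold adjointMap
  rw [h]
  exact mfderiv_id

theorem adjointMap_mul [LieGroup 𝓘(ℝ, EG) ∞ G] (g k : G) :
    adjointMap (EG := EG) (g * k) = (adjointMap g).comp (adjointMap k) := by
  have hd : ∀ (a x : G), MDifferentiableAt 𝓘(ℝ, EG) 𝓘(ℝ, EG) (fun h : G => a * h * a⁻¹) x := by
    intro a x
    have h1 : ContMDiff 𝓘(ℝ, EG) 𝓘(ℝ, EG) ∞ (fun h : G => a * h * a⁻¹) :=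
      (contMDiff_mul_right (I := 𝓘(ℝ, EG)) (n := ∞) (a := a⁻¹)).comp
        (contMDiff_mul_left (I := 𝓘(ℝ, EG)) (n := ∞) (a := a))
    exact h1.mdifferentiableAt (by simp)
  have hc : (fun h : G => g * k * h * (g * k)⁻¹) =
      (fun h : G => g * h * g⁻¹) ∘ (fun h : G => k * h * k⁻¹) := by
    ext h; simp [mul_assoc]
  have h1 : k * 1 * k⁻¹ = (1 : G) := by simp
  unfold adjointMap
  rw [hc]
  refine (mfderiv_comp (1 : G) (hd g _) (hd k 1)).trans ?_
  rw [h1]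
  rfl

/-- The isotropy group `G_η` of `η` for the coadjoint action. -/
def coadjointIsotropy [LieGroup 𝓘(ℝ, EG) ∞ G] (η : GroupLieAlgebra 𝓘(ℝ, EG) G →L[ℝ] ℝ) :
    Subgroup G where
  carrier := {g | coadjointMap g η = η}
  one_mem' := by
    simp only [Set.mem_ofPred_eq, coadjointMap, inv_one]
    rw [adjointMap_one]; rfl
  mul_mem' := by
    intro a b ha hb
    simp only [Set.mem_ofPred_eq, coadjointMap] at ha hb ⊢
    rw [mul_inv_rev, adjointMap_mul, ← ContinuousLinearMap.comp_assoc, hb, ha]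
  inv_mem' := by
    intro a ha
    simp only [Set.mem_ofPred_eq, coadjointMap] at ha ⊢
    conv_lhs => rw [← ha]
    rw [ContinuousLinearMap.comp_assoc, ← adjointMap_mul, inv_inv, inv_mul_cancel, adjointMap_one]
    rfl

end LieGroups

/-! ### Hamiltonian actions and symplectic reduction -/

section Reduction

variable {E M EG G : Type*}
  [NormedAddCommGroup E] [NormedSpace ℝ E] [TopologicalSpace M] [ChartedSpace E M]
  [NormedAddCommGroup EG] [NormedSpace ℝ EG] [TopologicalSpace G] [ChartedSpace EG G] [Group G]
  [MulAction G M]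

/-- The fundamental vector field of `a` in the Lie algebra, `d/dt (exp(ta) • x)` at `t = 0`:
the image of `a` under the differential at `1` of the orbit map `g ↦ g • x`. It is a tangent
vector at `1 • x = x`. -/
def fundamentalField (a : GroupLieAlgebra 𝓘(ℝ, EG) G) (x : M) : TangentSpace 𝓘(ℝ, E) x :=
  (mfderiv 𝓘(ℝ, EG) 𝓘(ℝ, E) (fun g : G => g • x) 1 a : TangentSpace 𝓘(ℝ, E) ((1 : G) • x))

/-- The smooth action of `G` on the symplectic manifold `(M, Ω)` is Hamiltonian with equivariant
moment map `Φ : M → 𝔤*`. -/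
structure IsHamiltonianAction [FiniteDimensional ℝ E] (Ω : SymplecticForm E M)
    (Φ : M → (GroupLieAlgebra 𝓘(ℝ, EG) G →L[ℝ] ℝ)) : Prop where
  smooth_action : ContMDiffSMul 𝓘(ℝ, EG) 𝓘(ℝ, E) ∞ G M
  symplectic : ∀ (g : G) (x : M) (u v : TangentSpace 𝓘(ℝ, E) x),
    Ω.toForm (g • x) ![mfderiv 𝓘(ℝ, E) 𝓘(ℝ, E) (fun y : M => g • y) x u,
      mfderiv 𝓘(ℝ, E) 𝓘(ℝ, E) (fun y : M => g • y) x v] = Ω.toForm x ![u, v]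
  smooth_moment : ∀ a : GroupLieAlgebra 𝓘(ℝ, EG) G,
    ContMDiff 𝓘(ℝ, E) 𝓘(ℝ, ℝ) ∞ (fun x : M => Φ x a)
  sgrad_moment : ∀ (a : GroupLieAlgebra 𝓘(ℝ, EG) G) (x : M),
    Ω.sgrad (fun y : M => Φ y a) x = fundamentalField a x
  equivariant : ∀ (g : G) (x : M), Φ (g • x) = coadjointMap g (Φ x)

/-- The reduced space `M_η = Φ⁻¹(η) / G_η`, with the quotient topology. -/
def ReducedSpace [LieGroup 𝓘(ℝ, EG) ∞ G] (Φ : M → (GroupLieAlgebra 𝓘(ℝ, EG) G →L[ℝ] ℝ))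
    (η : GroupLieAlgebra 𝓘(ℝ, EG) G →L[ℝ] ℝ) : Type _ :=
  Quotient ((MulAction.orbitRel (coadjointIsotropy η) M).comap (Subtype.val : Φ ⁻¹' {η} → M))

instance [LieGroup 𝓘(ℝ, EG) ∞ G] (Φ : M → (GroupLieAlgebra 𝓘(ℝ, EG) G →L[ℝ] ℝ))
    (η : GroupLieAlgebra 𝓘(ℝ, EG) G →L[ℝ] ℝ) : TopologicalSpace (ReducedSpace Φ η) :=
  inferInstanceAs (TopologicalSpace (Quotient _))

/-- The natural projection `π : Φ⁻¹(η) → M_η`. -/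
def reducedProj [LieGroup 𝓘(ℝ, EG) ∞ G] (Φ : M → (GroupLieAlgebra 𝓘(ℝ, EG) G →L[ℝ] ℝ))
    (η : GroupLieAlgebra 𝓘(ℝ, EG) G →L[ℝ] ℝ) : Φ ⁻¹' {η} → ReducedSpace Φ η :=
  Quotient.mk _

/-- The reduced symplectic manifold `(M_η, Ω_η)`: the level set `Φ⁻¹(η)` is an embedded
submanifold of `M` (it carries the subspace topology, and the inclusion is a smooth immersion),
`M_η` is a smooth manifold for which the projection `π : Φ⁻¹(η) → M_η` is a submersion, and the
symplectic form `Ω_η` satisfies `Ω_η(dπ u, dπ v) = Ω(u, v)` for `u, v` tangent to `Φ⁻¹(η)`.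
These conditions determine both manifold structures and `Ω_η` uniquely. -/
structure ReducedSymplecticManifold [LieGroup 𝓘(ℝ, EG) ∞ G] (Ω : SymplecticForm E M)
    (Φ : M → (GroupLieAlgebra 𝓘(ℝ, EG) G →L[ℝ] ℝ))
    (η : GroupLieAlgebra 𝓘(ℝ, EG) G →L[ℝ] ℝ) where
  /-- the dimension of the level set -/
  dimLevel : ℕ
  [chartedLevel : ChartedSpace (EuclideanSpace ℝ (Fin dimLevel)) (Φ ⁻¹' {η})]
  [manifoldLevel : IsManifold (𝓡 dimLevel) ∞ (Φ ⁻¹' {η})]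
  smooth_incl : ContMDiff (𝓡 dimLevel) 𝓘(ℝ, E) ∞ (Subtype.val : Φ ⁻¹' {η} → M)
  immersion_incl : ∀ z : Φ ⁻¹' {η},
    Function.Injective (mfderiv (𝓡 dimLevel) 𝓘(ℝ, E) (Subtype.val : Φ ⁻¹' {η} → M) z)
  /-- the dimension of the reduced space -/
  dim : ℕ
  [charted : ChartedSpace (EuclideanSpace ℝ (Fin dim)) (ReducedSpace Φ η)]
  [manifold : IsManifold (𝓡 dim) ∞ (ReducedSpace Φ η)]
  hausdorff : T2Space (ReducedSpace Φ η)
  secondCountable : SecondCountableTopology (ReducedSpace Φ η)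
  smooth_proj : ContMDiff (𝓡 dimLevel) (𝓡 dim) ∞ (reducedProj Φ η)
  submersion_proj : ∀ z : Φ ⁻¹' {η},
    Function.Surjective (mfderiv (𝓡 dimLevel) (𝓡 dim) (reducedProj Φ η) z)
  /-- the reduced symplectic form -/
  form : SymplecticForm (EuclideanSpace ℝ (Fin dim)) (ReducedSpace Φ η)
  form_proj : ∀ (z : Φ ⁻¹' {η}) (u v : TangentSpace (𝓡 dimLevel) z),
    form.toForm (reducedProj Φ η z)
        ![mfderiv (𝓡 dimLevel) (𝓡 dim) (reducedProj Φ η) z u,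
          mfderiv (𝓡 dimLevel) (𝓡 dim) (reducedProj Φ η) z v] =
      Ω.toForm (z : M)
        ![mfderiv (𝓡 dimLevel) 𝓘(ℝ, E) (Subtype.val : Φ ⁻¹' {η} → M) z u,
          mfderiv (𝓡 dimLevel) 𝓘(ℝ, E) (Subtype.val : Φ ⁻¹' {η} → M) z v]

attribute [instance] ReducedSymplecticManifold.charted

/-- The reduced system is completely integrable: `M_η` carries its reduced symplectic structure,
the `G`-invariant function `H` induces a smooth function `H_η` on it, with
`H_η ∘ π = H` on `Φ⁻¹(η)`, and the Hamiltonian system of `H_η` is completely integrable in the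
non-commutative sense. -/
def ReducedSystemCompletelyIntegrable [LieGroup 𝓘(ℝ, EG) ∞ G] (Ω : SymplecticForm E M)
    (Φ : M → (GroupLieAlgebra 𝓘(ℝ, EG) G →L[ℝ] ℝ)) (H : C^∞⟮𝓘(ℝ, E), M; ℝ⟯)
    (η : GroupLieAlgebra 𝓘(ℝ, EG) G →L[ℝ] ℝ) : Prop :=
  ∃ (R : ReducedSymplecticManifold Ω Φ η) (Hη : C^∞⟮𝓡 R.dim, ReducedSpace Φ η; ℝ⟯),
    (∀ z : Φ ⁻¹' {η}, Hη (reducedProj Φ η z) = H z) ∧ R.form.CompletelyIntegrable Hη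

end Reduction

end

/-! Write n = dim G, m = dim M, and φ_a for the component of the moment map along a. At a regular
point x the equality dim F_x + dim ker = dim M says that F_x contains its own Poisson orthogonal:
the orthogonal has dimension m - l = r, and the kernel, which is the intersection of F_x with it,
already has that dimension (`mem_of_forall_bilin_eq_zero`). For invariant f one has {φ_a, f} =
df(a_M) = 0, so dφ_a(x) is orthogonal to F_x and hence lies in F_x. It is therefore a combination of
differentials of invariant functions and vanishes on orbit directions. By density this holds on all
of M, and since G is connected Φ is G-invariant (`moment_smul`).

Invariance and equivariance together give φ_b = 0 for b = Ad_g a - a, so b generates the zero vector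
field and vanishes by effectiveness. The adjoint action is thus trivial, a connected group with
trivial adjoint action is commutative, and a compact connected commutative Lie group is the quotient
of its Lie algebra by the lattice ker exp, that is, a torus.

Now let the action be free. Since Φ is invariant, every η in its image has G_η = G. The annihilator
of the image of dΦ consists of the a whose field vanishes at the point, so Φ is a submersion. Its
fibres are submanifolds of dimension m - n, and their quotients by the free compact action are
symplectic manifolds of dimension m - 2n. The integrals descend. Over a regular point the map from
F_x to the span of the reduced differentials is onto and preserves Poisson tensors, and its kernel
is the n-dimensional space of the dφ_a, which lies in the radical of the form on F_x. Both l and r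
therefore drop by n, and (l - n) + (r - n) = m - 2n is completeness of the reduced algebra
(`finrank_inducedSubalgebra`).

The word generic enters only because the regular set U must be dense in the fibre. As Φ is open, a
value η can fail this only if it lies on the frontier of one of the open sets Φ(B ∩ U), with B in a
countable basis; these frontiers are closed and nowhere dense
(`eventually_residual_dense_preimage`). -/

open Set Filter Topology
open scoped Manifold ContDiff

noncomputable section

/-! ### Inverse function theorem on manifolds without boundary -/

section InverseFunction

variable {E : Type*} [NormedAddCommGroup E] [NormedSpace ℝ E] [CompleteSpace E]
  {F : Type*} [NormedAddCommGroup F] [NormedSpace ℝ F] [CompleteSpace F]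

/-- The inverse function theorem for smooth maps, with a smooth inverse on an open set. -/
theorem ContDiffOn.exists_openPartialHomeomorph {f : E → F} {S : Set E} {x : E}
    (hf : ContDiffOn ℝ ∞ f S) (hS : IsOpen S) (hx : x ∈ S)
    (hbij : Function.Bijective (fderiv ℝ f x)) :
    ∃ e : OpenPartialHomeomorph E F, x ∈ e.source ∧ e.source ⊆ S ∧ (⇑e = f) ∧
      ContDiffOn ℝ ∞ e.symm e.target := by
  have hfx : ContDiffAt ℝ ∞ f x := hf.contDiffAt (hS.mem_nhds hx)
  let f' : E ≃L[ℝ] F := ContinuousLinearEquiv.ofBijective (fderiv ℝ f x)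
    (LinearMap.ker_eq_bot.2 hbij.1) (LinearMap.range_eq_top.2 hbij.2)
  have hf'c : (f' : E →L[ℝ] F) = fderiv ℝ f x := ContinuousLinearEquiv.coe_ofBijective _ _ _
  have hf' : HasFDerivAt f (f' : E →L[ℝ] F) x := by
    rw [hf'c]
    exact (hfx.differentiableAt (by simp)).hasFDerivAt
  let e₀ := hfx.toOpenPartialHomeomorph f hf' (by simp)
  -- The derivative must be invertible on the whole source, not only at x, for the inverse to be
  -- smooth on the whole target. Invertibility is an open condition, so the source can be cut down.
  let T : Set E := S ∩ fderiv ℝ f ⁻¹' (range ((↑) : (E ≃L[ℝ] F) → E →L[ℝ] F))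
  have hT : IsOpen T :=
    (hf.continuousOn_fderiv_of_isOpen hS (by simp)).isOpen_inter_preimage hS
      ContinuousLinearEquiv.isOpen
  refine ⟨e₀.restrOpen T hT, ?_, ?_, ?_, ?_⟩
  · exact ⟨hfx.mem_toOpenPartialHomeomorph_source hf' (by simp), hx, f', hf'c⟩
  · exact fun y hy => hy.2.1
  · rfl
  · intro y hy
    have hy' := (e₀.restrOpen T hT).map_target hy
    obtain ⟨g', hg'⟩ := hy'.2.2
    refine ContDiffAt.contDiffWithinAt ?_
    have hc : ContDiffAt ℝ ∞ f ((e₀.restrOpen T hT).symm y) :=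
      hf.contDiffAt (hS.mem_nhds hy'.2.1)
    refine (e₀.restrOpen T hT).contDiffAt_symm (f₀' := g') hy ?_ hc
    rw [hg']
    exact (hc.differentiableAt (by simp)).hasFDerivAt

variable {H : Type*} [TopologicalSpace H] {I : ModelWithCorners ℝ E H} [I.Boundaryless]
  {H' : Type*} [TopologicalSpace H'] {J : ModelWithCorners ℝ F H'} [J.Boundaryless]
  {M : Type*} [TopologicalSpace M] [ChartedSpace H M] [IsManifold I ∞ M]
  {N : Type*} [TopologicalSpace N] [ChartedSpace H' N] [IsManifold J ∞ N]

variable (I) in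
/-- The extended chart at a point of a manifold without boundary, as an open partial
homeomorphism. -/
def openExtChartAt (x : M) : OpenPartialHomeomorph M E :=
  (chartAt H x).transHomeomorph I.toHomeomorph

omit [CompleteSpace E] [IsManifold I ∞ M] in
theorem openExtChartAt_source (x : M) : (openExtChartAt I x).source = (extChartAt I x).source := by
  simp [openExtChartAt, extChartAt]

omit [CompleteSpace E] [IsManifold I ∞ M] in
theorem openExtChartAt_target (x : M) : (openExtChartAt I x).target = (extChartAt I x).target := by
  simp [openExtChartAt, extChartAt, I.range_eq_univ]
  rfl

/-- The inverse function theorem for smooth maps between manifolds. -/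
theorem ContMDiffOn.exists_openPartialHomeomorph {f : M → N} {S : Set M} {x : M}
    (hf : ContMDiffOn I J ∞ f S) (hS : IsOpen S) (hx : x ∈ S)
    (hbij : Function.Bijective (mfderiv I J f x)) :
    ∃ e : OpenPartialHomeomorph M N, x ∈ e.source ∧ e.source ⊆ S ∧ EqOn e f e.source ∧
      ContMDiffOn J I ∞ e.symm e.target := by
  let a := openExtChartAt I x
  let b := openExtChartAt J (f x)
  have ha : ContMDiffOn 𝓘(ℝ, E) I ∞ a.symm a.target := by
    have := contMDiffOn_extChartAt_symm (I := I) (n := ∞) x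
    rwa [← openExtChartAt_target] at this
  have ha' : ContMDiffOn I 𝓘(ℝ, E) ∞ a a.source := by
    have := contMDiffOn_extChartAt (I := I) (n := ∞) (x := x)
    rw [← extChartAt_source I, ← openExtChartAt_source] at this
    exact this
  have hb : ContMDiffOn 𝓘(ℝ, F) J ∞ b.symm b.target := by
    have := contMDiffOn_extChartAt_symm (I := J) (n := ∞) (f x)
    rwa [← openExtChartAt_target] at this
  have hb' : ContMDiffOn J 𝓘(ℝ, F) ∞ b b.source := by
    have := contMDiffOn_extChartAt (I := J) (n := ∞) (x := f x)
    rw [← extChartAt_source J, ← openExtChartAt_source] at this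
    exact this
  have hxa : x ∈ a.source := by
    simp only [a, openExtChartAt_source]; exact mem_extChartAt_source x
  have hxb : f x ∈ b.source := by
    simp only [b, openExtChartAt_source]; exact mem_extChartAt_source _
  let S' : Set M := S ∩ f ⁻¹' b.source
  have hS' : IsOpen S' := hf.continuousOn.isOpen_inter_preimage hS b.open_source
  let T : Set E := a.target ∩ a.symm ⁻¹' S'
  have hT : IsOpen T := a.symm.isOpen_inter_preimage hS'
  have hg : ContMDiffOn 𝓘(ℝ, E) 𝓘(ℝ, F) ∞ (b ∘ f ∘ a.symm) T :=
    hb'.comp (hf.comp (ha.mono inter_subset_left) fun y hy => hy.2.1) fun y hy => hy.2.2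
  have hxS' : x ∈ S' := ⟨hx, hxb⟩
  have hxT : a x ∈ T := ⟨a.map_source hxa, by simpa [a.left_inv hxa] using hxS'⟩
  have hda := (OpenPartialHomeomorph.MDifferentiable.symm
    ⟨ha'.mdifferentiableOn (by simp), ha.mdifferentiableOn (by simp)⟩).mfderiv_bijective hxT.1
  have hdb := (OpenPartialHomeomorph.MDifferentiable.mfderiv_bijective
    ⟨hb'.mdifferentiableOn (by simp), hb.mdifferentiableOn (by simp)⟩ hxb)
  have hbij' : Function.Bijective (fderiv ℝ (b ∘ f ∘ a.symm) (a x)) := by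
    have hax := a.left_inv hxa
    have h1 : MDifferentiableAt 𝓘(ℝ, E) I a.symm (a x) :=
      (ha.contMDiffAt (a.open_target.mem_nhds hxT.1)).mdifferentiableAt (by simp)
    have h2 : MDifferentiableAt I J f (a.symm (a x)) := by
      rw [hax]
      exact (hf.contMDiffAt (hS.mem_nhds hx)).mdifferentiableAt (by simp)
    have h3 : MDifferentiableAt J 𝓘(ℝ, F) b (f (a.symm (a x))) := by
      rw [hax]
      exact (hb'.contMDiffAt (b.open_source.mem_nhds hxb)).mdifferentiableAt (by simp)
    have h4 := mfderiv_comp (a x) (g := b) (f := f ∘ a.symm) h3 (h2.comp _ h1)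
    rw [mfderiv_comp (a x) h2 h1] at h4
    have h5 : (fderiv ℝ (b ∘ f ∘ a.symm) (a x) : E → F) =
        (mfderiv J 𝓘(ℝ, F) b (f (a.symm (a x)))) ∘ (mfderiv I J f (a.symm (a x))) ∘
        (mfderiv 𝓘(ℝ, E) I a.symm (a x)) := by
      rw [← mfderiv_eq_fderiv]
      funext v
      exact DFunLike.congr_fun h4 v
    rw [h5]
    rw [← hax] at hbij hdb
    exact hdb.comp (hbij.comp hda)
  obtain ⟨c, hxc, hcT, hcf, hcs⟩ :=
    hg.contDiffOn.exists_openPartialHomeomorph hT hxT hbij'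
  refine ⟨(a.trans c).trans b.symm, ?_, ?_, ?_, ?_⟩
  · simp
    refine ⟨⟨hxa, hxc⟩, ?_⟩
    rw [hcf]
    simp [a.left_inv hxa]
    exact b.map_source hxb
  · rintro y hy
    simp at hy
    have := (hcT hy.1.2).2.1
    rwa [a.left_inv hy.1.1] at this
  · rintro y hy
    simp at hy
    have := (hcT hy.1.2).2.2
    rw [mem_preimage, a.left_inv hy.1.1] at this
    simp [hcf, a.left_inv hy.1.1]
    exact b.left_inv this
  · have : (((a.trans c).trans b.symm).symm : N → M) = a.symm ∘ c.symm ∘ b := by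
      ext y; simp
    rw [this]
    have hsub : ((a.trans c).trans b.symm).target ⊆
        b.source ∩ b ⁻¹' (c.target ∩ c.symm ⁻¹' a.target) := by
      intro y hy
      simpa [OpenPartialHomeomorph.trans_target] using hy
    refine ha.comp ((contMDiffOn_iff_contDiffOn.2 hcs).comp (hb'.mono ?_) ?_) ?_
    · exact fun y hy => (hsub hy).1
    · exact fun y hy => (hsub hy).2.1
    · exact fun y hy => (hsub hy).2.2

end InverseFunction

/-! ### Maps with zero differential, and regularity of autonomous ODEs -/

section ZeroDerivative

variable {E : Type*} [NormedAddCommGroup E] [NormedSpace ℝ E]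
  {F : Type*} [NormedAddCommGroup F] [NormedSpace ℝ F]
  {M : Type*} [TopologicalSpace M] [ChartedSpace E M] [IsManifold 𝓘(ℝ, E) ∞ M]
  {N : Type*} [TopologicalSpace N] [ChartedSpace F N] [IsManifold 𝓘(ℝ, F) ∞ N]

/-- A map between manifolds whose differential vanishes is locally constant. -/
theorem isLocallyConstant_of_hasMFDerivAt_zero {f : M → N}
    (hf : ∀ x, HasMFDerivAt 𝓘(ℝ, E) 𝓘(ℝ, F) f x 0) : IsLocallyConstant f := by
  rw [IsLocallyConstant.iff_eventually_eq]
  intro x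
  let a := extChartAt 𝓘(ℝ, E) x
  let b := extChartAt 𝓘(ℝ, F) (f x)
  have hcont : ContinuousAt f x := (hf x).continuousAt
  have h1 : f ⁻¹' b.source ∈ 𝓝 x := hcont (extChartAt_source_mem_nhds _)
  have hsymm : Tendsto a.symm (𝓝 (a x)) (𝓝 x) := by
    have := continuousAt_extChartAt_symm (I := 𝓘(ℝ, E)) x
    rw [ContinuousAt, extChartAt_to_inv] at this
    exact this
  have h2 : a.target ∩ a.symm ⁻¹' (f ⁻¹' b.source) ∈ 𝓝 (a x) :=
    inter_mem (extChartAt_target_mem_nhds x) (hsymm h1)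
  obtain ⟨r, hr, hball⟩ := Metric.mem_nhds_iff.1 h2
  have h3 : ∀ y ∈ Metric.ball (a x) r, HasFDerivAt (b ∘ f ∘ a.symm) (0 : E →L[ℝ] F) y := by
    intro y hy
    have hy' := hball hy
    have e1 : MDifferentiableAt 𝓘(ℝ, E) 𝓘(ℝ, E) a.symm y :=
      ((contMDiffOn_extChartAt_symm (I := 𝓘(ℝ, E)) (n := ∞) x).contMDiffAt
        ((isOpen_extChartAt_target x).mem_nhds hy'.1)).mdifferentiableAt (by simp)
    have e2 : MDifferentiableAt 𝓘(ℝ, F) 𝓘(ℝ, F) b (f (a.symm y)) := by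
      refine mdifferentiableAt_extChartAt ?_
      rw [← extChartAt_source 𝓘(ℝ, F)]
      exact hy'.2
    have e3 := e2.hasMFDerivAt.comp y ((hf (a.symm y)).comp y e1.hasMFDerivAt)
    have e4 := e3.hasFDerivAt
    refine e4.congr_fderiv ?_
    ext v
    exact map_zero (mfderiv 𝓘(ℝ, F) 𝓘(ℝ, F) b (f (a.symm y)))
  have h4 : ∀ y ∈ Metric.ball (a x) r, (b ∘ f ∘ a.symm) y = (b ∘ f ∘ a.symm) (a x) := by
    intro y hy
    refine (convex_ball (a x) r).is_const_of_fderivWithin_eq_zero (𝕜 := ℝ)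
      (fun z hz => (h3 z hz).differentiableAt.differentiableWithinAt) ?_ hy
      (Metric.mem_ball_self hr)
    intro z hz
    rw [fderivWithin_of_isOpen Metric.isOpen_ball hz]
    exact (h3 z hz).fderiv
  have h5 : ∀ᶠ y in 𝓝 x, a y ∈ Metric.ball (a x) r :=
    (continuousAt_extChartAt (I := 𝓘(ℝ, E)) x) (Metric.ball_mem_nhds _ hr)
  filter_upwards [h5, extChartAt_source_mem_nhds (I := 𝓘(ℝ, E)) x, h1] with y hy hy2 hy3
  have := h4 _ hy
  simp only [Function.comp_apply] at this
  rw [a.left_inv hy2, a.left_inv (mem_extChartAt_source x)] at this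
  exact b.injOn hy3 (mem_extChartAt_source _) this

theorem eq_of_hasMFDerivAt_zero [PreconnectedSpace M] {f : M → N}
    (hf : ∀ x, HasMFDerivAt 𝓘(ℝ, E) 𝓘(ℝ, F) f x 0) (x y : M) : f x = f y :=
  (isLocallyConstant_of_hasMFDerivAt_zero hf).apply_eq_of_preconnectedSpace x y

end ZeroDerivative

section AutonomousODE

variable {E : Type*} [NormedAddCommGroup E] [NormedSpace ℝ E]

/-- Solutions of a smooth autonomous differential equation are smooth. -/
theorem contDiffOn_of_hasDerivAt_autonomous {x : ℝ → E} {w : E → E} {S : Set ℝ} {W : Set E}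
    (hS : IsOpen S) (hW : ContDiffOn ℝ ∞ w W) (hxW : MapsTo x S W)
    (hx : ∀ t ∈ S, HasDerivAt x (w (x t)) t) : ContDiffOn ℝ ∞ x S := by
  rw [contDiffOn_infty]
  intro n
  induction n with
  | zero =>
    exact contDiffOn_zero.2 fun t ht => (hx t ht).continuousAt.continuousWithinAt
  | succ n ih =>
    push_cast
    rw [contDiffOn_succ_iff_deriv_of_isOpen hS]
    refine ⟨fun t ht => (hx t ht).differentiableAt.differentiableWithinAt, by simp, ?_⟩
    -- Bootstrap: the derivative of x is w ∘ x, which is as smooth as x itself.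
    refine ((hW.of_le (by exact_mod_cast le_top)).comp ih hxW).congr fun t ht => ?_
    exact (hx t ht).deriv

end AutonomousODE

/-! ### Left-invariant fields and one-parameter subgroups -/

section OneParameterSubgroups

variable {EG G : Type*} [NormedAddCommGroup EG] [NormedSpace ℝ EG] [CompleteSpace EG]
  [TopologicalSpace G] [ChartedSpace EG G] [Group G] [LieGroup 𝓘(ℝ, EG) ∞ G] [T2Space G]

omit [CompleteSpace EG] [T2Space G] in
theorem mdifferentiableAt_mulLeft (g h : G) :
    MDifferentiableAt 𝓘(ℝ, EG) 𝓘(ℝ, EG) (fun k : G => g * k) h :=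
  (contMDiff_mul_left (I := 𝓘(ℝ, EG)) (n := ∞) (a := g)).mdifferentiableAt (by simp)

omit [CompleteSpace EG] [T2Space G] in
theorem hasMFDerivAt_mul_left (g h : G) :
    HasMFDerivAt 𝓘(ℝ, EG) 𝓘(ℝ, EG) (fun k : G => g * k) h
      (mfderiv 𝓘(ℝ, EG) 𝓘(ℝ, EG) (fun k : G => g * k) h) :=
  (mdifferentiableAt_mulLeft g h).hasMFDerivAt

omit [CompleteSpace EG] [T2Space G] in
-- The chain rule applied to left translation by g * h, factored as translation by h followed by
-- translation by g.
theorem mfderiv_mul_left_mulInvariantVectorField (a : GroupLieAlgebra 𝓘(ℝ, EG) G) (g h : G) :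
    mfderiv 𝓘(ℝ, EG) 𝓘(ℝ, EG) (fun k : G => g * k) h (mulInvariantVectorField a h) =
      mulInvariantVectorField a (g * h) := by
  have h1 : (fun k : G => g * h * k) = (fun k => g * k) ∘ (fun k => h * k) := by
    ext k; simp [mul_assoc]
  have h2 : mfderiv 𝓘(ℝ, EG) 𝓘(ℝ, EG) (fun k : G => g * h * k) 1 =
      (mfderiv 𝓘(ℝ, EG) 𝓘(ℝ, EG) (fun k : G => g * k) (h * 1)).comp
        (mfderiv 𝓘(ℝ, EG) 𝓘(ℝ, EG) (fun k : G => h * k) 1) := by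
    rw [h1]
    exact mfderiv_comp (1 : G) (mdifferentiableAt_mulLeft g _) (mdifferentiableAt_mulLeft h 1)
  -- The points h and h * 1 are only propositionally equal. Viewing both derivatives as
  -- endomorphisms of EG allows the rewriting.
  have h3 : ∀ (y : G) (v : EG), y = h * 1 →
      (mfderiv 𝓘(ℝ, EG) 𝓘(ℝ, EG) (fun k : G => g * k) y : EG →L[ℝ] EG) v =
        (mfderiv 𝓘(ℝ, EG) 𝓘(ℝ, EG) (fun k : G => g * k) (h * 1) : EG →L[ℝ] EG) v := by
    rintro _ v rfl; rfl
  exact (h3 h _ (mul_one h).symm).trans (DFunLike.congr_fun h2 a).symm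

omit [CompleteSpace EG] [T2Space G] in
-- C¹ regularity is what existence and uniqueness of integral curves require.
theorem contMDiff_one_mulInvariantVectorField (a : GroupLieAlgebra 𝓘(ℝ, EG) G) :
    ContMDiff 𝓘(ℝ, EG) 𝓘(ℝ, EG).tangent 1
      (fun g : G => (⟨g, mulInvariantVectorField a g⟩ : TangentBundle 𝓘(ℝ, EG) G)) := by
  have : LieGroup 𝓘(ℝ, EG) (minSmoothness ℝ 3) G := by
    refine LieGroup.of_le (n := ∞) ?_
    simp [minSmoothness_of_isRCLikeNormedField]
    exact WithTop.coe_le_coe.2 (le_top (a := (3 : ℕ∞)))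
  refine (contMDiff_mulInvariantVectorField (I := 𝓘(ℝ, EG)) a).of_le ?_
  simp [minSmoothness_of_isRCLikeNormedField]

omit [CompleteSpace EG] [T2Space G] in
theorem IsMIntegralCurveOn.mul_left {a : GroupLieAlgebra 𝓘(ℝ, EG) G} {γ : ℝ → G} {s : Set ℝ}
    (hγ : IsMIntegralCurveOn γ (mulInvariantVectorField (I := 𝓘(ℝ, EG)) a) s) (g : G) :
    IsMIntegralCurveOn (fun t => g * γ t) (mulInvariantVectorField (I := 𝓘(ℝ, EG)) a) s := by
  intro t ht
  have h := (hasMFDerivAt_mul_left (EG := EG) g (γ t)).comp_hasMFDerivWithinAt t (hγ t ht)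
  refine h.congr_mfderiv ?_
  ext
  change mfderiv 𝓘(ℝ, EG) 𝓘(ℝ, EG) (fun k : G => g * k) (γ t)
    ((1 : ℝ) • mulInvariantVectorField a (γ t)) = (1 : ℝ) • mulInvariantVectorField a (g * γ t)
  rw [map_smul, mfderiv_mul_left_mulInvariantVectorField]

/-- For every `a` in the Lie algebra there is an integral curve of the corresponding
left-invariant vector field through `1`. -/
theorem exists_isMIntegralCurve_mulInvariantVectorField (a : GroupLieAlgebra 𝓘(ℝ, EG) G) :
    ∃ γ : ℝ → G, γ 0 = 1 ∧
      IsMIntegralCurve γ (mulInvariantVectorField (I := 𝓘(ℝ, EG)) a) := by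
  obtain ⟨γ, hγ0, hγ⟩ := exists_isMIntegralCurveAt_of_contMDiffAt_boundaryless (t₀ := 0)
    ((contMDiff_one_mulInvariantVectorField a) (1 : G))
  rw [isMIntegralCurveAt_iff'] at hγ
  obtain ⟨ε, hε, hγ⟩ := hγ
  -- Left translates of one local curve through 1 give curves with the same lifetime ε through every
  -- point, so the field is complete.
  refine exists_isMIntegralCurve_of_isMIntegralCurveOn
    (contMDiff_one_mulInvariantVectorField a) hε (fun g => ⟨fun t => g * γ t, by simp [hγ0], ?_⟩) 1
  refine (hγ.mono ?_).mul_left g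
  rw [Real.ball_eq_Ioo]
  simp

/-- The one-parameter subgroup `t ↦ exp (ta)` generated by `a`. -/
def oneParam (a : GroupLieAlgebra 𝓘(ℝ, EG) G) : ℝ → G :=
  (exists_isMIntegralCurve_mulInvariantVectorField a).choose

theorem oneParam_zero (a : GroupLieAlgebra 𝓘(ℝ, EG) G) : oneParam a 0 = 1 :=
  (exists_isMIntegralCurve_mulInvariantVectorField a).choose_spec.1

theorem isMIntegralCurve_oneParam (a : GroupLieAlgebra 𝓘(ℝ, EG) G) :
    IsMIntegralCurve (oneParam a) (mulInvariantVectorField (I := 𝓘(ℝ, EG)) a) :=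
  (exists_isMIntegralCurve_mulInvariantVectorField a).choose_spec.2

theorem eq_oneParam {a : GroupLieAlgebra 𝓘(ℝ, EG) G} {γ : ℝ → G} (h0 : γ 0 = 1)
    (hγ : IsMIntegralCurve γ (mulInvariantVectorField (I := 𝓘(ℝ, EG)) a)) : γ = oneParam a :=
  isMIntegralCurve_Ioo_eq_of_contMDiff_boundaryless (t₀ := 0)
    (contMDiff_one_mulInvariantVectorField a) hγ (isMIntegralCurve_oneParam a)
    (by rw [h0, oneParam_zero])

/-- As functions of t both sides are integral curves of the same field, with the same value at t =
0. -/
theorem oneParam_add (a : GroupLieAlgebra 𝓘(ℝ, EG) G) (s t : ℝ) :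
    oneParam a (s + t) = oneParam a s * oneParam a t := by
  have h1 := (isMIntegralCurve_oneParam a).comp_add s
  have h2 : IsMIntegralCurve (fun t => oneParam a s * oneParam a t)
      (mulInvariantVectorField (I := 𝓘(ℝ, EG)) a) := by
    rw [isMIntegralCurve_iff_isMIntegralCurveOn]
    exact ((isMIntegralCurve_oneParam a).isMIntegralCurveOn univ).mul_left _
  have := isMIntegralCurve_Ioo_eq_of_contMDiff_boundaryless (t₀ := 0)
    (contMDiff_one_mulInvariantVectorField a) h1 h2 (by simp [oneParam_zero])
  have := congrFun this t
  simpa [add_comm] using this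

omit [CompleteSpace EG] [T2Space G] [LieGroup 𝓘(ℝ, EG) ∞ G] in
theorem mulInvariantVectorField_one (a : GroupLieAlgebra 𝓘(ℝ, EG) G) :
    mulInvariantVectorField a (1 : G) = a := by
  have h : (fun k : G => 1 * k) = id := by ext; simp
  have h2 : mfderiv 𝓘(ℝ, EG) 𝓘(ℝ, EG) (fun k : G => 1 * k) (1 : G) =
      ContinuousLinearMap.id ℝ _ := by
    rw [h]; exact mfderiv_id
  exact DFunLike.congr_fun h2 a

theorem hasMFDerivAt_oneParam_zero (a : GroupLieAlgebra 𝓘(ℝ, EG) G) :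
    HasMFDerivAt 𝓘(ℝ, ℝ) 𝓘(ℝ, EG) (oneParam a) 0
      ((1 : ℝ →L[ℝ] ℝ).smulRight (a : EG) : ℝ →L[ℝ] EG) := by
  have h := isMIntegralCurve_oneParam a 0
  refine h.congr_mfderiv ?_
  rw [oneParam_zero, mulInvariantVectorField_one]
  rfl

end OneParameterSubgroups

/-! ### Fundamental fields of a smooth action -/

section SmoothAction

variable {E M EG G : Type*}
  [NormedAddCommGroup E] [NormedSpace ℝ E] [TopologicalSpace M] [ChartedSpace E M]
  [NormedAddCommGroup EG] [NormedSpace ℝ EG] [TopologicalSpace G] [ChartedSpace EG G] [Group G]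
  [MulAction G M] [ContMDiffSMul 𝓘(ℝ, EG) 𝓘(ℝ, E) ∞ G M]

variable (EG) in
theorem contMDiff_orbitMap (x : M) :
    ContMDiff 𝓘(ℝ, EG) 𝓘(ℝ, E) ∞ (fun g : G => g • x) :=
  (contMDiff_smul (I := 𝓘(ℝ, EG)) (I' := 𝓘(ℝ, E)) (n := ∞)).comp
    (contMDiff_id.prodMk contMDiff_const)

variable (E EG G) in
/-- The linear map `a ↦ a_M(x)` from the Lie algebra to the tangent space at `x`. -/
def fundamentalMap (x : M) : EG →L[ℝ] E :=
  mfderiv 𝓘(ℝ, EG) 𝓘(ℝ, E) (fun g : G => g • x) 1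

theorem hasMFDerivAt_orbitMap (x : M) :
    HasMFDerivAt 𝓘(ℝ, EG) 𝓘(ℝ, E) (fun g : G => g • x) 1 (fundamentalMap E EG G x : EG →L[ℝ] E) :=
  ((contMDiff_orbitMap EG x).mdifferentiableAt (by simp)).hasMFDerivAt

/-- A chain rule in which the intermediate point is known only up to a proved equality. The
derivatives are typed on the model spaces, so no transport between tangent spaces arises. -/
theorem HasMFDerivAt.comp_of_eq' {E₁ E₂ E₃ M₁ M₂ M₃ : Type*}
    [NormedAddCommGroup E₁] [NormedSpace ℝ E₁] [TopologicalSpace M₁]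
    [NormedAddCommGroup E₂] [NormedSpace ℝ E₂] [TopologicalSpace M₂]
    [NormedAddCommGroup E₃] [NormedSpace ℝ E₃] [TopologicalSpace M₃]
    {H₁ H₂ H₃ : Type*} [TopologicalSpace H₁] [TopologicalSpace H₂] [TopologicalSpace H₃]
    {I₁ : ModelWithCorners ℝ E₁ H₁} {I₂ : ModelWithCorners ℝ E₂ H₂}
    {I₃ : ModelWithCorners ℝ E₃ H₃}
    [ChartedSpace H₁ M₁] [ChartedSpace H₂ M₂] [ChartedSpace H₃ M₃]
    {f : M₁ → M₂} {g : M₂ → M₃} {x : M₁} {y : M₂} {f' : E₁ →L[ℝ] E₂} {g' : E₂ →L[ℝ] E₃}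
    (hg : HasMFDerivAt I₂ I₃ g y g') (hf : HasMFDerivAt I₁ I₂ f x f') (hy : f x = y) :
    HasMFDerivAt I₁ I₃ (fun z => g (f z)) x (g'.comp f' : E₁ →L[ℝ] E₃) := by
  subst hy
  exact hg.comp x hf

section Invariance

variable [LieGroup 𝓘(ℝ, EG) ∞ G]

/-- The derivative of the orbit map at an arbitrary group element. -/
theorem hasMFDerivAt_orbitMap_right (x : M) (g : G) :
    HasMFDerivAt 𝓘(ℝ, EG) 𝓘(ℝ, E) (fun k : G => k • x) g
      ((fundamentalMap E EG G (g • x) : EG →L[ℝ] E).comp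
        (mfderiv 𝓘(ℝ, EG) 𝓘(ℝ, EG) (fun k : G => k * g⁻¹) g : EG →L[ℝ] EG)) := by
  have h1 : HasMFDerivAt 𝓘(ℝ, EG) 𝓘(ℝ, EG) (fun k : G => k * g⁻¹) g
      (mfderiv 𝓘(ℝ, EG) 𝓘(ℝ, EG) (fun k : G => k * g⁻¹) g : EG →L[ℝ] EG) :=
    ((contMDiff_mul_right (I := 𝓘(ℝ, EG)) (n := ∞) (a := g⁻¹)).mdifferentiableAt
      (by simp)).hasMFDerivAt
  have h2 := (hasMFDerivAt_orbitMap (E := E) (EG := EG) (G := G) (g • x)).comp_of_eq' h1 (by simp)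
  refine h2.congr_of_eventuallyEq (Eventually.of_forall fun k => ?_)
  simp [smul_smul]

omit [LieGroup 𝓘(ℝ, EG) ∞ G] in
theorem hasMFDerivAt_orbitMap_left (x : M) (g : G) :
    HasMFDerivAt 𝓘(ℝ, EG) 𝓘(ℝ, E) (fun k : G => (g * k) • x) 1
      ((mfderiv 𝓘(ℝ, E) 𝓘(ℝ, E) (fun y : M => g • y) x : E →L[ℝ] E).comp
        (fundamentalMap E EG G x : EG →L[ℝ] E)) := by
  have h1 : HasMFDerivAt 𝓘(ℝ, E) 𝓘(ℝ, E) (fun y : M => g • y) x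
      (mfderiv 𝓘(ℝ, E) 𝓘(ℝ, E) (fun y : M => g • y) x : E →L[ℝ] E) :=
    ((ContMDiffSMul.contMDiff_const_smul (I := 𝓘(ℝ, EG)) (I' := 𝓘(ℝ, E)) (n := ∞)
      g).mdifferentiableAt (by simp)).hasMFDerivAt
  have h2 := h1.comp_of_eq' (hasMFDerivAt_orbitMap (E := E) (EG := EG) (G := G) x) (by simp)
  refine h2.congr_of_eventuallyEq (Eventually.of_forall fun k => ?_)
  simp [smul_smul]

/-- A smooth function which is infinitesimally invariant under a connected group is invariant. -/
theorem smul_invariant_of_differential_fundamentalField [PreconnectedSpace G] {f : M → ℝ}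
    (hf : ContMDiff 𝓘(ℝ, E) 𝓘(ℝ, ℝ) ∞ f)
    (h : ∀ (a : GroupLieAlgebra 𝓘(ℝ, EG) G) (x : M),
      differential (E := E) f x (fundamentalField a x) = 0) (g : G) (x : M) :
    f (g • x) = f x := by
  have key : ∀ g : G, HasMFDerivAt 𝓘(ℝ, EG) 𝓘(ℝ, ℝ) (fun k : G => f (k • x)) g
      (0 : EG →L[ℝ] ℝ) := by
    intro g
    have h1 : HasMFDerivAt 𝓘(ℝ, E) 𝓘(ℝ, ℝ) f (g • x) (differential (E := E) f (g • x)) :=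
      (hf.mdifferentiableAt (by simp)).hasMFDerivAt
    have h2 := h1.comp_of_eq' (hasMFDerivAt_orbitMap_right (E := E) (EG := EG) x g) rfl
    refine h2.congr_mfderiv ?_
    ext v
    exact h _ _
  have := eq_of_hasMFDerivAt_zero key g 1
  simpa using this

omit [LieGroup 𝓘(ℝ, EG) ∞ G] in
/-- The differential of an invariant function vanishes along the orbits. -/
theorem differential_fundamentalField_of_invariant {f : M → ℝ}
    (hf : ContMDiff 𝓘(ℝ, E) 𝓘(ℝ, ℝ) ∞ f) (h : ∀ (g : G) (x : M), f (g • x) = f x)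
    (a : GroupLieAlgebra 𝓘(ℝ, EG) G) (x : M) :
    differential (E := E) f x (fundamentalField a x) = 0 := by
  have h1 : HasMFDerivAt 𝓘(ℝ, E) 𝓘(ℝ, ℝ) f x (differential (E := E) f x) :=
    (hf.mdifferentiableAt (by simp)).hasMFDerivAt
  have h2 := h1.comp_of_eq' (hasMFDerivAt_orbitMap (E := E) (EG := EG) (G := G) x) (by simp)
  have h3 : HasMFDerivAt 𝓘(ℝ, EG) 𝓘(ℝ, ℝ) (fun g : G => f (g • x)) 1 (0 : EG →L[ℝ] ℝ) := by
    rw [show (fun g : G => f (g • x)) = fun _ => f x from funext fun g => h g x]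
    exact hasMFDerivAt_const _ _
  have h4 := hasMFDerivAt_unique h2 h3
  exact DFunLike.congr_fun h4 a

/-- For smooth `f`, the function `x ↦ df(x)(a_M(x))` is continuous. -/
theorem continuous_differential_fundamentalField [IsManifold 𝓘(ℝ, E) ∞ M] {f : M → ℝ}
    (hf : ContMDiff 𝓘(ℝ, E) 𝓘(ℝ, ℝ) ∞ f) (a : GroupLieAlgebra 𝓘(ℝ, EG) G) :
    Continuous (fun x : M => differential (E := E) f x (fundamentalField a x)) := by
  rw [continuous_iff_continuousAt]
  intro x₀
  have hu : ContMDiff (𝓘(ℝ, E).prod 𝓘(ℝ, EG)) 𝓘(ℝ, ℝ) ∞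
      (Function.uncurry fun (x : M) (g : G) => f (g • x)) := by
    have : ContMDiff (𝓘(ℝ, E).prod 𝓘(ℝ, EG)) 𝓘(ℝ, E) ∞ (fun p : M × G => p.2 • p.1) :=
      (contMDiff_smul (I := 𝓘(ℝ, EG)) (I' := 𝓘(ℝ, E)) (n := ∞)).comp
        (contMDiff_snd.prodMk contMDiff_fst)
    exact hf.comp this
  have : IsManifold 𝓘(ℝ, EG) 1 G := IsManifold.of_le (n := ∞) (by simp)
  have : IsManifold 𝓘(ℝ, E) 1 M := IsManifold.of_le (n := ∞) (by simp)
  have h := ContMDiffAt.mfderiv_apply (n := ∞) (m := 0) (x₀ := x₀) (I := 𝓘(ℝ, EG))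
    (I' := 𝓘(ℝ, ℝ)) (J := 𝓘(ℝ, E)) (J' := 𝓘(ℝ, E))
    (fun (x : M) (g : G) => f (g • x)) (fun _ => (1 : G))
    (fun x : M => x) (fun _ : M => (a : EG)) hu.contMDiffAt contMDiffAt_const contMDiffAt_id
    contMDiffAt_const (by simp)
  refine h.continuousAt.congr (Eventually.of_forall fun x => ?_)
  have h1 : HasMFDerivAt 𝓘(ℝ, E) 𝓘(ℝ, ℝ) f x (differential (E := E) f x) :=
    (hf.mdifferentiableAt (by simp)).hasMFDerivAt
  have h2 := h1.comp_of_eq' (hasMFDerivAt_orbitMap (E := E) (EG := EG) (G := G) x) (by simp)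
  -- The base point in G is constantly 1 and the target is the vector space ℝ, so both coordinate
  -- changes are trivial.
  have key : ∀ ϕ : M → EG →L[ℝ] ℝ,
      inTangentCoordinates 𝓘(ℝ, EG) 𝓘(ℝ, ℝ) (fun _ : M => (1 : G)) (fun x => f ((1 : G) • x))
        ϕ x₀ x = ϕ x := by
    intro ϕ
    rw [inTangentCoordinates_eq (fun _ : M => (1 : G)) (fun x => f ((1 : G) • x)) ϕ
      (mem_chart_source EG (1 : G)) (mem_univ _)]
    ext v
    simp only [ContinuousLinearMap.comp_apply]
    rw [(tangentBundleCore 𝓘(ℝ, EG) G).coordChange_self _ _ (mem_chart_source EG (1 : G))]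
    exact (tangentBundleCore 𝓘(ℝ, ℝ) ℝ).coordChange_self (achart ℝ (f ((1 : G) • x)))
      (f ((1 : G) • x)) (mem_chart_source ℝ _) (ϕ x v)
  exact (DFunLike.congr_fun (key fun x =>
    mfderiv 𝓘(ℝ, EG) 𝓘(ℝ, ℝ) (fun g : G => f (g • x)) 1) a).trans
    (DFunLike.congr_fun h2.mfderiv a)

end Invariance

section Fixed

variable [LieGroup 𝓘(ℝ, EG) ∞ G] [T2Space G] [CompleteSpace EG]
  [IsManifold 𝓘(ℝ, E) ∞ M]

/-- Zeros of a fundamental field are fixed by the one-parameter group. -/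
theorem oneParam_smul_of_fundamentalField_eq_zero (a : GroupLieAlgebra 𝓘(ℝ, EG) G) (x : M)
    (h : (fundamentalField a x : TangentSpace 𝓘(ℝ, E) x) = 0) (t : ℝ) : oneParam a t • x = x := by
  have key : ∀ t, HasMFDerivAt 𝓘(ℝ, ℝ) 𝓘(ℝ, E) (fun s => oneParam a s • x) t (0 : ℝ →L[ℝ] E) := by
    intro t
    have h1 : HasMFDerivAt 𝓘(ℝ, ℝ) 𝓘(ℝ, ℝ) (fun s : ℝ => s - t) t
        (ContinuousLinearMap.id ℝ ℝ) := by
      exact ((hasFDerivAt_id t).sub_const t).hasMFDerivAt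
    have h2 := (hasMFDerivAt_oneParam_zero a).comp_of_eq' h1 (sub_self t)
    have h3 := (hasMFDerivAt_orbitMap_left (E := E) (EG := EG) x (oneParam a t)).comp_of_eq' h2
      (by simp [oneParam_zero])
    -- Since exp(sa) = exp(ta) exp((s - t)a), the velocity at time t is the image of the velocity at
    -- time 0, which is zero.
    have h4 : (fun s => oneParam a s • x) =
        fun s => (oneParam a t * oneParam a (s - t)) • x := by
      ext s
      rw [← oneParam_add]
      simp
    rw [h4]
    refine h3.congr_mfderiv ?_
    ext
    have h5 : ∀ (A : E →L[ℝ] E) (B : EG →L[ℝ] E) (b : EG), B b = 0 → A (B ((1 : ℝ) • b)) = 0 := by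
      intro A B b hb
      rw [one_smul, hb, map_zero]
    exact h5 _ _ _ h
  have := eq_of_hasMFDerivAt_zero key t 0
  simpa [oneParam_zero] using this

/-- The velocity of the subgroup at time 0 is a. -/
theorem eq_zero_of_oneParam_eq_one {a : GroupLieAlgebra 𝓘(ℝ, EG) G} (h : ∀ t, oneParam a t = 1) :
    a = 0 := by
  have h1 := hasMFDerivAt_oneParam_zero a
  have h2 : HasMFDerivAt 𝓘(ℝ, ℝ) 𝓘(ℝ, EG) (oneParam a) 0 (0 : ℝ →L[ℝ] EG) := by
    rw [show oneParam a = fun _ => 1 from funext h]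
    exact hasMFDerivAt_const _ _
  have h3 := DFunLike.congr_fun (hasMFDerivAt_unique h1 h2) (1 : ℝ)
  exact (one_smul ℝ (a : EG)).symm.trans h3

/-- For a free action the fundamental fields are nowhere zero. -/
theorem fundamentalMap_injective_of_free (hfree : ∀ (g : G) (x : M), g • x = x → g = 1) (x : M) :
    Function.Injective (fundamentalMap E EG G x) := by
  rw [injective_iff_map_eq_zero]
  intro a ha
  exact eq_zero_of_oneParam_eq_one (a := a) fun t =>
    hfree _ x (oneParam_smul_of_fundamentalField_eq_zero a x ha t)

/-- For an effective action a Lie algebra element that acts trivially vanishes. -/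
theorem eq_zero_of_fundamentalField_eq_zero [FaithfulSMul G M] {a : GroupLieAlgebra 𝓘(ℝ, EG) G}
    (h : ∀ x : M, (fundamentalField a x : TangentSpace 𝓘(ℝ, E) x) = 0) : a = 0 :=
  eq_zero_of_oneParam_eq_one fun t => FaithfulSMul.eq_of_smul_eq_smul (α := M) fun x => by
    rw [oneParam_smul_of_fundamentalField_eq_zero a x (h x) t, one_smul]

end Fixed

end SmoothAction

/-! ### Coisotropic subspaces and the Poisson tensor -/

section LinearAlgebra

/-- If `dim F` and the dimension of the kernel of `B` on `F` add up to `dim W`, then `F` contains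
its orthogonal complement. -/
theorem mem_of_forall_bilin_eq_zero {W : Type*} [AddCommGroup W] [Module ℝ W]
    [FiniteDimensional ℝ W] (B : LinearMap.BilinForm ℝ W)
    (hB : Function.Surjective B) (F : Submodule ℝ W)
    (h : Module.finrank ℝ F + Module.finrank ℝ (LinearMap.ker (B.restrict F)) =
      Module.finrank ℝ W) (α : W) (hα : ∀ γ ∈ F, B α γ = 0) : α ∈ F := by
  -- The kernel of T is the orthogonal of F. Since T is onto, it has dimension dim W - dim F, which
  -- by h is the dimension of the radical K of B on F. As K lies in this kernel, the two coincide.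
  let T : W →ₗ[ℝ] Module.Dual ℝ F := F.dualRestrict ∘ₗ B
  have hT : Function.Surjective T := (Subspace.dualRestrict_surjective (W := F)).comp hB
  have h1 := LinearMap.finrank_range_add_finrank_ker T
  rw [LinearMap.range_eq_top.2 hT, finrank_top, Subspace.dual_finrank_eq] at h1
  let K := (LinearMap.ker (B.restrict F)).map F.subtype
  have hK : K ≤ LinearMap.ker T := by
    rintro _ ⟨k, hk, rfl⟩
    rw [LinearMap.mem_ker]
    ext γ
    exact DFunLike.congr_fun (LinearMap.mem_ker.1 hk) γ
  have h2 : Module.finrank ℝ K = Module.finrank ℝ (LinearMap.ker (B.restrict F)) :=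
    Submodule.finrank_map_subtype_eq _ _
  have h3 : K = LinearMap.ker T := Submodule.eq_of_le_of_finrank_eq hK (by omega)
  have h4 : α ∈ LinearMap.ker T := by
    rw [LinearMap.mem_ker]
    ext γ
    exact hα γ γ.2
  rw [← h3] at h4
  obtain ⟨k, _, rfl⟩ := h4
  exact k.2

end LinearAlgebra

section Symplectic

variable {E M : Type*} [NormedAddCommGroup E] [NormedSpace ℝ E]
  [TopologicalSpace M] [ChartedSpace E M]

namespace SymplecticForm

theorem toForm_swap (Ω : SymplecticForm E M) (x : M) (u v : TangentSpace 𝓘(ℝ, E) x) :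
    Ω.toForm x ![u, v] = - Ω.toForm x ![v, u] := by
  have h := (Ω.toForm x).toAlternatingMap.map_swap ![v, u] (i := 0) (j := 1) (by decide)
  have h2 : ![v, u] ∘ Equiv.swap (0 : Fin 2) 1 = ![u, v] := by
    ext i; fin_cases i <;> simp
  rw [h2] at h
  exact h

variable [FiniteDimensional ℝ E]

theorem poissonTensor_apply (Ω : SymplecticForm E M) (x : M)
    (α β : TangentSpace 𝓘(ℝ, E) x →L[ℝ] ℝ) :
    Ω.poissonTensor x α β = Ω.toForm x ![Ω.sharp x α, Ω.sharp x β] := rfl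

theorem toForm_sharp (Ω : SymplecticForm E M) (x : M) (α : TangentSpace 𝓘(ℝ, E) x →L[ℝ] ℝ)
    (w : TangentSpace 𝓘(ℝ, E) x) : Ω.toForm x ![w, Ω.sharp x α] = α w := by
  rw [← flat_apply]
  exact congrArg (fun α : TangentSpace 𝓘(ℝ, E) x →L[ℝ] ℝ => α w)
    ((LinearEquiv.ofBijective (Ω.flat x) (Ω.flat_bijective x)).apply_symm_apply _)

theorem poissonTensor_eq (Ω : SymplecticForm E M) (x : M)
    (α β : TangentSpace 𝓘(ℝ, E) x →L[ℝ] ℝ) :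
    Ω.poissonTensor x α β = β (Ω.sharp x α) := by
  rw [poissonTensor_apply, toForm_sharp]

theorem poissonTensor_swap (Ω : SymplecticForm E M) (x : M)
    (α β : TangentSpace 𝓘(ℝ, E) x →L[ℝ] ℝ) :
    Ω.poissonTensor x α β = - Ω.poissonTensor x β α := by
  rw [poissonTensor_apply, poissonTensor_apply, toForm_swap]

/-- A covector orthogonal to all others vanishes, because every tangent vector is the sharp of some
covector. Equality of dimensions turns injectivity into surjectivity. -/
theorem poissonTensor_surjective (Ω : SymplecticForm E M) (x : M) :
    Function.Surjective (Ω.poissonTensor x) := by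
  have : FiniteDimensional ℝ (TangentSpace 𝓘(ℝ, E) x →L[ℝ] ℝ) :=
    inferInstanceAs (FiniteDimensional ℝ (E →L[ℝ] ℝ))
  have hinj : Function.Injective (Ω.poissonTensor x) := by
    rw [injective_iff_map_eq_zero]
    intro α hα
    have h : ∀ β, Ω.poissonTensor x β α = 0 := fun β => by
      rw [poissonTensor_swap, hα]; simp
    ext w
    obtain ⟨β, rfl⟩ := (Ω.sharp x).surjective w
    rw [← poissonTensor_eq, h]; rfl
  exact (LinearMap.injective_iff_surjective_of_finrank_eq_finrank
    (Subspace.dual_finrank_eq (K := ℝ)).symm).1 hinj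

end SymplecticForm

end Symplectic

/-! ### Invariance of the moment map and triviality of the adjoint action -/

section Moment

variable {EG G E M : Type*}
    [NormedAddCommGroup EG] [NormedSpace ℝ EG]
    [TopologicalSpace G] [ChartedSpace EG G] [Group G] [LieGroup 𝓘(ℝ, EG) ∞ G]
    [NormedAddCommGroup E] [NormedSpace ℝ E] [FiniteDimensional ℝ E]
    [TopologicalSpace M] [ChartedSpace E M]
    [MulAction G M]
    {Ω : SymplecticForm E M} {Φ : M → (GroupLieAlgebra 𝓘(ℝ, EG) G →L[ℝ] ℝ)}

omit [LieGroup 𝓘(ℝ, EG) ∞ G] in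
/-- The differentials of the components of the moment map are orthogonal to the differentials of
invariant functions. -/
theorem IsHamiltonianAction.poissonTensor_moment (hΦ : IsHamiltonianAction Ω Φ)
    (a : GroupLieAlgebra 𝓘(ℝ, EG) G) (x : M) (α : TangentSpace 𝓘(ℝ, E) x →L[ℝ] ℝ) :
    Ω.poissonTensor x (differential (E := E) (fun y => Φ y a) x) α = α (fundamentalField a x) := by
  rw [Ω.poissonTensor_eq, ← hΦ.sgrad_moment]
  rfl

omit [LieGroup 𝓘(ℝ, EG) ∞ G] [FiniteDimensional ℝ E] in
/-- Every element of the span of differentials of invariant functions vanishes on orbits. -/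
theorem differentialSpan_fundamentalField [ContMDiffSMul 𝓘(ℝ, EG) 𝓘(ℝ, E) ∞ G M]
    {F : Subalgebra ℝ C^∞⟮𝓘(ℝ, E), M; ℝ⟯}
    (hF : ∀ f ∈ F, ∀ (g : G) (x : M), f (g • x) = f x)
    (a : GroupLieAlgebra 𝓘(ℝ, EG) G) (x : M) (α : TangentSpace 𝓘(ℝ, E) x →L[ℝ] ℝ)
    (hα : α ∈ differentialSpan F x) : α (fundamentalField a x) = 0 := by
  induction hα using Submodule.span_induction with
  | mem α h =>
    obtain ⟨f, hf, rfl⟩ := h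
    exact differential_fundamentalField_of_invariant f.contMDiff (hF f hf) a x
  | zero => rfl
  | add α β _ _ h1 h2 =>
    rw [add_apply, h1, h2, add_zero]
  | smul c α _ h =>
    rw [smul_apply, h, smul_zero]

omit [LieGroup 𝓘(ℝ, EG) ∞ G] in
/-- Where the algebra of invariant functions satisfies the completeness condition, it contains the
differentials of the components of the moment map. -/
theorem IsHamiltonianAction.differential_moment_mem (hΦ : IsHamiltonianAction Ω Φ)
    {F : Subalgebra ℝ C^∞⟮𝓘(ℝ, E), M; ℝ⟯}
    (hF : ∀ f ∈ F, ∀ (g : G) (x : M), f (g • x) = f x) {x : M}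
    (hx : Module.finrank ℝ (differentialSpan F x) + Module.finrank ℝ
        (LinearMap.ker ((Ω.poissonTensor x).restrict (differentialSpan F x))) =
      Module.finrank ℝ E) (a : GroupLieAlgebra 𝓘(ℝ, EG) G) :
    differential (E := E) (fun y => Φ y a) x ∈ differentialSpan F x := by
  have := hΦ.smooth_action
  have : FiniteDimensional ℝ (TangentSpace 𝓘(ℝ, E) x →L[ℝ] ℝ) :=
    inferInstanceAs (FiniteDimensional ℝ (E →L[ℝ] ℝ))
  have hdim : Module.finrank ℝ (TangentSpace 𝓘(ℝ, E) x →L[ℝ] ℝ) = Module.finrank ℝ E := by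
    change Module.finrank ℝ (E →L[ℝ] ℝ) = _
    rw [← (LinearMap.toContinuousLinearMap (𝕜 := ℝ) (E := E) (F' := ℝ)).finrank_eq]
    exact Subspace.dual_finrank_eq
  -- It suffices to show orthogonality to the span: pairing dφ_a with a covector evaluates the
  -- latter on a_M, and differentials of invariant functions vanish there.
  refine mem_of_forall_bilin_eq_zero _ (Ω.poissonTensor_surjective x) _ (hx.trans hdim.symm) _ ?_
  intro γ hγ
  rw [hΦ.poissonTensor_moment]
  exact differentialSpan_fundamentalField hF a x γ hγ

variable [IsManifold 𝓘(ℝ, E) ∞ M]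

/-- A complete algebra of invariant functions forces the moment map to be invariant. -/
theorem IsHamiltonianAction.moment_smul [PreconnectedSpace G] (hΦ : IsHamiltonianAction Ω Φ)
    {F : Subalgebra ℝ C^∞⟮𝓘(ℝ, E), M; ℝ⟯} (hc : Ω.IsComplete F)
    (hF : ∀ f ∈ F, ∀ (g : G) (x : M), f (g • x) = f x) (g : G) (x : M) : Φ (g • x) = Φ x := by
  have := hΦ.smooth_action
  ext a
  refine smul_invariant_of_differential_fundamentalField (EG := EG) (hΦ.smooth_moment a) ?_ g x
  intro b
  obtain ⟨l, r, hlr, U, _, hUd, hU⟩ := hc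
  -- The vanishing of dφ_a(b_M) is available only on the regular set. Continuity extends it to M.
  have hcont := continuous_differential_fundamentalField (hΦ.smooth_moment a) b
  refine fun x => congrFun (hcont.ext_on hUd (continuous_const (y := (0 : ℝ))) ?_) x
  intro x hx
  obtain ⟨h1, h2⟩ := hU x hx
  exact differentialSpan_fundamentalField hF b x _
    (hΦ.differential_moment_mem hF (by rw [h1, h2, hlr]) a)

variable [CompleteSpace EG] [T2Space G] [FaithfulSMul G M]

/-- Invariance and equivariance make the component of Φ along Ad_g a - a identically zero. Its
Hamiltonian field, which is the fundamental field of that element, then vanishes, and effectiveness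
applies. -/
theorem IsHamiltonianAction.adjointMap_eq_id (hΦ : IsHamiltonianAction Ω Φ)
    (hinv : ∀ (g : G) (x : M), Φ (g • x) = Φ x) (g : G) (a : GroupLieAlgebra 𝓘(ℝ, EG) G) :
    adjointMap (EG := EG) g a = a := by
  have := hΦ.smooth_action
  rw [← sub_eq_zero]
  refine eq_zero_of_fundamentalField_eq_zero (E := E) (M := M) fun x => ?_
  rw [← hΦ.sgrad_moment]
  have h0 : (fun y : M => Φ y (adjointMap (EG := EG) g a - a)) = fun _ => 0 := by
    ext y
    -- The coadjoint action contains an inverse, so g⁻¹ is what produces Ad_g.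
    have h1 := hΦ.equivariant g⁻¹ y
    rw [hinv] at h1
    have h2 := DFunLike.congr_fun h1 a
    simp only [coadjointMap, inv_inv] at h2
    rw [map_sub, sub_eq_zero]
    exact h2.symm
  rw [h0]
  have h3 : differential (E := E) (fun _ : M => (0 : ℝ)) x = 0 := mfderiv_const
  rw [SymplecticForm.sgrad, h3, map_zero]

end Moment

/-! ### From trivial adjoint action to commutativity -/

section Commutative

variable {EG G : Type*} [NormedAddCommGroup EG] [NormedSpace ℝ EG]
    [TopologicalSpace G] [ChartedSpace EG G] [Group G] [LieGroup 𝓘(ℝ, EG) ∞ G]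

omit [LieGroup 𝓘(ℝ, EG) ∞ G] in
theorem hasMFDerivAt_mul_of_contMDiffMul [ContMDiffMul 𝓘(ℝ, EG) ∞ G] {F N : Type*}
    [NormedAddCommGroup F] [NormedSpace ℝ F] [TopologicalSpace N] [ChartedSpace F N]
    {p q : N → G} {x : N} {p' q' : F →L[ℝ] EG}
    (hp : HasMFDerivAt 𝓘(ℝ, F) 𝓘(ℝ, EG) p x p') (hq : HasMFDerivAt 𝓘(ℝ, F) 𝓘(ℝ, EG) q x q')
    {g h : G} (hg : p x = g) (hh : q x = h) :
    HasMFDerivAt 𝓘(ℝ, F) 𝓘(ℝ, EG) (fun y => p y * q y) x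
      ((mfderiv (𝓘(ℝ, EG).prod 𝓘(ℝ, EG)) 𝓘(ℝ, EG) (fun z : G × G => z.1 * z.2) (g, h) :
        EG × EG →L[ℝ] EG).comp (p'.prod q')) := by
  have h1 : HasMFDerivAt (𝓘(ℝ, EG).prod 𝓘(ℝ, EG)) 𝓘(ℝ, EG) (fun z : G × G => z.1 * z.2) (g, h)
      (mfderiv (𝓘(ℝ, EG).prod 𝓘(ℝ, EG)) 𝓘(ℝ, EG) (fun z : G × G => z.1 * z.2) (g, h)) :=
    ((contMDiff_mul 𝓘(ℝ, EG) ∞).mdifferentiableAt (by simp)).hasMFDerivAt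
  exact h1.comp_of_eq' (f' := p'.prod q') (f := fun y => (p y, q y)) (hp.prodMk hq) (by rw [hg, hh])

/-- A connected Lie group with trivial adjoint action is commutative. -/
theorem mul_comm_of_adjointMap_eq_id [PreconnectedSpace G]
    (h : ∀ (g : G) (a : GroupLieAlgebra 𝓘(ℝ, EG) G), adjointMap (EG := EG) g a = a) (g k : G) :
    g * k = k * g := by
  have hconj : HasMFDerivAt 𝓘(ℝ, EG) 𝓘(ℝ, EG) (fun k : G => g * k * g⁻¹) 1
      (ContinuousLinearMap.id ℝ EG) := by
    have h1 : ContMDiff 𝓘(ℝ, EG) 𝓘(ℝ, EG) ∞ (fun k : G => g * k * g⁻¹) :=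
      (contMDiff_mul_right (I := 𝓘(ℝ, EG)) (n := ∞) (a := g⁻¹)).comp
        (contMDiff_mul_left (I := 𝓘(ℝ, EG)) (n := ∞) (a := g))
    refine (h1.mdifferentiableAt (x := 1) (by simp)).hasMFDerivAt.congr_mfderiv ?_
    ext a
    exact h g a
  have hinv : HasMFDerivAt 𝓘(ℝ, EG) 𝓘(ℝ, EG) (fun k : G => k⁻¹) 1
      (mfderiv 𝓘(ℝ, EG) 𝓘(ℝ, EG) (fun k : G => k⁻¹) 1) :=
    ((contMDiff_inv 𝓘(ℝ, EG) ∞).mdifferentiableAt (by simp)).hasMFDerivAt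
  have hid : HasMFDerivAt 𝓘(ℝ, EG) 𝓘(ℝ, EG) (fun k : G => k) 1 (ContinuousLinearMap.id ℝ EG) :=
    hasMFDerivAt_id _
  have h1 := hasMFDerivAt_mul_of_contMDiffMul hconj hinv (g := 1) (by simp) inv_one
  have h2 := hasMFDerivAt_mul_of_contMDiffMul hid hinv rfl inv_one
  -- Conjugation by g has derivative the identity at 1, so k ↦ g k g⁻¹ k⁻¹ and k ↦ k k⁻¹ have the
  -- same derivative there. The second map is constant, so both derivatives are zero.
  have h3 : HasMFDerivAt 𝓘(ℝ, EG) 𝓘(ℝ, EG) (fun k : G => k * k⁻¹) 1 (0 : EG →L[ℝ] EG) := by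
    rw [show (fun k : G => k * k⁻¹) = fun _ => 1 from funext fun k => mul_inv_cancel k]
    exact hasMFDerivAt_const _ _
  have h4 := hasMFDerivAt_unique h2 h3
  have h5 : HasMFDerivAt 𝓘(ℝ, EG) 𝓘(ℝ, EG) (fun k : G => g * k * g⁻¹ * k⁻¹) 1
      (0 : EG →L[ℝ] EG) := h1.congr_mfderiv h4
  have key : ∀ m : G, HasMFDerivAt 𝓘(ℝ, EG) 𝓘(ℝ, EG) (fun k : G => g * k * g⁻¹ * k⁻¹) m
      (0 : EG →L[ℝ] EG) := by
    intro m
    have e1 : HasMFDerivAt 𝓘(ℝ, EG) 𝓘(ℝ, EG) (fun k : G => m⁻¹ * k) m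
      (mfderiv 𝓘(ℝ, EG) 𝓘(ℝ, EG) (fun k : G => m⁻¹ * k) m) := hasMFDerivAt_mul_left _ _
    have e2 : ContMDiff 𝓘(ℝ, EG) 𝓘(ℝ, EG) ∞ (fun k : G => g * m * g⁻¹ * k * m⁻¹) :=
      (contMDiff_mul_right (I := 𝓘(ℝ, EG)) (n := ∞) (a := m⁻¹)).comp
        (contMDiff_mul_left (I := 𝓘(ℝ, EG)) (n := ∞) (a := g * m * g⁻¹))
    have e3 := h5.comp_of_eq' e1 (inv_mul_cancel m)
    have e4 := ((e2.mdifferentiableAt (x := 1) (by simp)).hasMFDerivAt).comp_of_eq' e3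
      (by simp)
    -- Near m the commutator map is the commutator map near 1 composed with smooth translations, so
    -- its derivative vanishes at every m.
    have e5 : (fun k : G => g * k * g⁻¹ * k⁻¹) = fun k : G =>
        g * m * g⁻¹ * (g * (m⁻¹ * k) * g⁻¹ * (m⁻¹ * k)⁻¹) * m⁻¹ := by
      ext k; group
    rw [e5]
    refine e4.congr_mfderiv ?_
    ext v
    exact map_zero (mfderiv 𝓘(ℝ, EG) 𝓘(ℝ, EG) (fun k : G => g * m * g⁻¹ * k * m⁻¹) 1)
  have := eq_of_hasMFDerivAt_zero key k 1
  simp only [mul_one, mul_inv_cancel, inv_one] at this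
  rw [mul_inv_eq_one, mul_inv_eq_iff_eq_mul] at this
  exact this

end Commutative

/-! ### Smooth maps to and from products of circles -/

section PiManifold

variable {ι : Type*} [Fintype ι] {E : ι → Type*} [∀ i, NormedAddCommGroup (E i)]
  [∀ i, NormedSpace ℝ (E i)] {H : ι → Type*} [∀ i, TopologicalSpace (H i)]
  {I : ∀ i, ModelWithCorners ℝ (E i) (H i)}
  {N : ι → Type*} [∀ i, TopologicalSpace (N i)] [∀ i, ChartedSpace (H i) (N i)]
  {F HF M : Type*} [NormedAddCommGroup F] [NormedSpace ℝ F] [TopologicalSpace HF]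
  {J : ModelWithCorners ℝ F HF} [TopologicalSpace M] [ChartedSpace HF M]

theorem contMDiffAt_pi_of_forall {f : M → ∀ i, N i} {x : M}
    (h : ∀ i, ContMDiffAt J (I i) ∞ (fun y => f y i) x) :
    ContMDiffAt J (ModelWithCorners.pi I) ∞ f x := by
  rw [contMDiffAt_iff_target]
  refine ⟨continuousAt_pi.2 fun i => (h i).continuousAt, ?_⟩
  refine contMDiffAt_pi_space.2 fun i => ?_
  exact (contMDiffAt_iff_target.1 (h i)).2

theorem contMDiff_pi_apply [∀ i, (I i).Boundaryless] (i : ι) :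
    ContMDiff (ModelWithCorners.pi I) (I i) ∞ (fun z : ∀ i, N i => z i) := by
  intro z
  rw [contMDiffAt_iff]
  refine ⟨continuousAt_apply i z, ?_⟩
  have h1 : ContDiffWithinAt ℝ ∞ (fun v : ∀ i, E i => v i) (range (ModelWithCorners.pi I))
      (extChartAt (ModelWithCorners.pi I) z z) := 
    (ContinuousLinearMap.proj (R := ℝ) (φ := E) i).contDiff.contDiffWithinAt
  have h2 : extChartAt (ModelWithCorners.pi I) z z = fun i => extChartAt (I i) (z i) (z i) := rfl
  refine h1.congr_of_eventuallyEq ?_ ?_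
  · have h3 : ∀ᶠ v : ∀ i, E i in 𝓝 (extChartAt (ModelWithCorners.pi I) z z),
        v i ∈ (extChartAt (I i) (z i)).target :=
      (continuousAt_apply i _).eventually (extChartAt_target_mem_nhds (I := I i) (z i))
    filter_upwards [nhdsWithin_le_nhds h3] with v hv
    exact (extChartAt (I i) (z i)).right_inv hv
  · exact (extChartAt (I i) (z i)).right_inv (mem_extChartAt_target (I := I i) (z i))

end PiManifold

/-- The argument is the imaginary part of the logarithm, whose branch cut stays away from 1. -/
theorem contMDiffAt_circle_arg_one :
    ContMDiffAt (𝓡 1) 𝓘(ℝ, ℝ) ∞ (fun z : Circle => Complex.arg z) 1 := by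
  have : Fact (Module.finrank ℝ ℂ = 1 + 1) := finrank_real_complex_fact'
  have h1 : ContMDiff (𝓡 1) 𝓘(ℝ, ℂ) ∞ (fun z : Circle => (z : ℂ)) := contMDiff_coe_sphere
  have h2 : ContDiffAt ℝ ∞ Complex.log ((1 : Circle) : ℂ) :=
    (Complex.contDiffAt_log (by simp)).restrict_scalars ℝ
  have h3 : ContDiffAt ℝ ∞ (fun w : ℂ => (Complex.log w).im) ((1 : Circle) : ℂ) :=
    (Complex.imCLM.contDiff.contDiffAt).comp _ h2
  have h4 := h3.contMDiffAt.comp (1 : Circle) h1.contMDiffAt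
  exact h4.congr_of_eventuallyEq (Eventually.of_forall fun z => (Complex.log_im _).symm)

/-! ### One-parameter subgroups of a commutative Lie group -/

section Commutative

variable {EG G : Type*} [NormedAddCommGroup EG] [NormedSpace ℝ EG]
    [TopologicalSpace G] [ChartedSpace EG G] [CommGroup G] [LieGroup 𝓘(ℝ, EG) ∞ G]

/-- The derivative of multiplication at (1, 1) is determined by its restrictions to the two factors,
and each of these is the identity because multiplying by 1 does nothing. -/
theorem hasMFDerivAt_mul_one_one {F N : Type*}
    [NormedAddCommGroup F] [NormedSpace ℝ F] [TopologicalSpace N] [ChartedSpace F N]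
    {p q : N → G} {x : N} {p' q' : F →L[ℝ] EG}
    (hp : HasMFDerivAt 𝓘(ℝ, F) 𝓘(ℝ, EG) p x p') (hq : HasMFDerivAt 𝓘(ℝ, F) 𝓘(ℝ, EG) q x q')
    (hp1 : p x = 1) (hq1 : q x = 1) :
    HasMFDerivAt 𝓘(ℝ, F) 𝓘(ℝ, EG) (fun y => p y * q y) x (p' + q' : F →L[ℝ] EG) := by
  have hc : HasMFDerivAt 𝓘(ℝ, F) 𝓘(ℝ, EG) (fun _ : N => (1 : G)) x (0 : F →L[ℝ] EG) :=
    hasMFDerivAt_const _ _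
  have h0 := hasMFDerivAt_mul_of_contMDiffMul hp hq hp1 hq1
  have h1 := hasMFDerivAt_mul_of_contMDiffMul hp hc hp1 rfl
  have h2 := hasMFDerivAt_mul_of_contMDiffMul hc hq rfl hq1
  have h3 := hasMFDerivAt_unique (h1.congr_of_eventuallyEq
    (.of_forall fun y => (mul_one (p y)).symm)) hp
  have h4 := hasMFDerivAt_unique (h2.congr_of_eventuallyEq
    (.of_forall fun y => (one_mul (q y)).symm)) hq
  refine h0.congr_mfderiv ?_
  have key : ∀ (μ : EG × EG →L[ℝ] EG), μ.comp (p'.prod 0) = p' →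
      μ.comp ((0 : F →L[ℝ] EG).prod q') = q' → μ.comp (p'.prod q') = p' + q' := by
    intro μ e1 e2
    ext v
    have e1' := DFunLike.congr_fun e1 v
    have e2' := DFunLike.congr_fun e2 v
    simp only [ContinuousLinearMap.comp_apply, ContinuousLinearMap.prod_apply, add_apply,
      zero_apply] at e1' e2' ⊢
    conv_rhs => rw [← e1', ← e2', ← map_add]
    simp
  exact key _ h3 h4

variable [T2Space G] [CompleteSpace EG]

/-- Additivity transports the velocity at 0 to every t by left translation, so γ is an integral
curve of the left-invariant field of a. -/
theorem eq_oneParam_of_add {a : GroupLieAlgebra 𝓘(ℝ, EG) G} {γ : ℝ → G}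
    (hadd : ∀ s t, γ (s + t) = γ s * γ t)
    (hγ : HasMFDerivAt 𝓘(ℝ, ℝ) 𝓘(ℝ, EG) γ 0 ((1 : ℝ →L[ℝ] ℝ).smulRight (a : EG) : ℝ →L[ℝ] EG)) :
    γ = oneParam a := by
  have h0 : γ 0 = 1 := by simpa using hadd 0 0
  refine eq_oneParam h0 fun t => ?_
  have h1 : HasMFDerivAt 𝓘(ℝ, ℝ) 𝓘(ℝ, ℝ) (fun s : ℝ => s - t) t (ContinuousLinearMap.id ℝ ℝ) :=
    ((hasFDerivAt_id t).sub_const t).hasMFDerivAt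
  have h2 := hγ.comp_of_eq' h1 (sub_self t)
  have h3 := (hasMFDerivAt_mul_left (EG := EG) (γ t) 1).comp_of_eq' h2 (by simp [h0])
  have h4 : γ = fun s => γ t * γ (s - t) := by
    ext s; rw [← hadd]; simp
  have h5 : HasMFDerivAt 𝓘(ℝ, ℝ) 𝓘(ℝ, EG) γ t _ := h3.congr_of_eventuallyEq (.of_forall fun s => congrFun h4 s)
  refine h5.congr_mfderiv ?_
  ext
  exact (map_smul (mfderiv 𝓘(ℝ, EG) 𝓘(ℝ, EG) (fun k : G => γ t * k) 1) (1 : ℝ) a)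

/-- Commutativity makes the pointwise product a one-parameter subgroup. Its velocity at 0 is a + b.
-/
theorem oneParam_add_left (a b : GroupLieAlgebra 𝓘(ℝ, EG) G) (t : ℝ) :
    oneParam (a + b) t = oneParam a t * oneParam b t := by
  refine (congrFun (eq_oneParam_of_add (a := a + b)
    (γ := fun t => oneParam a t * oneParam b t) ?_ ?_) t).symm
  · intro s t
    simp only [oneParam_add]
    exact mul_mul_mul_comm _ _ _ _
  · refine (hasMFDerivAt_mul_one_one (hasMFDerivAt_oneParam_zero a) (hasMFDerivAt_oneParam_zero b)
      (oneParam_zero a) (oneParam_zero b)).congr_mfderiv ?_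
    ext
    exact (smul_add (1 : ℝ) (a : EG) b).symm

theorem oneParam_smul_left (c : ℝ) (a : GroupLieAlgebra 𝓘(ℝ, EG) G) (t : ℝ) :
    oneParam (c • a) t = oneParam a (c * t) := by
  refine (congrFun (eq_oneParam_of_add (a := c • a) (γ := fun t => oneParam a (c * t)) ?_ ?_) t).symm
  · intro s t
    rw [mul_add, oneParam_add]
  · have h1 : HasMFDerivAt 𝓘(ℝ, ℝ) 𝓘(ℝ, ℝ) (fun s : ℝ => c * s) 0 (c • ContinuousLinearMap.id ℝ ℝ) :=
      ((hasFDerivAt_id (0 : ℝ)).const_mul c).hasMFDerivAt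
    refine ((hasMFDerivAt_oneParam_zero a).comp_of_eq' h1 (mul_zero c)).congr_mfderiv ?_
    ext
    change (c * 1 : ℝ) • (a : EG) = (1 : ℝ) • (c • (a : EG))
    rw [mul_one, one_smul]

/-- One-parameter subgroups are smooth near `0`. -/
theorem contMDiffAt_oneParam_zero (a : GroupLieAlgebra 𝓘(ℝ, EG) G) :
    ContMDiffAt 𝓘(ℝ, ℝ) 𝓘(ℝ, EG) ∞ (oneParam a) 0 := by
  let φ := extChartAt 𝓘(ℝ, EG) (1 : G)
  have hφ1 : φ.symm (φ 1) = 1 := extChartAt_to_inv (I := 𝓘(ℝ, EG)) (1 : G)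
  let μ : EG × EG → EG := fun p => φ (φ.symm p.1 * φ.symm p.2)
  have hφs : ContMDiffOn 𝓘(ℝ, EG) 𝓘(ℝ, EG) ∞ φ.symm φ.target := contMDiffOn_extChartAt_symm _
  have hφ : ContMDiffOn 𝓘(ℝ, EG) 𝓘(ℝ, EG) ∞ φ φ.source := by
    have := contMDiffOn_extChartAt (I := 𝓘(ℝ, EG)) (n := ∞) (x := (1 : G))
    rwa [← extChartAt_source 𝓘(ℝ, EG)] at this
  have hm : ContMDiffOn 𝓘(ℝ, EG × EG) 𝓘(ℝ, EG) ∞ (fun p : EG × EG => φ.symm p.1 * φ.symm p.2)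
      (φ.target ×ˢ φ.target) := by
    refine ContMDiffOn.mul ?_ ?_
    · exact hφs.comp contDiff_fst.contMDiff.contMDiffOn fun p hp => hp.1
    · exact hφs.comp contDiff_snd.contMDiff.contMDiffOn fun p hp => hp.2
  let W := (φ.target ×ˢ φ.target) ∩ (fun p : EG × EG => φ.symm p.1 * φ.symm p.2) ⁻¹' φ.source
  have hW : IsOpen W := hm.continuousOn.isOpen_inter_preimage
    ((isOpen_extChartAt_target _).prod (isOpen_extChartAt_target _)) (isOpen_extChartAt_source _)
  have hμ : ContDiffOn ℝ ∞ μ W := by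
    rw [← contMDiffOn_iff_contDiffOn]
    exact hφ.comp (hm.mono inter_subset_left) fun p hp => hp.2
  have hφ_one : φ 1 ∈ φ.target := mem_extChartAt_target (I := 𝓘(ℝ, EG)) (1 : G)
  have hoW : (φ 1, φ 1) ∈ W := by
    refine ⟨⟨hφ_one, hφ_one⟩, ?_⟩
    simp only [mem_preimage, hφ1, mul_one]
    exact mem_extChartAt_source _
  -- the curve in the chart
  let x : ℝ → EG := fun t => φ (oneParam a t)
  have hφd : MDifferentiableAt 𝓘(ℝ, EG) 𝓘(ℝ, EG) φ 1 := mdifferentiableAt_extChartAt (mem_chart_source _ _)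
  have hx0 := hφd.hasMFDerivAt.comp_of_eq' (hasMFDerivAt_oneParam_zero a) (oneParam_zero a)
  set x' : EG := (mfderiv 𝓘(ℝ, EG) 𝓘(ℝ, EG) φ 1 : EG →L[ℝ] EG) a with hx'
  have hx0' : HasDerivAt x x' 0 := by
    have key : ∀ (A : EG →L[ℝ] EG) (v : EG),
        HasFDerivAt x (A.comp ((1 : ℝ →L[ℝ] ℝ).smulRight v)) 0 → HasDerivAt x (A v) 0 := by
      intro A v h
      refine h.hasDerivAt.congr_deriv ?_
      simp
    exact key _ _ hx0.hasFDerivAt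
  let V : Set EG := (fun y => (y, φ 1)) ⁻¹' W
  have hV : IsOpen V := hW.preimage (by fun_prop)
  -- The left-invariant field read in the chart: the derivative of the smooth map μ in its second
  -- slot at the identity. The curve x solves the autonomous equation of w, hence is smooth.
  let w : EG → EG := fun y => fderiv ℝ μ (y, φ 1) (0, x')
  have hw : ContDiffOn ℝ ∞ w V := by
    have h1 : ContDiffOn ℝ ∞ (fderiv ℝ μ) W := hμ.fderiv_of_isOpen hW (by simp)
    have h2 : ContDiffOn ℝ ∞ (fun y => fderiv ℝ μ (y, φ 1)) V :=
      h1.comp (by fun_prop) fun y hy => hy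
    exact h2.clm_apply contDiffOn_const
  have hcont : Continuous (oneParam a) := (isMIntegralCurve_oneParam a).continuous
  let S₀ : Set ℝ := oneParam a ⁻¹' φ.source
  have hS₀ : IsOpen S₀ := (isOpen_extChartAt_source _).preimage hcont
  have hxS₀ : ContinuousOn x S₀ :=
    (continuousOn_extChartAt (I := 𝓘(ℝ, EG)) (1 : G)).comp hcont.continuousOn fun t ht => ht
  let S := S₀ ∩ x ⁻¹' V
  have hS : IsOpen S := hxS₀.isOpen_inter_preimage hS₀ hV
  have h0S : (0 : ℝ) ∈ S := by
    refine ⟨?_, ?_⟩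
    · simp only [S₀, mem_preimage, oneParam_zero]
      exact mem_extChartAt_source _
    · simp only [x, V, mem_preimage, oneParam_zero]
      exact hoW
  have hder : ∀ t ∈ S, HasDerivAt x (w (x t)) t := by
    intro t ht
    have e1 : HasFDerivAt μ (fderiv ℝ μ (x t, φ 1)) (x t, φ 1) :=
      ((hμ.contDiffAt (hW.mem_nhds ht.2)).differentiableAt (by simp)).hasFDerivAt
    have e2 : HasDerivAt (fun s => x (s - t)) x' t := by
      have := hx0'
      rw [← sub_self t] at this
      exact this.comp_sub_const t t
    have e3 : HasDerivAt (fun s => (x t, x (s - t))) (0, x') t := (hasDerivAt_const t (x t)).prodMk e2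
    have e4 : (x t, x (t - t)) = (x t, φ 1) := by simp [x, oneParam_zero]
    have e5 : HasDerivAt (fun s => μ (x t, x (s - t))) (w (x t)) t := by
      have e1' := e1
      rw [← e4] at e1'
      have := e1'.comp_hasDerivAt t e3
      rw [e4] at this
      exact this
    refine e5.congr_of_eventuallyEq ?_
    have e6 : ∀ᶠ s in 𝓝 t, s - t ∈ S₀ := by
      have : ContinuousAt (fun s : ℝ => s - t) t := by fun_prop
      refine this.eventually (hS₀.mem_nhds ?_)
      simp only [sub_self]; exact h0S.1
    filter_upwards [e6] with s hs
    simp only [x, μ]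
    rw [φ.left_inv ht.1, φ.left_inv hs, ← oneParam_add]
    simp
  have hxsm : ContDiffOn ℝ ∞ x S :=
    contDiffOn_of_hasDerivAt_autonomous hS hw (fun t ht => ht.2) hder
  have hxs : ContMDiffOn 𝓘(ℝ, ℝ) 𝓘(ℝ, EG) ∞ (φ.symm ∘ x) S :=
    hφs.comp hxsm.contMDiffOn fun t ht => φ.map_source ht.1
  refine (hxs.contMDiffAt (hS.mem_nhds h0S)).congr_of_eventuallyEq ?_
  filter_upwards [hS.mem_nhds h0S] with t ht
  exact (φ.left_inv ht.1).symm

theorem contMDiff_oneParam (a : GroupLieAlgebra 𝓘(ℝ, EG) G) :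
    ContMDiff 𝓘(ℝ, ℝ) 𝓘(ℝ, EG) ∞ (oneParam a) := by
  intro t
  have h1 : ContMDiffAt 𝓘(ℝ, ℝ) 𝓘(ℝ, ℝ) ∞ (fun s : ℝ => s - t) t :=
    (contDiff_id.sub contDiff_const).contMDiff.contMDiffAt
  have h2 : ContMDiffAt 𝓘(ℝ, ℝ) 𝓘(ℝ, EG) ∞ (fun s => oneParam a (s - t)) t :=
    ContMDiffAt.comp_of_eq (contMDiffAt_oneParam_zero a) h1 (sub_self t)
  have h3 : ContMDiffAt 𝓘(ℝ, ℝ) 𝓘(ℝ, EG) ∞ (fun s => oneParam a t * oneParam a (s - t)) t :=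
    (contMDiff_mul_left (I := 𝓘(ℝ, EG)) (n := ∞) (a := oneParam a t)).contMDiffAt.comp t h2
  refine h3.congr_of_eventuallyEq (.of_forall fun s => ?_)
  simp only [← oneParam_add, add_sub_cancel]

end Commutative

/-! ### The exponential map; compact connected commutative groups are tori -/

section Exponential

variable {EG G : Type*} [NormedAddCommGroup EG] [NormedSpace ℝ EG] [FiniteDimensional ℝ EG]
    [TopologicalSpace G] [ChartedSpace EG G] [CommGroup G] [LieGroup 𝓘(ℝ, EG) ∞ G] [T2Space G]

variable (G) in
/-- The exponential map of a commutative Lie group, as a homomorphism. -/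
def lieExp : EG →+ Additive G where
  toFun a :=
    have : CompleteSpace EG := FiniteDimensional.complete ℝ EG
    Additive.ofMul (oneParam (a : GroupLieAlgebra 𝓘(ℝ, EG) G) 1)
  map_zero' := by
    have : CompleteSpace EG := FiniteDimensional.complete ℝ EG
    have h := oneParam_smul_left 0 (0 : GroupLieAlgebra 𝓘(ℝ, EG) G) 1
    rw [zero_mul, oneParam_zero, zero_smul] at h
    exact congrArg Additive.ofMul h
  map_add' a b := by
    have : CompleteSpace EG := FiniteDimensional.complete ℝ EG
    exact congrArg Additive.ofMul (oneParam_add_left (a : GroupLieAlgebra 𝓘(ℝ, EG) G) b 1)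

theorem lieExp_smul [CompleteSpace EG] (t : ℝ) (a : EG) :
    (lieExp G (t • a)).toMul = oneParam (a : GroupLieAlgebra 𝓘(ℝ, EG) G) t := by
  have h := oneParam_smul_left (EG := EG) (G := G) t a 1
  rw [mul_one] at h
  exact h

/-- In a basis the exponential is a finite product of one-parameter subgroups evaluated at the
coordinates, so smooth dependence of flows on parameters is not needed. -/
theorem contMDiff_lieExp : ContMDiff 𝓘(ℝ, EG) 𝓘(ℝ, EG) ∞ (fun a : EG => (lieExp G a).toMul) := by
  have : CompleteSpace EG := FiniteDimensional.complete ℝ EG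
  let b := Module.finBasis ℝ EG
  have h : (fun a : EG => (lieExp G a).toMul) =
      fun a => ∏ i, oneParam (b i : GroupLieAlgebra 𝓘(ℝ, EG) G) (b.repr a i) := by
    ext a
    conv_lhs => rw [← b.sum_repr a, map_sum, toMul_sum]
    exact Finset.prod_congr rfl fun i _ => lieExp_smul _ _
  rw [h]
  refine contMDiff_finsetProd fun i _ => (contMDiff_oneParam _).comp ?_
  have : ContDiff ℝ ∞ (fun a => b.coord i a) := (b.coord i).toContinuousLinearMap.contDiff
  exact this.contMDiff

theorem hasMFDerivAt_lieExp_zero :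
    HasMFDerivAt 𝓘(ℝ, EG) 𝓘(ℝ, EG) (fun a : EG => (lieExp G a).toMul) 0
      (ContinuousLinearMap.id ℝ EG) := by
  have : CompleteSpace EG := FiniteDimensional.complete ℝ EG
  have h := (contMDiff_lieExp (G := G) (EG := EG)).mdifferentiableAt (x := (0 : EG)) (by simp)
  refine h.hasMFDerivAt.congr_mfderiv ?_
  refine ContinuousLinearMap.ext fun (a : EG) => ?_
  have h1 : HasMFDerivAt 𝓘(ℝ, ℝ) 𝓘(ℝ, EG) (fun t : ℝ => t • a) 0
      ((1 : ℝ →L[ℝ] ℝ).smulRight a) :=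
    ((1 : ℝ →L[ℝ] ℝ).smulRight a).hasFDerivAt.hasMFDerivAt
  have h2 := h.hasMFDerivAt.comp_of_eq' h1 (zero_smul ℝ a)
  have h3 : HasMFDerivAt 𝓘(ℝ, ℝ) 𝓘(ℝ, EG) (fun t : ℝ => (lieExp G (t • a)).toMul) 0
      ((1 : ℝ →L[ℝ] ℝ).smulRight a : ℝ →L[ℝ] EG) :=
    (hasMFDerivAt_oneParam_zero (EG := EG) (G := G) a).congr_of_eventuallyEq
      (.of_forall fun t => lieExp_smul t a)
  have h4 := DFunLike.congr_fun (hasMFDerivAt_unique h2 h3) (1 : ℝ)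
  have key : ∀ A : EG →L[ℝ] EG, A ((1 : ℝ) • a) = (1 : ℝ) • a → A a = a := by
    intro A h
    rwa [one_smul] at h
  exact key _ h4

/-- Since exp is a homomorphism, its derivative at x is that of a left translation composed with its
derivative at 0, the identity. It is thus invertible everywhere. -/
theorem exists_openPartialHomeomorph_lieExp (x : EG) :
    ∃ e : OpenPartialHomeomorph EG G, x ∈ e.source ∧
      EqOn e (fun a : EG => (lieExp G a).toMul) e.source ∧
      ContMDiffOn 𝓘(ℝ, EG) 𝓘(ℝ, EG) ∞ e.symm e.target := by
  have : CompleteSpace EG := FiniteDimensional.complete ℝ EG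
  have hsm := contMDiff_lieExp (G := G) (EG := EG)
  suffices hbij : Function.Bijective
      (mfderiv 𝓘(ℝ, EG) 𝓘(ℝ, EG) (fun a : EG => (lieExp G a).toMul) x) by
    obtain ⟨e, h1, _, h2, h3⟩ := hsm.contMDiffOn.exists_openPartialHomeomorph isOpen_univ
      (mem_univ x) hbij
    exact ⟨e, h1, h2, h3⟩
  have h1 : HasMFDerivAt 𝓘(ℝ, EG) 𝓘(ℝ, EG) (fun a : EG => a - x) x (ContinuousLinearMap.id ℝ EG) :=
    ((hasFDerivAt_id x).sub_const x).hasMFDerivAt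
  have h2 := (hasMFDerivAt_lieExp_zero (G := G)).comp_of_eq' h1 (sub_self x)
  have h3 := (hasMFDerivAt_mul_left (EG := EG) (lieExp G x).toMul (1 : G)).comp_of_eq' h2
    (by simp)
  have h4 : HasMFDerivAt 𝓘(ℝ, EG) 𝓘(ℝ, EG) (fun a : EG => (lieExp G a).toMul) x
      (mfderiv 𝓘(ℝ, EG) 𝓘(ℝ, EG) (fun k : G => (lieExp G x).toMul * k) 1 : EG →L[ℝ] EG) := by
    refine (h3.congr_of_eventuallyEq (.of_forall fun a => ?_)).congr_mfderiv ?_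
    · simp only [← toMul_add, ← map_add, add_sub_cancel]
    · rfl
  rw [h4.mfderiv]
  let g := (lieExp G x).toMul
  have e1 := (hasMFDerivAt_mul_left (EG := EG) g⁻¹ g).comp_of_eq'
    (hasMFDerivAt_mul_left (EG := EG) g 1) (mul_one g)
  have e2 := (hasMFDerivAt_mul_left (EG := EG) g 1).comp_of_eq'
    (hasMFDerivAt_mul_left (EG := EG) g⁻¹ g) (inv_mul_cancel g)
  have e1' := hasMFDerivAt_unique (e1.congr_of_eventuallyEq
    (.of_forall fun k => (inv_mul_cancel_left g k).symm)) (hasMFDerivAt_id _)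
  have e2' := hasMFDerivAt_unique (e2.congr_of_eventuallyEq
    (.of_forall fun k => (mul_inv_cancel_left g k).symm)) (hasMFDerivAt_id _)
  exact Function.bijective_iff_has_inverse.2 ⟨_, fun v => DFunLike.congr_fun e1' v,
    fun v => DFunLike.congr_fun e2' v⟩

theorem isOpenMap_lieExp : IsOpenMap (fun a : EG => (lieExp G a).toMul) := by
  refine isOpenMap_iff_nhds_le.2 fun x => ?_
  obtain ⟨e, hx, he, -⟩ := exists_openPartialHomeomorph_lieExp (G := G) x
  have h := e.map_nhds_eq hx
  rw [he hx, map_congr (he.eventuallyEq_of_mem (e.open_source.mem_nhds hx))] at h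
  exact h.ge

/-- The image is an open subgroup, hence also closed, in a connected group. -/
theorem lieExp_surjective [PreconnectedSpace G] :
    Function.Surjective (fun a : EG => (lieExp G a).toMul) := by
  have : IsTopologicalGroup G := topologicalGroup_of_lieGroup 𝓘(ℝ, EG) ∞
  let R : Subgroup G := (AddMonoidHom.toMultiplicativeLeft (lieExp G (EG := EG))).range
  have hR : (R : Set G) = range (fun a : EG => (lieExp G a).toMul) := rfl
  have hopen : IsOpen (R : Set G) := by
    rw [hR]; exact isOpenMap_lieExp.isOpen_range
  have hclosed : IsClosed (R : Set G) := R.isClosed_of_isOpen hopen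
  have := IsClopen.eq_univ ⟨hclosed, hopen⟩ ⟨1, R.one_mem⟩
  rw [← range_eq_univ, ← hR, this]

variable (EG G) in
/-- The kernel of the exponential map, as a `ℤ`-submodule of the Lie algebra. -/
def lieExpKer : Submodule ℤ EG := AddSubgroup.toIntSubmodule (lieExp G (EG := EG)).ker

theorem mem_lieExpKer {x : EG} : x ∈ lieExpKer EG G ↔ lieExp G x = 0 := Iff.rfl

/-- The exponential is injective near 0, so 0 is isolated in its kernel. -/
instance discreteTopology_lieExpKer : DiscreteTopology (lieExpKer EG G) := by
  obtain ⟨e, h0, he, -⟩ := exists_openPartialHomeomorph_lieExp (G := G) (0 : EG)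
  refine discreteTopology_of_isOpen_singleton_zero ?_
  have : ({0} : Set (lieExpKer EG G)) = Subtype.val ⁻¹' e.source := by
    ext ⟨x, hx⟩
    simp only [mem_singleton_iff, mem_preimage]
    constructor
    · intro h
      rw [Subtype.ext_iff] at h
      simp only [ZeroMemClass.coe_zero] at h
      rwa [h]
    · intro h
      refine Subtype.ext (e.injOn h h0 ?_)
      refine (he h).trans (Eq.trans ?_ (he h0).symm)
      simp [mem_lieExpKer.1 hx]
  rw [this]
  exact e.open_source.preimage continuous_subtype_val

variable [CompactSpace G] [PreconnectedSpace G]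

/-- If the kernel did not span, a nonzero linear functional would vanish on it. By compactness G is
the image of one ball, so every vector is congruent modulo the kernel to one in that ball, and the
functional would be bounded. -/
instance isZLattice_lieExpKer : IsZLattice ℝ (lieExpKer EG G) where
  span_top := by
    by_contra hne
    obtain ⟨f, hf0, hf⟩ := Submodule.exists_le_ker_of_lt_top _ (lt_top_iff_ne_top.2 hne)
    have hcov : (univ : Set G) ⊆ ⋃ n : ℕ,
        (fun a : EG => (lieExp G a).toMul) '' Metric.ball 0 n := by
      intro g _
      obtain ⟨x, rfl⟩ := lieExp_surjective (EG := EG) g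
      obtain ⟨n, hn⟩ := exists_nat_gt ‖x‖
      exact mem_iUnion.2 ⟨n, x, by simpa using hn, rfl⟩
    obtain ⟨n, hn⟩ := isCompact_univ.elim_directed_cover _
      (fun n : ℕ => isOpenMap_lieExp _ Metric.isOpen_ball) hcov
      (directed_of_isDirected_le fun m n hmn => image_mono (Metric.ball_subset_ball (by simpa)))
    obtain ⟨C, hC⟩ := (isCompact_closedBall (0 : EG) n).exists_bound_of_continuousOn
      (f := f) f.toContinuousLinearMap.continuous.continuousOn
    have hbdd : ∀ x, ‖f x‖ ≤ C := by
      intro x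
      obtain ⟨y, hy, hxy⟩ := hn (mem_univ (lieExp G x).toMul)
      have h1 : x - y ∈ lieExpKer EG G := by
        rw [mem_lieExpKer, map_sub, sub_eq_zero]
        exact hxy.symm
      have h2 : f (x - y) = 0 := hf (Submodule.subset_span h1)
      rw [map_sub, sub_eq_zero] at h2
      rw [h2]
      exact hC y (Metric.ball_subset_closedBall hy)
    refine hf0 (LinearMap.ext fun x => ?_)
    by_contra hx
    rw [LinearMap.zero_apply] at hx
    have h3 : 0 < ‖f x‖ := norm_pos_iff.2 hx
    have h4 := hbdd (((C + 1) / ‖f x‖) • x)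
    rw [map_smul, norm_smul, norm_div, norm_norm, div_mul_cancel₀ _ h3.ne'] at h4
    have := le_abs_self (C + 1)
    rw [Real.norm_eq_abs] at h4
    linarith

/-- Through p = exp and through c, both G and the standard torus are quotients of the Lie algebra by
the same lattice. The induced isomorphism is smooth both ways because both covering maps have local
smooth inverses. -/
theorem isTorus_of_commGroup : IsTorus EG G := by
  have : CompleteSpace EG := FiniteDimensional.complete ℝ EG
  let n := Module.finrank ℤ (lieExpKer EG G)
  let b : Module.Basis (Fin n) ℝ EG := (Module.finBasis ℤ (lieExpKer EG G)).ofZLatticeBasis ℝ _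
  have hker : ∀ x : EG, x ∈ lieExpKer EG G ↔ ∀ i, ∃ m : ℤ, b.repr x i = m := by
    intro x
    rw [← (Module.finBasis ℤ (lieExpKer EG G)).ofZLatticeBasis_span ℝ]
    rw [b.mem_span_iff_repr_mem ℤ]
    simp [eq_comm]
  -- the covering of the standard torus
  let c : EG → Fin n → Circle := fun x i => Circle.exp (2 * Real.pi * b.repr x i)
  have hcsm : ContMDiff 𝓘(ℝ, EG) (ModelWithCorners.pi fun _ : Fin n => 𝓡 1) ∞ c := by
    intro x
    refine contMDiffAt_pi_of_forall fun i => ?_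
    have h1 : ContDiff ℝ ∞ (fun a => 2 * Real.pi * b.coord i a) :=
      contDiff_const.mul (b.coord i).toContinuousLinearMap.contDiff
    exact contMDiff_circleExp.contMDiffAt.comp x h1.contMDiff.contMDiffAt
  have hcadd : ∀ x y, c (x + y) = c x * c y := by
    intro x y
    ext i
    simp [c, mul_add, Circle.exp_add]
  have hcker : ∀ x, c x = 1 ↔ lieExp G x = 0 := by
    intro x
    rw [← mem_lieExpKer, hker]
    simp only [c, funext_iff, Pi.one_apply, Circle.exp_eq_one]
    refine forall_congr' fun i => exists_congr fun m => ?_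
    have := Real.pi_pos
    constructor
    · intro h
      have h2 : 2 * Real.pi * (b.repr x i - m) = 0 := by linarith
      rcases mul_eq_zero.1 h2 with h3 | h3 <;> linarith
    · intro h; rw [h]; ring
  let p : EG → G := fun a => (lieExp G a).toMul
  have hp : Function.Surjective p := lieExp_surjective
  have hpadd : ∀ x y, p (x + y) = p x * p y := fun x y => by simp [p]
  have hcp : ∀ x y, p x = p y ↔ c x = c y := by
    intro x y
    have h1 : p x = p y ↔ lieExp G (x - y) = 0 := by
      rw [map_sub, sub_eq_zero]; rfl
    have h2 : c x = c (x - y) * c y := by rw [← hcadd, sub_add_cancel]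
    rw [h1, ← hcker, h2, mul_eq_right]
  let f : G → Fin n → Circle := fun g => c (Function.surjInv hp g)
  have hfp : ∀ x, f (p x) = c x := fun x => (hcp _ _).1 (Function.surjInv_eq hp (p x))
  -- Division by 2π undoes the normalisation in c: L lifts a tuple of angles to the Lie algebra.
  let L : (Fin n → ℝ) → EG := fun t => ∑ i, (t i / (2 * Real.pi)) • b i
  have hcL : ∀ t, c (L t) = fun i => Circle.exp (t i) := by
    intro t
    ext i
    have h1 : b.repr (L t) i = t i / (2 * Real.pi) := by
      simp only [L]
      rw [← b.equivFun_apply, map_sum, Finset.sum_apply]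
      simp [Finsupp.single_apply]
    simp only [c, h1]
    rw [mul_div_cancel₀ _ (by positivity)]
  have hLsm : ContDiff ℝ ∞ L := by fun_prop
  have hfinj : Function.Injective f := by
    intro g h hgh
    obtain ⟨x, rfl⟩ := hp g
    obtain ⟨y, rfl⟩ := hp h
    rw [hfp, hfp] at hgh
    exact (hcp x y).2 hgh
  have hfsurj : Function.Surjective f := fun z =>
    ⟨p (L fun i => Complex.arg (z i)), by
      rw [hfp, hcL]; ext i; simp [Circle.exp_arg]⟩
  let φ : G →* (Fin n → Circle) := MonoidHom.mk' f fun g h => by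
    obtain ⟨x, rfl⟩ := hp g
    obtain ⟨y, rfl⟩ := hp h
    rw [← hpadd, hfp, hfp, hfp, hcadd]
  let e : G ≃* (Fin n → Circle) := MulEquiv.ofBijective φ ⟨hfinj, hfsurj⟩
  have hesymm : ∀ x, e.symm (c x) = p x := fun x => by
    rw [← hfp x]; exact e.symm_apply_apply (p x)
  refine ⟨n, e, ?_, ?_⟩
  · intro g
    obtain ⟨x, rfl⟩ := hp g
    obtain ⟨ψ, hx, hψ, hψs⟩ := exists_openPartialHomeomorph_lieExp (G := G) x
    have hpx : p x ∈ ψ.target := by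
      rw [show p x = ψ x from (hψ hx).symm]; exact ψ.map_source hx
    have h1 := hcsm.contMDiffAt.comp (p x) (hψs.contMDiffAt (ψ.open_target.mem_nhds hpx))
    refine h1.congr_of_eventuallyEq ?_
    filter_upwards [ψ.open_target.mem_nhds hpx] with y hy
    change f y = c (ψ.symm y)
    rw [← hfp]
    congr 1
    rw [show p (ψ.symm y) = ψ (ψ.symm y) from (hψ (ψ.map_target hy)).symm, ψ.right_inv hy]
  · intro z
    -- Angles of w that depend smoothly on w near z. Rotating by the inverse of z brings the
    -- argument close to 1, away from its discontinuity, and the constant angle of z is added back.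
    let A : (Fin n → Circle) → (Fin n → ℝ) := fun w i => Complex.arg (w i * (z i)⁻¹ : Circle)
      + Complex.arg (z i)
    have hA : ContMDiffAt (ModelWithCorners.pi fun _ : Fin n => 𝓡 1) 𝓘(ℝ, Fin n → ℝ) ∞ A z := by
      refine contMDiffAt_pi_space.2 fun i => ?_
      have h1 : ContMDiffAt (ModelWithCorners.pi fun _ : Fin n => 𝓡 1) (𝓡 1) ∞
          (fun w : Fin n → Circle => w i * (z i)⁻¹) z :=
        (contMDiff_mul_right (I := 𝓡 1) (n := ∞) (a := (z i)⁻¹)).contMDiffAt.comp z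
          ((contMDiff_pi_apply (I := fun _ : Fin n => 𝓡 1) (N := fun _ => Circle) i) z)
      have h2 := ContMDiffAt.comp_of_eq contMDiffAt_circle_arg_one h1 (mul_inv_cancel (z i))
      exact h2.add contMDiffAt_const
    have h3 : ContMDiffAt (ModelWithCorners.pi fun _ : Fin n => 𝓡 1) 𝓘(ℝ, EG) ∞
        (fun w => p (L (A w))) z :=
      (contMDiff_lieExp.comp hLsm.contMDiff).contMDiffAt.comp z hA
    refine h3.congr_of_eventuallyEq (.of_forall fun w => ?_)
    change e.symm w = p (L (A w))
    rw [← hesymm, hcL]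
    congr 1
    funext i
    simp only [A, Circle.exp_add, Circle.exp_arg, inv_mul_cancel_right]

end Exponential

/-- A compact connected commutative Lie group is a torus. -/
theorem isTorus_of_mul_comm {EG G : Type*} [NormedAddCommGroup EG] [NormedSpace ℝ EG]
    [FiniteDimensional ℝ EG] [TopologicalSpace G] [ChartedSpace EG G] [Group G]
    [LieGroup 𝓘(ℝ, EG) ∞ G] [T2Space G] [CompactSpace G] [PreconnectedSpace G]
    (h : ∀ g k : G, g * k = k * g) : IsTorus EG G :=
  letI : CommGroup G := { ‹Group G› with mul_comm := h }
  isTorus_of_commGroup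

/-! ### Manifold structures from charts; regular level sets -/

section ChartFamily

variable {X F : Type*} [TopologicalSpace X] [NormedAddCommGroup F] [NormedSpace ℝ F]

/-- The charted space structure given by a choice of charts around all points. -/
@[reducible]
def chartedSpaceOfCharts (c : X → OpenPartialHomeomorph X F) (hc : ∀ x, x ∈ (c x).source) :
    ChartedSpace F X where
  atlas := range c
  chartAt := c
  mem_chart_source := hc
  chart_mem_atlas := mem_range_self

theorem isManifold_chartedSpaceOfCharts (c : X → OpenPartialHomeomorph X F)
    (hc : ∀ x, x ∈ (c x).source)
    (h : ∀ x y, ContDiffOn ℝ ∞ (c y ∘ (c x).symm) ((c x).target ∩ (c x).symm ⁻¹' (c y).source)) :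
    @IsManifold ℝ _ F _ _ F _ 𝓘(ℝ, F) ∞ X _ (chartedSpaceOfCharts c hc) := by
  let := chartedSpaceOfCharts c hc
  refine isManifold_of_contDiffOn _ _ _ ?_
  rintro _ _ ⟨x, rfl⟩ ⟨y, rfl⟩
  simpa [OpenPartialHomeomorph.trans_source] using h x y

end ChartFamily

section LinearAlgebra

variable {E V F : Type*} [NormedAddCommGroup E] [NormedSpace ℝ E] [FiniteDimensional ℝ E]
  [NormedAddCommGroup V] [NormedSpace ℝ V] [FiniteDimensional ℝ V]
  [NormedAddCommGroup F] [NormedSpace ℝ F] [FiniteDimensional ℝ F]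

omit [FiniteDimensional ℝ V] [FiniteDimensional ℝ F] in
theorem finrank_ker_of_surjective {A : E →L[ℝ] V} (hA : Function.Surjective A)
    (hd : Module.finrank ℝ F + Module.finrank ℝ V = Module.finrank ℝ E) :
    Module.finrank ℝ (LinearMap.ker A.toLinearMap) = Module.finrank ℝ F := by
  have h1 := LinearMap.finrank_range_add_finrank_ker A.toLinearMap
  rw [LinearMap.range_eq_top.2 hA, finrank_top] at h1
  omega

/-- A surjective linear map can be completed to an isomorphism onto a product. -/
theorem exists_prod_bijective {A : E →L[ℝ] V} (hA : Function.Surjective A)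
    (hd : Module.finrank ℝ F + Module.finrank ℝ V = Module.finrank ℝ E) :
    ∃ L : E →L[ℝ] F, Function.Bijective (A.prod L) := by
  let K := LinearMap.ker A.toLinearMap
  obtain ⟨p, hp⟩ := LinearMap.exists_leftInverse_of_injective K.subtype K.ker_subtype
  let e : K ≃ₗ[ℝ] F := LinearEquiv.ofFinrankEq K F (finrank_ker_of_surjective hA hd)
  let L : E →L[ℝ] F := (e.toLinearMap ∘ₗ p).toContinuousLinearMap
  have hinj : Function.Injective (A.prod L) := by
    rw [injective_iff_map_eq_zero]
    intro v hv
    rw [ContinuousLinearMap.prod_apply, Prod.mk_eq_zero] at hv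
    have h1 : p (K.subtype ⟨v, hv.1⟩) = ⟨v, hv.1⟩ := DFunLike.congr_fun hp ⟨v, hv.1⟩
    have h2 : e (p v) = 0 := hv.2
    rw [map_eq_zero_iff _ e.injective] at h2
    have h3 : (⟨v, hv.1⟩ : K) = 0 := h1.symm.trans h2
    exact congrArg Subtype.val h3
  refine ⟨L, hinj, ?_⟩
  refine (LinearMap.injective_iff_surjective_of_finrank_eq_finrank
    (f := (A.prod L).toLinearMap) ?_).1 hinj
  rw [Module.finrank_prod]; omega

/-- An injective linear map can be completed to an isomorphism from a product. -/
theorem exists_coprod_bijective {A : V →L[ℝ] E} (hA : Function.Injective A)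
    (hd : Module.finrank ℝ F + Module.finrank ℝ V = Module.finrank ℝ E) :
    ∃ L : F →L[ℝ] E, Function.Bijective (A.coprod L) := by
  obtain ⟨C, hC⟩ := Submodule.exists_isCompl (LinearMap.range A.toLinearMap)
  have h1 := Submodule.finrank_add_eq_of_isCompl hC
  rw [LinearMap.finrank_range_of_inj hA] at h1
  let e : F ≃ₗ[ℝ] C := LinearEquiv.ofFinrankEq F C (by omega)
  let L : F →L[ℝ] E := (C.subtype ∘ₗ e.toLinearMap).toContinuousLinearMap
  have hinj : Function.Injective (A.coprod L) := by
    rw [injective_iff_map_eq_zero]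
    rintro ⟨v, w⟩ hv
    rw [ContinuousLinearMap.coprod_apply] at hv
    have h2 : A v = -L w := eq_neg_of_add_eq_zero_left hv
    have h3 : A v ∈ C := by rw [h2]; exact C.neg_mem (e w).2
    have h4 : A v = 0 := Submodule.disjoint_def.1 hC.disjoint _ ⟨v, rfl⟩ h3
    have h5 : L w = 0 := by rw [h4] at h2; simpa using h2
    have h6 : e w = 0 := Subtype.ext h5
    rw [map_eq_zero_iff _ e.injective] at h6
    rw [(map_eq_zero_iff A hA).1 h4, h6]; rfl
  refine ⟨L, hinj, ?_⟩
  refine (LinearMap.injective_iff_surjective_of_finrank_eq_finrank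
    (f := (A.coprod L).toLinearMap) ?_).1 hinj
  rw [Module.finrank_prod]; omega

end LinearAlgebra

section LevelSet

variable {E M V F : Type*} [NormedAddCommGroup E] [NormedSpace ℝ E] [FiniteDimensional ℝ E]
  [TopologicalSpace M] [ChartedSpace E M] [IsManifold 𝓘(ℝ, E) ∞ M]
  [NormedAddCommGroup V] [NormedSpace ℝ V] [FiniteDimensional ℝ V]
  [NormedAddCommGroup F] [NormedSpace ℝ F] [FiniteDimensional ℝ F]

/-- Around a regular point, a smooth map is the first coordinate of a chart. -/
theorem exists_straightening {Φ : M → V} (hΦ : ContMDiff 𝓘(ℝ, E) 𝓘(ℝ, V) ∞ Φ)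
    (hd : Module.finrank ℝ F + Module.finrank ℝ V = Module.finrank ℝ E) {x : M}
    (hx : Function.Surjective (mfderiv 𝓘(ℝ, E) 𝓘(ℝ, V) Φ x)) :
    ∃ e : OpenPartialHomeomorph M (V × F), x ∈ e.source ∧ (∀ y ∈ e.source, (e y).1 = Φ y) ∧
      ContMDiffOn 𝓘(ℝ, E) 𝓘(ℝ, V × F) ∞ e e.source ∧
      ContMDiffOn 𝓘(ℝ, V × F) 𝓘(ℝ, E) ∞ e.symm e.target := by
  have : CompleteSpace E := FiniteDimensional.complete ℝ E
  have : CompleteSpace V := FiniteDimensional.complete ℝ V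
  have : CompleteSpace F := FiniteDimensional.complete ℝ F
  let A : E →L[ℝ] V := mfderiv 𝓘(ℝ, E) 𝓘(ℝ, V) Φ x
  obtain ⟨L, hL⟩ := exists_prod_bijective (A := A) (F := F) hx hd
  let φ := extChartAt 𝓘(ℝ, E) x
  have hφ : ContMDiffOn 𝓘(ℝ, E) 𝓘(ℝ, E) ∞ φ φ.source := by
    have := contMDiffOn_extChartAt (I := 𝓘(ℝ, E)) (n := ∞) (x := x)
    rwa [← extChartAt_source 𝓘(ℝ, E)] at this
  -- L is an isomorphism on the kernel of dΦ at x, so Φ together with L in the chart has bijective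
  -- derivative there.
  let f : M → V × F := fun y => (Φ y, L (φ y))
  have hf : ContMDiffOn 𝓘(ℝ, E) 𝓘(ℝ, V × F) ∞ f φ.source :=
    hΦ.contMDiffOn.prodMk_space (L.contDiff.contMDiff.comp_contMDiffOn hφ)
  have hfd : HasMFDerivAt 𝓘(ℝ, E) 𝓘(ℝ, V × F) f x (A.prod L : E →L[ℝ] V × F) := by
    have h1 : HasMFDerivAt 𝓘(ℝ, E) 𝓘(ℝ, V) Φ x A :=
      (hΦ.mdifferentiableAt (by simp)).hasMFDerivAt
    have h2 : HasMFDerivAt 𝓘(ℝ, E) 𝓘(ℝ, E) φ x (ContinuousLinearMap.id ℝ E) := by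
      have h := mdifferentiableAt_extChartAt (I := 𝓘(ℝ, E)) (mem_chart_source E x)
      exact h.hasMFDerivAt.congr_mfderiv mfderiv_extChartAt_self
    have h3 : HasMFDerivAt 𝓘(ℝ, E) 𝓘(ℝ, F) (fun y => L (φ y)) x (L : E →L[ℝ] F) :=
      L.hasFDerivAt.hasMFDerivAt.comp_of_eq' h2 rfl
    have h4 := (hf.contMDiffAt (extChartAt_source_mem_nhds x)).mdifferentiableAt (by simp)
    refine h4.hasMFDerivAt.congr_mfderiv ?_
    have h5 := (ContinuousLinearMap.fst ℝ V F).hasFDerivAt.hasMFDerivAt.comp_of_eq'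
      h4.hasMFDerivAt rfl
    have h6 := (ContinuousLinearMap.snd ℝ V F).hasFDerivAt.hasMFDerivAt.comp_of_eq'
      h4.hasMFDerivAt rfl
    refine ContinuousLinearMap.ext fun v => Prod.ext ?_ ?_
    · exact DFunLike.congr_fun (hasMFDerivAt_unique h5 h1) v
    · exact DFunLike.congr_fun (hasMFDerivAt_unique h6 h3) v
  obtain ⟨e, h1, h2, h3, h4⟩ := hf.exists_openPartialHomeomorph (isOpen_extChartAt_source x)
    (mem_extChartAt_source x) (by rw [hfd.mfderiv]; exact hL)
  exact ⟨e, h1, fun y hy => by rw [h3 hy], (hf.mono h2).congr h3, h4⟩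

/-- The chart of a level set induced by a straightening chart of the manifold. -/
def levelChart {Φ : M → V} {η : V} (z : Φ ⁻¹' {η}) (e : OpenPartialHomeomorph M (V × F))
    (he : ∀ y ∈ e.source, (e y).1 = Φ y) : OpenPartialHomeomorph (Φ ⁻¹' {η}) F where
  toFun w := (e w).2
  -- Outside the target the value is arbitrary; z only supplies a point of the level set.
  invFun u := by
    classical exact if h : (η, u) ∈ e.target then ⟨e.symm (η, u), by
      have := he _ (e.map_target h)
      rw [e.right_inv h] at this
      exact this.symm⟩ else z
  source := Subtype.val ⁻¹' e.source
  target := (fun u => (η, u)) ⁻¹' e.target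
  map_source' w hw := by
    have h1 : (η, (e w).2) = e w := Prod.ext (((he _ hw).trans w.2).symm) rfl
    simp only [mem_preimage, h1]
    exact e.map_source hw
  map_target' u hu := by
    simp only [mem_preimage] at hu ⊢
    rw [dif_pos hu]
    exact e.map_target hu
  left_inv' w hw := by
    have h1 : (η, (e w).2) = e w := Prod.ext (((he _ hw).trans w.2).symm) rfl
    have h2 : (η, (e w).2) ∈ e.target := by rw [h1]; exact e.map_source hw
    rw [dif_pos h2]
    refine Subtype.ext ?_
    simp only [h1]
    exact e.left_inv hw
  right_inv' u hu := by
    simp only [mem_preimage] at hu ⊢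
    rw [dif_pos hu]
    simp only [e.right_inv hu]
  open_source := e.open_source.preimage continuous_subtype_val
  open_target := e.open_target.preimage (by fun_prop)
  continuousOn_toFun := continuous_snd.comp_continuousOn
    (e.continuousOn.comp continuous_subtype_val.continuousOn fun w hw => hw)
  continuousOn_invFun := by
    rw [Topology.IsInducing.subtypeVal.continuousOn_iff]
    have h : ContinuousOn (fun u => e.symm (η, u)) ((fun u => (η, u)) ⁻¹' e.target) :=
      e.continuousOn_symm.comp (by fun_prop) fun u hu => hu
    refine h.congr fun u hu => ?_
    simp only [mem_preimage] at hu
    simp only [Function.comp_apply]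
    rw [dif_pos hu]

omit [NormedSpace ℝ V] [FiniteDimensional ℝ V] [NormedSpace ℝ F] [FiniteDimensional ℝ F] in
theorem levelChart_symm_coe {Φ : M → V} {η : V} (z : Φ ⁻¹' {η})
    (e : OpenPartialHomeomorph M (V × F)) (he : ∀ y ∈ e.source, (e y).1 = Φ y) {u : F}
    (hu : u ∈ (levelChart z e he).target) : ((levelChart z e he).symm u : M) = e.symm (η, u) := by
  change ((levelChart z e he).invFun u : M) = _
  simp only [levelChart]
  rw [dif_pos (show (η, u) ∈ e.target from hu)]

/-- A regular level set is an embedded submanifold: the inclusion is smooth, its differential is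
injective, and there are local smooth retractions. -/
theorem exists_levelSet_manifold {Φ : M → V} (hΦ : ContMDiff 𝓘(ℝ, E) 𝓘(ℝ, V) ∞ Φ)
    (hd : Module.finrank ℝ F + Module.finrank ℝ V = Module.finrank ℝ E) {η : V}
    (hx : ∀ x ∈ Φ ⁻¹' {η}, Function.Surjective (mfderiv 𝓘(ℝ, E) 𝓘(ℝ, V) Φ x)) :
    ∃ _ : ChartedSpace F (Φ ⁻¹' {η}), IsManifold 𝓘(ℝ, F) ∞ (Φ ⁻¹' {η}) ∧
      ContMDiff 𝓘(ℝ, F) 𝓘(ℝ, E) ∞ (Subtype.val : Φ ⁻¹' {η} → M) ∧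
      (∀ z : Φ ⁻¹' {η}, ∃ r : M → Φ ⁻¹' {η}, ContMDiffAt 𝓘(ℝ, E) 𝓘(ℝ, F) ∞ r z ∧
        ∀ᶠ w : Φ ⁻¹' {η} in 𝓝 z, r (w : M) = w) := by
  choose e hes hef hesm hesymm using fun z : Φ ⁻¹' {η} =>
    exists_straightening (F := F) hΦ hd (hx z z.2)
  let c := fun z => levelChart z (e z) (hef z)
  have hc : ∀ z, z ∈ (c z).source := fun z => hes z
  have hcs : ∀ z, ContMDiffOn 𝓘(ℝ, F) 𝓘(ℝ, E) ∞ (fun u => ((c z).symm u : M)) (c z).target := by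
    intro z
    have h1 : ContMDiff 𝓘(ℝ, F) 𝓘(ℝ, V × F) ∞ (fun u : F => (η, u)) :=
      (contDiff_const.prodMk contDiff_id).contMDiff
    refine ((hesymm z).comp (s := (c z).target) h1.contMDiffOn fun u hu => hu).congr fun u hu => ?_
    exact levelChart_symm_coe z (e z) (hef z) hu
  have hce : ∀ z, ContMDiffOn 𝓘(ℝ, E) 𝓘(ℝ, F) ∞ (fun y => (e z y).2) (e z).source := fun z =>
    contDiff_snd.contMDiff.comp_contMDiffOn (hesm z)
  let cs := chartedSpaceOfCharts c hc
  have hman : IsManifold 𝓘(ℝ, F) ∞ (Φ ⁻¹' {η}) := by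
    refine isManifold_chartedSpaceOfCharts c hc fun x y => ?_
    rw [← contMDiffOn_iff_contDiffOn]
    exact (hce y).comp ((hcs x).mono inter_subset_left) fun u hu => hu.2
  have hchart : ∀ z, ContMDiffOn 𝓘(ℝ, F) 𝓘(ℝ, F) ∞ (c z) (c z).source := fun z =>
    contMDiffOn_chart (I := 𝓘(ℝ, F)) (n := ∞) (x := z)
  have hchart_symm : ∀ z, ContMDiffOn 𝓘(ℝ, F) 𝓘(ℝ, F) ∞ (c z).symm (c z).target := fun z =>
    contMDiffOn_chart_symm (I := 𝓘(ℝ, F)) (n := ∞) (x := z)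
  refine ⟨cs, hman, fun z => ?_, fun z => ⟨fun y => (c z).symm (e z y).2, ?_, ?_⟩⟩
  · have h1 : ContMDiffAt 𝓘(ℝ, F) 𝓘(ℝ, E) ∞ ((fun u => ((c z).symm u : M)) ∘ c z) z :=
      ((hcs z).contMDiffAt ((c z).open_target.mem_nhds ((c z).map_source (hc z)))).comp z
        ((hchart z).contMDiffAt ((c z).open_source.mem_nhds (hc z)))
    refine h1.congr_of_eventuallyEq ?_
    filter_upwards [(c z).open_source.mem_nhds (hc z)] with w hw
    simp only [Function.comp_apply, (c z).left_inv hw]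
  · have h1 : ContMDiffAt 𝓘(ℝ, E) 𝓘(ℝ, F) ∞ (fun y => (e z y).2) z :=
      (hce z).contMDiffAt ((e z).open_source.mem_nhds (hes z))
    exact ((hchart_symm z).contMDiffAt ((c z).open_target.mem_nhds
      ((c z).map_source (hc z)))).comp (z : M) h1
  · filter_upwards [(c z).open_source.mem_nhds (hc z)] with w hw
    exact (c z).left_inv hw

end LevelSet

/-! ### The orbit space of a free action of a compact group -/

section QuotientManifold

variable {EG G EP P X F : Type*}
  [NormedAddCommGroup EG] [NormedSpace ℝ EG] [FiniteDimensional ℝ EG]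
  [TopologicalSpace G] [ChartedSpace EG G] [Group G] [LieGroup 𝓘(ℝ, EG) ∞ G]
  [CompactSpace G] [T2Space G]
  [NormedAddCommGroup EP] [NormedSpace ℝ EP] [FiniteDimensional ℝ EP]
  [TopologicalSpace P] [ChartedSpace EP P] [IsManifold 𝓘(ℝ, EP) ∞ P] [T2Space P]
  [MulAction G P] [ContMDiffSMul 𝓘(ℝ, EG) 𝓘(ℝ, EP) ∞ G P]
  [TopologicalSpace X]
  [NormedAddCommGroup F] [NormedSpace ℝ F] [FiniteDimensional ℝ F]

omit [CompactSpace G] [T2Space P] in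
/-- Around every point there is a slice for a free action, i.e. the group action gives a
diffeomorphism of a neighbourhood of `{1} × slice` onto an open set. -/
theorem exists_slice (hfree : ∀ (g : G) (x : P), g • x = x → g = 1)
    (hd : Module.finrank ℝ F + Module.finrank ℝ EG = Module.finrank ℝ EP) (z : P) :
    ∃ (σ : F → P) (e : OpenPartialHomeomorph (G × F) P) (S : Set F), IsOpen S ∧
      (0 : F) ∈ S ∧ σ 0 = z ∧ ContMDiffOn 𝓘(ℝ, F) 𝓘(ℝ, EP) ∞ σ S ∧
      ((1 : G), (0 : F)) ∈ e.source ∧ (∀ p ∈ e.source, p.2 ∈ S ∧ e p = p.1 • σ p.2) ∧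
      ContMDiffOn 𝓘(ℝ, EP) (𝓘(ℝ, EG).prod 𝓘(ℝ, F)) ∞ e.symm e.target := by
  have : CompleteSpace EG := FiniteDimensional.complete ℝ EG
  have : CompleteSpace EP := FiniteDimensional.complete ℝ EP
  have : CompleteSpace F := FiniteDimensional.complete ℝ F
  obtain ⟨L, hL⟩ := exists_coprod_bijective (F := F)
    (fundamentalMap_injective_of_free (E := EP) (EG := EG) hfree z) hd
  let φ := extChartAt 𝓘(ℝ, EP) z
  -- The slice is affine in a chart, in the directions of a complement L to the tangent space of the
  -- orbit.
  let σ : F → P := fun c => φ.symm (φ z + L c)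
  let S : Set F := (fun c => φ z + L c) ⁻¹' φ.target
  have hcont : ContDiff ℝ ∞ (fun c => φ z + L c) := contDiff_const.add L.contDiff
  have hS : IsOpen S := (isOpen_extChartAt_target z).preimage hcont.continuous
  have hσ : ContMDiffOn 𝓘(ℝ, F) 𝓘(ℝ, EP) ∞ σ S :=
    (contMDiffOn_extChartAt_symm (I := 𝓘(ℝ, EP)) (n := ∞) z).comp
      hcont.contMDiff.contMDiffOn fun c hc => hc
  have hσ0 : σ 0 = z := by simp [σ, φ]
  have h0S : (0 : F) ∈ S := by simp [S, φ]
  have hσd : HasMFDerivAt 𝓘(ℝ, F) 𝓘(ℝ, EP) σ 0 L := by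
    have h1 : HasMFDerivAt 𝓘(ℝ, F) 𝓘(ℝ, EP) (fun c => φ z + L c) 0 L :=
      (L.hasFDerivAt.const_add (φ z)).hasMFDerivAt
    have h2 : HasMFDerivAt 𝓘(ℝ, EP) 𝓘(ℝ, EP) φ.symm (φ z) (ContinuousLinearMap.id ℝ EP) := by
      have h := ((contMDiffOn_extChartAt_symm (I := 𝓘(ℝ, EP)) (n := ∞) z).contMDiffAt
        (extChartAt_target_mem_nhds z)).mdifferentiableAt (by simp)
      refine h.hasMFDerivAt.congr_mfderiv ?_
      have h3 := mfderivWithin_range_extChartAt_symm (I := 𝓘(ℝ, EP)) (x := z)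
      rw [show range (𝓘(ℝ, EP) : EP → EP) = univ from range_id, mfderivWithin_univ] at h3
      exact h3
    exact h2.comp_of_eq' h1 (by simp)
  let Θ : G × F → P := fun p => p.1 • σ p.2
  have hΘ : ContMDiffOn (𝓘(ℝ, EG).prod 𝓘(ℝ, F)) 𝓘(ℝ, EP) ∞ Θ (univ ×ˢ S) :=
    contMDiffOn_fst.smul (I := 𝓘(ℝ, EG)) (hσ.comp contMDiffOn_snd fun p hp => hp.2)
  have h1S : ((1 : G), (0 : F)) ∈ (univ : Set G) ×ˢ S := ⟨mem_univ _, h0S⟩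
  have hΘd : HasMFDerivAt (𝓘(ℝ, EG).prod 𝓘(ℝ, F)) 𝓘(ℝ, EP) Θ ((1 : G), (0 : F))
      ((fundamentalMap EP EG G z).coprod L : EG × F →L[ℝ] EP) := by
    have h := (hΘ.contMDiffAt ((isOpen_univ.prod hS).mem_nhds h1S)).mdifferentiableAt (by simp)
    refine h.hasMFDerivAt.congr_mfderiv ?_
    have e1 : HasMFDerivAt 𝓘(ℝ, EG) (𝓘(ℝ, EG).prod 𝓘(ℝ, F)) (fun g : G => (g, (0 : F))) 1
        ((ContinuousLinearMap.id ℝ EG).prod 0 : EG →L[ℝ] EG × F) :=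
      (hasMFDerivAt_id (1 : G)).prodMk (hasMFDerivAt_const _ _)
    have e2 : HasMFDerivAt 𝓘(ℝ, F) (𝓘(ℝ, EG).prod 𝓘(ℝ, F)) (fun c : F => ((1 : G), c)) 0
        ((0 : F →L[ℝ] EG).prod (ContinuousLinearMap.id ℝ F) : F →L[ℝ] EG × F) :=
      (hasMFDerivAt_const _ _).prodMk (hasMFDerivAt_id (0 : F))
    have e3 := h.hasMFDerivAt.comp_of_eq' e1 rfl
    have e4 := h.hasMFDerivAt.comp_of_eq' e2 rfl
    have e5 : HasMFDerivAt 𝓘(ℝ, EG) 𝓘(ℝ, EP) (fun g : G => Θ (g, (0 : F))) 1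
        (fundamentalMap EP EG G z) := by
      refine (hasMFDerivAt_orbitMap (E := EP) (EG := EG) (G := G) z).congr_of_eventuallyEq
        (.of_forall fun g => ?_)
      simp only [Θ, hσ0]
    have e6 : HasMFDerivAt 𝓘(ℝ, F) 𝓘(ℝ, EP) (fun c : F => Θ ((1 : G), c)) 0 L := by
      refine hσd.congr_of_eventuallyEq (.of_forall fun c => ?_)
      simp only [Θ, one_smul]
    have key : ∀ A : EG × F →L[ℝ] EP,
        A.comp ((ContinuousLinearMap.id ℝ EG).prod 0) = fundamentalMap EP EG G z →
        A.comp ((0 : F →L[ℝ] EG).prod (ContinuousLinearMap.id ℝ F)) = L →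
        A = (fundamentalMap EP EG G z).coprod L := by
      intro A k1 k2
      refine ContinuousLinearMap.ext fun p => ?_
      rw [ContinuousLinearMap.coprod_apply, ← k1, ← k2]
      simp [← map_add]
    exact key _ (hasMFDerivAt_unique e3 e5) (hasMFDerivAt_unique e4 e6)
  obtain ⟨e, he1, he2, he3, he4⟩ := hΘ.exists_openPartialHomeomorph (isOpen_univ.prod hS) h1S
    (by rw [hΘd.mfderiv]; exact hL)
  exact ⟨σ, e, S, hS, h0S, hσ0, hσ, he1, fun p hp => ⟨(he2 hp).2, he3 hp⟩, he4⟩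

/-- Charts of the orbit space of a free action of a compact Lie group. -/
theorem exists_quotient_chart (hfree : ∀ (g : G) (x : P), g • x = x → g = 1)
    (hd : Module.finrank ℝ F + Module.finrank ℝ EG = Module.finrank ℝ EP)
    {π : P → X} (hπ : IsOpenQuotientMap π) (hfib : ∀ z w, π z = π w ↔ ∃ g : G, g • z = w) (z : P) :
    ∃ (c : OpenPartialHomeomorph X F) (σ : F → P), π z ∈ c.source ∧
      ContMDiffOn 𝓘(ℝ, F) 𝓘(ℝ, EP) ∞ σ c.target ∧ (∀ u ∈ c.target, π (σ u) = c.symm u) ∧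
      ContMDiffOn 𝓘(ℝ, EP) 𝓘(ℝ, F) ∞ (fun w => c (π w)) (π ⁻¹' c.source) := by
  obtain ⟨σ, e, S, hS, h0S, hσ0, hσ, he1, he, hes⟩ := exists_slice (EG := EG) (F := F) hfree hd z
  have : ContinuousSMul G P := ContMDiffSMul.continuousSMul (I := 𝓘(ℝ, EG)) (I' := 𝓘(ℝ, EP)) ∞
  obtain ⟨N, hN, B₀, hB₀, hNB⟩ := mem_nhds_prod_iff.1 (e.open_source.mem_nhds he1)
  -- injectivity of the slice on orbits
  have hσc : ContinuousAt σ 0 := hσ.continuousOn.continuousAt (hS.mem_nhds h0S)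
  have hK : IsCompact (interior N)ᶜ := isOpen_interior.isClosed_compl.isCompact
  -- By freeness no g outside N fixes z, and this set of g is compact. So, uniformly in g, points of
  -- a small slice are not carried to one another by elements far from 1. Inside N injectivity of e
  -- takes over.
  have hsep : ∀ᶠ p : F × F in 𝓝 (0, 0), ∀ g ∈ (interior N)ᶜ, g • σ p.1 ≠ σ p.2 := by
    refine hK.eventually_forall_of_forall_eventually fun g hg => ?_
    have hne : g • σ 0 ≠ σ 0 := by
      intro h
      have hg1 := hfree g _ h
      exact hg (hg1 ▸ mem_interior_iff_mem_nhds.2 hN)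
    have c1 : ContinuousAt (fun q : (F × F) × G => q.2 • σ q.1.1) ((0, 0), g) :=
      continuousAt_snd.smul (ContinuousAt.comp_of_eq hσc (by fun_prop) rfl)
    have c2 : ContinuousAt (fun q : (F × F) × G => σ q.1.2) ((0, 0), g) :=
      ContinuousAt.comp_of_eq hσc (by fun_prop) rfl
    exact (c1.prodMk c2).eventually ((isClosed_diagonal.isOpen_compl).mem_nhds hne)
  rw [nhds_prod_eq, eventually_prod_self_iff'] at hsep
  obtain ⟨T, hT, hTs⟩ := hsep
  let B : Set F := S ∩ interior B₀ ∩ interior T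
  have hBo : IsOpen B := (hS.inter isOpen_interior).inter isOpen_interior
  have h0B : (0 : F) ∈ B := ⟨⟨h0S, mem_interior_iff_mem_nhds.2 hB₀⟩, mem_interior_iff_mem_nhds.2 hT⟩
  have h1N : (1 : G) ∈ N := mem_of_mem_nhds hN
  have hsrc : ∀ g ∈ N, ∀ u ∈ B, (g, u) ∈ e.source := fun g hg u hu =>
    hNB ⟨hg, interior_subset hu.1.2⟩
  have hslice : ∀ u ∈ B, ∀ v ∈ B, ∀ g : G, g • σ u = σ v → g = 1 ∧ u = v := by
    intro u hu v hv g hg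
    have hgN : g ∈ N := by
      by_contra h
      exact hTs u (interior_subset hu.2) v (interior_subset hv.2) g
        (fun h' => h (interior_subset h')) hg
    have h1 := e.injOn (hsrc g hgN u hu) (hsrc 1 h1N v hv) (by
      rw [(he _ (hsrc g hgN u hu)).2, (he _ (hsrc 1 h1N v hv)).2, one_smul]
      exact hg)
    exact Prod.mk_inj.1 h1
  have hinj : InjOn (fun u => π (σ u)) B := by
    intro u hu v hv huv
    obtain ⟨g, hg⟩ := (hfib _ _).1 huv
    exact (hslice u hu v hv g hg).2
  have hσB : ContMDiffOn 𝓘(ℝ, F) 𝓘(ℝ, EP) ∞ σ B := hσ.mono fun u hu => hu.1.1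
  have hcB : ContinuousOn (fun u => π (σ u)) B := hπ.continuous.comp_continuousOn hσB.continuousOn
  have himg : ∀ W ⊆ B, IsOpen W → IsOpen ((fun u => π (σ u)) '' W) := by
    intro W hWB hW
    -- The image of a piece of the slice equals that of a full open neighbourhood in P, as moving
    -- along orbits does not change π.
    have h1 : (fun u => π (σ u)) '' W = π '' (e '' (e.source ∩ univ ×ˢ W)) := by
      ext x
      constructor
      · rintro ⟨u, hu, rfl⟩
        have h2 := hsrc 1 h1N u (hWB hu)
        refine ⟨_, ⟨(1, u), ⟨h2, mem_univ _, hu⟩, rfl⟩, ?_⟩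
        rw [(he _ h2).2, one_smul]
      · rintro ⟨_, ⟨p, ⟨hp, -, hu⟩, rfl⟩, rfl⟩
        refine ⟨p.2, hu, ?_⟩
        rw [(he _ hp).2]
        exact (hfib _ _).2 ⟨p.1, rfl⟩
    rw [h1]
    exact hπ.isOpenMap _ (e.isOpen_image_of_subset_source
      (e.open_source.inter (isOpen_univ.prod hW)) inter_subset_left)
  let s : OpenPartialHomeomorph F X :=
    OpenPartialHomeomorph.ofContinuousOpenRestrict (InjOn.toPartialEquiv (fun u => π (σ u)) B hinj)
      hcB (by
        intro V hV
        obtain ⟨W, hW, rfl⟩ := isOpen_induced_iff.1 hV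
        convert himg (W ∩ B) inter_subset_right (hW.inter hBo) using 1
        ext x
        constructor
        · rintro ⟨u, hu, rfl⟩
          exact ⟨u, ⟨hu, u.2⟩, rfl⟩
        · rintro ⟨u, ⟨hu, huB⟩, rfl⟩
          exact ⟨⟨u, huB⟩, hu, rfl⟩) hBo
  have hss : s.source = B := rfl
  have hst : s.target = (fun u => π (σ u)) '' B := rfl
  have hsv : ∀ u, s u = π (σ u) := fun u => rfl
  refine ⟨s.symm, σ, ⟨0, h0B, by simp only [hσ0]⟩, hσB, fun u hu => rfl, ?_⟩
  intro w hw
  obtain ⟨v, hv, hvw⟩ := hw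
  obtain ⟨g, hg⟩ := (hfib _ _).1 hvw.symm
  -- A point w over the chart need not lie near the slice; the group element g moves it there. The
  -- chart is then the slice component of the inverse of e at g • w, a smooth function.
  have hgw : e (1, v) = g • w := by rw [(he _ (hsrc 1 h1N v hv)).2, one_smul, hg]
  have hsm : ContMDiff 𝓘(ℝ, EP) 𝓘(ℝ, EP) ∞ (fun w : P => g • w) :=
    ContMDiffSMul.contMDiff_const_smul (I := 𝓘(ℝ, EG)) (I' := 𝓘(ℝ, EP)) (n := ∞) g
  have hwt : g • w ∈ e.target := hgw ▸ e.map_source (hsrc 1 h1N v hv)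
  have h1 : ContMDiffAt 𝓘(ℝ, EP) (𝓘(ℝ, EG).prod 𝓘(ℝ, F)) ∞ (fun w' : P => e.symm (g • w')) w :=
    (hes.contMDiffAt (e.open_target.mem_nhds hwt)).comp w hsm.contMDiffAt
  have h2 : ContMDiffAt 𝓘(ℝ, EP) 𝓘(ℝ, F) ∞ (fun w' : P => (e.symm (g • w')).2) w :=
    contMDiffAt_snd.comp w h1
  refine (h2.congr_of_eventuallyEq ?_).contMDiffWithinAt
  have h3 : (fun w' : P => e.symm (g • w')) ⁻¹' (univ ×ˢ B) ∈ 𝓝 w := by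
    refine h1.continuousAt.preimage_mem_nhds ((isOpen_univ.prod hBo).mem_nhds ?_)
    rw [← hgw, e.left_inv (hsrc 1 h1N v hv)]
    exact ⟨mem_univ _, hv⟩
  filter_upwards [h3, hsm.continuous.continuousAt.preimage_mem_nhds (e.open_target.mem_nhds hwt)]
    with w' h4 h5
  have h6 := (he _ (e.map_target h5)).2
  rw [e.right_inv h5] at h6
  have h7 : π w' = s (e.symm (g • w')).2 := by
    rw [hsv, hfib]
    exact ⟨(e.symm (g • w')).1⁻¹ * g, by rw [mul_smul, inv_smul_eq_iff]; exact h6⟩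
  rw [h7]
  exact s.left_inv h4.2

/-- The orbit space of a free action of a compact Lie group is a manifold, the projection is
smooth and has local smooth sections through every point. -/
theorem exists_quotient_manifold (hfree : ∀ (g : G) (x : P), g • x = x → g = 1)
    (hd : Module.finrank ℝ F + Module.finrank ℝ EG = Module.finrank ℝ EP)
    {π : P → X} (hπ : IsOpenQuotientMap π) (hfib : ∀ z w, π z = π w ↔ ∃ g : G, g • z = w) :
    ∃ _ : ChartedSpace F X, IsManifold 𝓘(ℝ, F) ∞ X ∧ ContMDiff 𝓘(ℝ, EP) 𝓘(ℝ, F) ∞ π ∧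
      ∀ z : P, ∃ (τ : X → P) (W : Set X), IsOpen W ∧ π z ∈ W ∧
        ContMDiffOn 𝓘(ℝ, F) 𝓘(ℝ, EP) ∞ τ W ∧ τ (π z) = z ∧ ∀ x ∈ W, π (τ x) = x := by
  choose c₀ σ₀ hc₀ hσ₀ hs₀ hsm₀ using exists_quotient_chart (EG := EG) (F := F) hfree hd hπ hfib
  choose s hs using hπ.surjective
  let c := fun x => c₀ (s x)
  let σ := fun x => σ₀ (s x)
  have hc : ∀ x, x ∈ (c x).source := fun x => by
    have := hc₀ (s x)
    rwa [hs] at this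
  have hσ : ∀ x, ContMDiffOn 𝓘(ℝ, F) 𝓘(ℝ, EP) ∞ (σ x) (c x).target := fun x => hσ₀ _
  have hπσ : ∀ x, ∀ u ∈ (c x).target, π (σ x u) = (c x).symm u := fun x => hs₀ _
  have hsm : ∀ x, ContMDiffOn 𝓘(ℝ, EP) 𝓘(ℝ, F) ∞ (fun w => c x (π w)) (π ⁻¹' (c x).source) :=
    fun x => hsm₀ _
  let cs := chartedSpaceOfCharts c hc
  have hman : IsManifold 𝓘(ℝ, F) ∞ X := by
    refine isManifold_chartedSpaceOfCharts c hc fun x y => ?_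
    rw [← contMDiffOn_iff_contDiffOn]
    refine ((hsm y).comp ((hσ x).mono inter_subset_left) ?_).congr ?_
    · intro u hu
      change π (σ x u) ∈ (c y).source
      rw [hπσ x u hu.1]
      exact hu.2
    · intro u hu
      simp only [Function.comp_apply, hπσ x u hu.1]
  have hchart : ∀ x, ContMDiffOn 𝓘(ℝ, F) 𝓘(ℝ, F) ∞ (c x) (c x).source := fun x =>
    contMDiffOn_chart (I := 𝓘(ℝ, F)) (n := ∞) (x := x)
  have hchart_symm : ∀ x, ContMDiffOn 𝓘(ℝ, F) 𝓘(ℝ, F) ∞ (c x).symm (c x).target := fun x =>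
    contMDiffOn_chart_symm (I := 𝓘(ℝ, F)) (n := ∞) (x := x)
  refine ⟨cs, hman, fun z => ?_, fun z => ?_⟩
  · have ho : π ⁻¹' (c (π z)).source ∈ 𝓝 z :=
      ((c (π z)).open_source.preimage hπ.continuous).mem_nhds (hc _)
    have h1 : ContMDiffAt 𝓘(ℝ, EP) 𝓘(ℝ, F) ∞ (fun w => (c (π z)).symm (c (π z) (π w))) z :=
      ((hchart_symm (π z)).contMDiffAt ((c (π z)).open_target.mem_nhds
        ((c (π z)).map_source (hc _)))).comp z ((hsm (π z)).contMDiffAt ho)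
    refine h1.congr_of_eventuallyEq ?_
    filter_upwards [ho] with w hw
    exact ((c (π z)).left_inv hw).symm
  · have h1 : π (σ (π z) (c (π z) (π z))) = π z := by
      rw [hπσ _ _ ((c (π z)).map_source (hc _)), (c (π z)).left_inv (hc _)]
    -- The section given by the chart meets the orbit of z but may miss z. Translating it by g makes
    -- it pass through z.
    obtain ⟨g, hg⟩ := (hfib _ _).1 h1
    have hsmg : ContMDiff 𝓘(ℝ, EP) 𝓘(ℝ, EP) ∞ (fun w : P => g • w) :=
      ContMDiffSMul.contMDiff_const_smul (I := 𝓘(ℝ, EG)) (I' := 𝓘(ℝ, EP)) (n := ∞) g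
    refine ⟨fun x => g • σ (π z) (c (π z) x), (c (π z)).source, (c (π z)).open_source, hc _,
      hsmg.comp_contMDiffOn ((hσ (π z)).comp (hchart (π z)) fun x hx => (c (π z)).map_source hx),
      hg, fun x hx => ?_⟩
    have h2 : π (g • σ (π z) (c (π z) x)) = π (σ (π z) (c (π z) x)) :=
      ((hfib _ _).2 ⟨g, rfl⟩).symm
    rw [h2, hπσ _ _ ((c (π z)).map_source hx), (c (π z)).left_inv hx]

omit [ChartedSpace EP P] [NormedAddCommGroup EP] [NormedSpace ℝ EP] [FiniteDimensional ℝ EP]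
  [IsManifold 𝓘(ℝ, EP) ∞ P] [ContMDiffSMul 𝓘(ℝ, EG) 𝓘(ℝ, EP) ∞ G P]
  [NormedAddCommGroup EG] [NormedSpace ℝ EG] [FiniteDimensional ℝ EG]
  [ChartedSpace EG G] [LieGroup 𝓘(ℝ, EG) ∞ G] [T2Space G] in
/-- The orbit space of a compact group is Hausdorff. -/
theorem t2Space_of_isOpenQuotientMap_orbits [ContinuousSMul G P] {π : P → X}
    (hπ : IsOpenQuotientMap π) (hfib : ∀ z w, π z = π w ↔ ∃ g : G, g • z = w) : T2Space X := by
  rw [t2Space_iff_of_isOpenQuotientMap hπ]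
  -- The orbit relation is the projection along the compact factor G of a closed set, hence closed.
  have h : {q : P × P | π q.1 = π q.2} = Prod.snd '' {p : G × (P × P) | p.1 • p.2.1 = p.2.2} := by
    ext q
    simp [hfib]
  rw [h]
  exact isClosedMap_snd_of_compactSpace _ (isClosed_eq (by fun_prop) (by fun_prop))

end QuotientManifold

/-! ### Pull-backs of 2-forms: smoothness and closedness -/

section AlternatingPullback

variable {D E F : Type*} [NormedAddCommGroup D] [NormedSpace ℝ D]
  [NormedAddCommGroup E] [NormedSpace ℝ E] [FiniteDimensional ℝ E]
  [NormedAddCommGroup F] [NormedSpace ℝ F] [FiniteDimensional ℝ F]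

/-- Allows smoothness of families of alternating forms to be tested in the ambient space of
multilinear maps. -/
theorem exists_leftInverse_toContinuousMultilinearMap (ι : Type*) [Fintype ι] :
    ∃ p : ContinuousMultilinearMap ℝ (fun _ : ι => E) ℝ →L[ℝ] E [⋀^ι]→L[ℝ] ℝ,
      ∀ ζ : E [⋀^ι]→L[ℝ] ℝ, p ζ.toContinuousMultilinearMap = ζ := by
  have : FiniteDimensional ℝ (ContinuousMultilinearMap ℝ (fun _ : ι => E) ℝ) :=
    Module.Finite.of_injective 
      (ContinuousMultilinearMap.toMultilinearMapLinear :
        ContinuousMultilinearMap ℝ (fun _ : ι => E) ℝ →ₗ[ℝ] MultilinearMap ℝ (fun _ : ι => E) ℝ)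
      ContinuousMultilinearMap.toMultilinearMap_injective
  obtain ⟨p, hp⟩ := LinearMap.exists_leftInverse_of_injective
    (ContinuousAlternatingMap.toContinuousMultilinearMapLinear (A := ℝ) (R := ℝ) (M := E) (N := ℝ)
      (ι := ι)) (LinearMap.ker_eq_bot.2
        ContinuousAlternatingMap.toContinuousMultilinearMap_injective)
  exact ⟨p.toContinuousLinearMap, fun ζ => DFunLike.congr_fun hp ζ⟩

omit [FiniteDimensional ℝ E] in
theorem ContDiffAt.alternating_compContinuousLinearMap {ι : Type*} [Fintype ι]
    {ζ : D → E [⋀^ι]→L[ℝ] ℝ} {A : D → F →L[ℝ] E} {x : D}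
    (hζ : ContDiffAt ℝ ∞ ζ x) (hA : ContDiffAt ℝ ∞ A x) :
    ContDiffAt ℝ ∞ (fun y => (ζ y).compContinuousLinearMap (A y)) x := by
  obtain ⟨p, hp⟩ := exists_leftInverse_toContinuousMultilinearMap (E := F) ι
  have h1 : ContDiffAt ℝ ∞ (fun y =>
      ContinuousMultilinearMap.compContinuousLinearMapContinuousMultilinear ℝ (fun _ : ι => F)
        (fun _ : ι => E) ℝ (fun _ => A y)) x :=
    (ContinuousMultilinearMap.contDiff _).contDiffAt.comp x
      (contDiffAt_pi.2 fun _ => hA)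
  have h2 : ContDiffAt ℝ ∞ (fun y => (ζ y).toContinuousMultilinearMap) x :=
    (ContinuousAlternatingMap.toContinuousMultilinearMapCLM ℝ (E := E) (ι := ι)
      (F := ℝ) (𝕜 := ℝ)).contDiff.contDiffAt.comp x hζ
  have h3 := p.contDiff.contDiffAt.comp x (h1.clm_apply h2)
  refine h3.congr_of_eventuallyEq (.of_forall fun y => ?_)
  exact (hp _).symm

end AlternatingPullback

section FormPullback

variable {E M F : Type*} [NormedAddCommGroup E] [NormedSpace ℝ E] [FiniteDimensional ℝ E]
  [TopologicalSpace M] [ChartedSpace E M] [IsManifold 𝓘(ℝ, E) ∞ M]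
  [NormedAddCommGroup F] [NormedSpace ℝ F] [FiniteDimensional ℝ F]

/-- The pull-back of a form on `M` by a map defined on a vector space. -/
def pullbackForm (Ω : ∀ x : M, (TangentSpace 𝓘(ℝ, E) x) [⋀^Fin 2]→L[ℝ] ℝ) (f : F → M) (u : F) :
    F [⋀^Fin 2]→L[ℝ] ℝ :=
  (Ω (f u)).compContinuousLinearMap (mfderiv 𝓘(ℝ, F) 𝓘(ℝ, E) f u)

omit [FiniteDimensional ℝ E] [FiniteDimensional ℝ F] in
-- Reduces pull-backs from M to pull-backs between vector spaces: near the given point f factors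
-- through the chart, and the chain rule identifies the two.
theorem pullbackForm_eventuallyEq (Ω : ∀ x : M, (TangentSpace 𝓘(ℝ, E) x) [⋀^Fin 2]→L[ℝ] ℝ)
    {f : F → M} {u₀ : F} (hf : ContMDiffAt 𝓘(ℝ, F) 𝓘(ℝ, E) ∞ f u₀) :
    ContDiffAt ℝ ∞ (fun u => extChartAt 𝓘(ℝ, E) (f u₀) (f u)) u₀ ∧
    pullbackForm Ω f =ᶠ[𝓝 u₀] fun u =>
      (twoFormInChart Ω (f u₀) (extChartAt 𝓘(ℝ, E) (f u₀) (f u))).compContinuousLinearMap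
        (fderiv ℝ (fun u => extChartAt 𝓘(ℝ, E) (f u₀) (f u)) u) := by
  let φ := extChartAt 𝓘(ℝ, E) (f u₀)
  let g : F → E := fun u => φ (f u)
  have hg : ContDiffAt ℝ ∞ g u₀ := by
    rw [← contMDiffAt_iff_contDiffAt]
    exact (contMDiffAt_extChartAt (I := 𝓘(ℝ, E)) (n := ∞)).comp u₀ hf
  refine ⟨hg, ?_⟩
  have h1 : ∀ᶠ u in 𝓝 u₀, f u ∈ φ.source :=
    hf.continuousAt.preimage_mem_nhds (extChartAt_source_mem_nhds (f u₀))
  have h2 : ∀ᶠ u in 𝓝 u₀, ContDiffAt ℝ 1 g u :=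
    (hg.of_le (by simp)).eventually (by simp)
  filter_upwards [h1, h1.eventually_nhds, h2] with u hu hu' hgu
  let Ω' : M → E [⋀^Fin 2]→L[ℝ] ℝ := Ω
  have e1 : φ.symm (g u) = f u := φ.left_inv hu
  have ht : g u ∈ φ.target := φ.map_source hu
  have hs : HasMFDerivAt 𝓘(ℝ, E) 𝓘(ℝ, E) φ.symm (g u)
      (mfderiv 𝓘(ℝ, E) 𝓘(ℝ, E) φ.symm (g u) : E →L[ℝ] E) :=
    (((contMDiffOn_extChartAt_symm (I := 𝓘(ℝ, E)) (n := ∞) (f u₀)).contMDiffAt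
      ((isOpen_extChartAt_target (f u₀)).mem_nhds ht)).mdifferentiableAt (by simp)).hasMFDerivAt
  have e2 : HasMFDerivAt 𝓘(ℝ, F) 𝓘(ℝ, E) f u
      ((mfderiv 𝓘(ℝ, E) 𝓘(ℝ, E) φ.symm (g u) : E →L[ℝ] E).comp (fderiv ℝ g u)) := by
    have := hs.comp_of_eq' (hgu.differentiableAt (by simp)).hasFDerivAt.hasMFDerivAt rfl
    refine this.congr_of_eventuallyEq ?_
    filter_upwards [hu'] with w hw
    exact (φ.left_inv hw).symm
  have e3 : pullbackForm Ω f u = (Ω' (f u)).compContinuousLinearMap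
      ((mfderiv 𝓘(ℝ, E) 𝓘(ℝ, E) φ.symm (g u) : E →L[ℝ] E).comp (fderiv ℝ g u)) :=
    congrArg (Ω' (f u)).compContinuousLinearMap e2.mfderiv
  rw [e3]
  change _ = ((Ω' (φ.symm (g u))).compContinuousLinearMap
    (mfderiv 𝓘(ℝ, E) 𝓘(ℝ, E) φ.symm (g u) : E →L[ℝ] E)).compContinuousLinearMap (fderiv ℝ g u)
  rw [e1]
  rfl

omit [FiniteDimensional ℝ E] in
theorem SymplecticForm.contDiffAt_pullbackForm (Ω : SymplecticForm E M)
    {f : F → M} {u₀ : F} (hf : ContMDiffAt 𝓘(ℝ, F) 𝓘(ℝ, E) ∞ f u₀) :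
    ContDiffAt ℝ ∞ (pullbackForm Ω.toForm f) u₀ := by
  obtain ⟨hg, he⟩ := pullbackForm_eventuallyEq Ω.toForm hf
  refine ContDiffAt.congr_of_eventuallyEq ?_ he
  refine ContDiffAt.alternating_compContinuousLinearMap ?_ (hg.fderiv_right (by simp))
  have h := (Ω.smooth (f u₀)).contDiffAt (extChartAt_target_mem_nhds (f u₀))
  exact h.comp u₀ hg

omit [FiniteDimensional ℝ E] [FiniteDimensional ℝ F] in
theorem SymplecticForm.extDeriv_pullbackForm (Ω : SymplecticForm E M)
    {f : F → M} {u₀ : F} (hf : ContMDiffAt 𝓘(ℝ, F) 𝓘(ℝ, E) ∞ f u₀) :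
    extDeriv (pullbackForm Ω.toForm f) u₀ = 0 := by
  obtain ⟨hg, he⟩ := pullbackForm_eventuallyEq Ω.toForm hf
  rw [he.extDeriv_eq]
  have h := (Ω.smooth (f u₀)).contDiffAt (extChartAt_target_mem_nhds (f u₀))
  have h1 := extDeriv_pullback (f := fun u => extChartAt 𝓘(ℝ, E) (f u₀) (f u)) (r := ∞)
    (h.differentiableAt (by simp)) hg
    (by simp only [minSmoothness_of_isRCLikeNormedField]; exact WithTop.coe_le_coe.2 (le_top : (2 : ℕ∞) ≤ ⊤))
  rw [Ω.closed _ _ (mem_extChartAt_target (f u₀))] at h1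
  rw [h1]
  ext v
  rfl

end FormPullback

/-! ### Descent of a form along a submersion -/

section ReducedForm

variable {E M EP P F X : Type*} [NormedAddCommGroup E] [NormedSpace ℝ E] [FiniteDimensional ℝ E]
  [TopologicalSpace M] [ChartedSpace E M] [IsManifold 𝓘(ℝ, E) ∞ M]
  [NormedAddCommGroup EP] [NormedSpace ℝ EP]
  [TopologicalSpace P] [ChartedSpace EP P]
  [NormedAddCommGroup F] [NormedSpace ℝ F] [FiniteDimensional ℝ F]
  [TopologicalSpace X] [ChartedSpace F X] [IsManifold 𝓘(ℝ, F) ∞ X]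

/-- The form `Ω` at `x`, as an alternating form on the model space. -/
def SymplecticForm.modelForm (Ω : SymplecticForm E M) (x : M) : E [⋀^Fin 2]→L[ℝ] ℝ := Ω.toForm x

omit [FiniteDimensional ℝ E] in
/-- A pre-symplectic form that is basic for a surjective submersion descends to a symplectic form
if its radical is tangent to the fibres. -/
theorem SymplecticForm.exists_descent (Ω : SymplecticForm E M) {ι : P → M} {π : P → X}
    (hι : ContMDiff 𝓘(ℝ, EP) 𝓘(ℝ, E) ∞ ι) {A : P → EP →L[ℝ] E} {B : P → EP →L[ℝ] F}
    (hA : ∀ z, HasMFDerivAt 𝓘(ℝ, EP) 𝓘(ℝ, E) ι z (A z))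
    (hB : ∀ z, HasMFDerivAt 𝓘(ℝ, EP) 𝓘(ℝ, F) π z (B z))
    (hπ : Function.Surjective π)
    (hsec : ∀ z : P, ∃ (τ : X → P) (W : Set X), IsOpen W ∧ π z ∈ W ∧
        ContMDiffOn 𝓘(ℝ, F) 𝓘(ℝ, EP) ∞ τ W ∧ τ (π z) = z ∧ ∀ x ∈ W, π (τ x) = x)
    (hinv : ∀ z w, π z = π w → ∀ u u' v v', B z u = B w v → B z u' = B w v' →
      Ω.modelForm (ι z) ![A z u, A z u'] = Ω.modelForm (ι w) ![A w v, A w v'])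
    (hker : ∀ z u, (∀ v, Ω.modelForm (ι z) ![A z v, A z u] = 0) → B z u = 0) :
    ∃ ζ : SymplecticForm F X, ∀ z u v,
      ζ.modelForm (π z) ![B z u, B z v] = Ω.modelForm (ι z) ![A z u, A z v] := by
  -- derivatives of local sections
  have hsecd : ∀ {τ : X → P} {W : Set X} {x : X}, IsOpen W → x ∈ W →
      ContMDiffOn 𝓘(ℝ, F) 𝓘(ℝ, EP) ∞ τ W → (∀ x ∈ W, π (τ x) = x) →
      ∃ T : F →L[ℝ] EP, HasMFDerivAt 𝓘(ℝ, F) 𝓘(ℝ, EP) τ x T ∧ ∀ v, B (τ x) (T v) = v := by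
    intro τ W x hW hx hτ hπτ
    have h1 := ((hτ.contMDiffAt (hW.mem_nhds hx)).mdifferentiableAt (by simp)).hasMFDerivAt
    refine ⟨mfderiv 𝓘(ℝ, F) 𝓘(ℝ, EP) τ x, h1, ?_⟩
    have h2 := (hB (τ x)).comp_of_eq' h1 rfl
    have h3 : HasMFDerivAt 𝓘(ℝ, F) 𝓘(ℝ, F) (fun y => π (τ y)) x (ContinuousLinearMap.id ℝ F) := by
      refine (hasMFDerivAt_id x).congr_of_eventuallyEq ?_
      filter_upwards [hW.mem_nhds hx] with y hy using hπτ y hy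
    exact fun v => DFunLike.congr_fun (hasMFDerivAt_unique h2 h3) v
  choose p hp using hπ
  choose τ W hWo hW hτ hτp hπτ using hsec
  let s : X → X → P := fun x => τ (p x)
  have hxs : ∀ x, x ∈ W (p x) := fun x => by
    have := hW (p x)
    rwa [hp] at this
  choose T hT hBT using fun x => hsecd (hWo (p x)) (hxs x) (hτ (p x)) (hπτ (p x))
  -- Vectors are lifted by the section chosen at x. The hypothesis hinv makes the value independent
  -- of the lift and of the point of the fibre.
  let ζ₀ : X → F [⋀^Fin 2]→L[ℝ] ℝ := fun x =>
    (Ω.modelForm (ι (s x x))).compContinuousLinearMap ((A (s x x)).comp (T x))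
  have hζ₀ : ∀ x z u v, π z = x →
      ζ₀ x ![B z u, B z v] = Ω.modelForm (ι z) ![A z u, A z v] := by
    intro x z u v hz
    have h1 : ζ₀ x ![B z u, B z v] = Ω.modelForm (ι (s x x))
        ![A (s x x) (T x (B z u)), A (s x x) (T x (B z v))] := by
      change Ω.modelForm (ι (s x x)) _ = _
      congr 1
      ext i
      fin_cases i <;> rfl
    rw [h1]
    exact hinv _ _ ((hπτ _ _ (hxs x)).trans hz.symm) _ _ _ _ (hBT x _) (hBT x _)
  -- By that independence one section may be kept fixed near a point. In a chart the form is then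
  -- the pull-back of Ω by a smooth map, which gives smoothness and closedness.
  have hchart : ∀ (x₀ : X), ∀ y ∈ (extChartAt 𝓘(ℝ, F) x₀).target, ∃ f : F → M,
      ContMDiffAt 𝓘(ℝ, F) 𝓘(ℝ, E) ∞ f y ∧
      twoFormInChart (E := F) (M := X) ζ₀ x₀ =ᶠ[𝓝 y] pullbackForm Ω.toForm f := by
    intro x₀ y hy
    let φ := extChartAt 𝓘(ℝ, F) x₀
    have hφ := contMDiffOn_extChartAt_symm (I := 𝓘(ℝ, F)) (n := ∞) x₀
    have hto := isOpen_extChartAt_target (I := 𝓘(ℝ, F)) x₀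
    let t : X → P := s (φ.symm y)
    let V := W (p (φ.symm y))
    have hVo : IsOpen V := hWo _
    have hV : φ.symm y ∈ V := hxs _
    have hφy := hφ.contMDiffAt (hto.mem_nhds hy)
    refine ⟨fun y' => ι (t (φ.symm y')), ?_, ?_⟩
    · exact hι.contMDiffAt.comp y (((hτ _).contMDiffAt (hVo.mem_nhds hV)).comp y hφy)
    · filter_upwards [hto.mem_nhds hy, hφy.continuousAt.preimage_mem_nhds (hVo.mem_nhds hV)]
        with y' hy' hyV
      obtain ⟨T', hT', hBT'⟩ := hsecd hVo hyV (hτ _) (hπτ _)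
      have h1 : HasMFDerivAt 𝓘(ℝ, F) 𝓘(ℝ, F) φ.symm y'
          (mfderiv 𝓘(ℝ, F) 𝓘(ℝ, F) φ.symm y' : F →L[ℝ] F) :=
        ((hφ.contMDiffAt (hto.mem_nhds hy')).mdifferentiableAt (by simp)).hasMFDerivAt
      have h2 := (hA _).comp_of_eq' (hT'.comp_of_eq' h1 rfl) rfl
      let Dφ : F →L[ℝ] F := mfderiv 𝓘(ℝ, F) 𝓘(ℝ, F) φ.symm y'
      have h3 : pullbackForm Ω.toForm (fun y' => ι (t (φ.symm y'))) y' =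
          (Ω.modelForm (ι (t (φ.symm y')))).compContinuousLinearMap
            ((A (t (φ.symm y'))).comp (T'.comp Dφ)) :=
        congrArg (Ω.modelForm (ι (t (φ.symm y')))).compContinuousLinearMap h2.mfderiv
      rw [h3]
      change (ζ₀ (φ.symm y')).compContinuousLinearMap Dφ = _
      ext v
      rw [ContinuousAlternatingMap.compContinuousLinearMap_apply,
        ContinuousAlternatingMap.compContinuousLinearMap_apply]
      have h4 := hζ₀ (φ.symm y') (t (φ.symm y')) (T' (Dφ (v 0))) (T' (Dφ (v 1)))
        (hπτ _ _ hyV)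
      erw [hBT', hBT'] at h4
      refine (congrArg _ (funext fun i => ?_)).trans (h4.trans (congrArg _ (funext fun i => ?_)))
      · fin_cases i <;> rfl
      · fin_cases i <;> rfl
  refine ⟨{ toForm := ζ₀
            smooth := fun x₀ y hy => ?_
            closed := fun x₀ y hy => ?_
            nondegenerate := ?_ }, fun z u v => hζ₀ _ z u v rfl⟩
  · obtain ⟨f, hf, he⟩ := hchart x₀ y hy
    exact ((Ω.contDiffAt_pullbackForm hf).congr_of_eventuallyEq he).contDiffWithinAt
  · obtain ⟨f, hf, he⟩ := hchart x₀ y hy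
    rw [he.extDeriv_eq]
    exact Ω.extDeriv_pullbackForm hf
  · have key : ∀ (x : X) (v : F), (∀ w : F, ζ₀ x ![w, v] = 0) → v = 0 := by
      intro x v hv
      rw [← hBT x v]
      refine hker _ _ fun w => ?_
      rw [← hζ₀ x _ _ _ (hπτ _ _ (hxs x))]
      erw [hBT]
      exact hv _
    exact key

end ReducedForm

/-! ### Density in generic fibres and openness of submersions -/

section FibrewiseDensity

/-- For an open continuous surjection from a second countable space, a dense open set is dense in
generic fibres. -/
theorem eventually_residual_dense_preimage {X Y : Type*} [TopologicalSpace X]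
    [SecondCountableTopology X] [TopologicalSpace Y] {f : X → Y} (hf : Continuous f)
    (ho : IsOpenMap f) {U : Set X} (hU : IsOpen U) (hd : Dense U) :
    ∀ᶠ y in residual Y, Dense ((Subtype.val : f ⁻¹' {y} → X) ⁻¹' U) := by
  let 𝓑 := TopologicalSpace.countableBasis X
  have h𝓑 : TopologicalSpace.IsTopologicalBasis 𝓑 := TopologicalSpace.isBasis_countableBasis X
  -- The exceptional values are those on the frontier of some f(B ∩ U). If y is on none of them and
  -- B meets its fibre, then y lies in the closure of f(B ∩ U), hence in f(B ∩ U) itself.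
  have h1 : ∀ᶠ y in residual Y, ∀ B ∈ 𝓑, y ∉ frontier (f '' (B ∩ U)) := by
    rw [eventually_countable_ball (TopologicalSpace.countable_countableBasis X)]
    intro B hB
    have hO : IsOpen (f '' (B ∩ U)) := ho _ ((h𝓑.isOpen hB).inter hU)
    refine residual_of_dense_open isClosed_frontier.isOpen_compl ?_
    have h2 := interior_frontier hO.isClosed_compl
    rw [frontier_compl] at h2
    exact interior_eq_empty_iff_dense_compl.1 h2
  filter_upwards [h1] with y hy
  refine dense_iff_inter_open.2 fun V hV hne => ?_
  obtain ⟨x, hx⟩ := hne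
  obtain ⟨W, hW, rfl⟩ := isOpen_induced_iff.1 hV
  obtain ⟨B, hB, hxB, hBW⟩ := h𝓑.mem_nhds_iff.1 (hW.mem_nhds hx)
  have hfx : f x = y := x.2
  have h2 : y ∈ closure (f '' (B ∩ U)) := by
    have h3 : (x : X) ∈ closure (B ∩ U) := by
      exact hd.open_subset_closure_inter (h𝓑.isOpen hB) hxB
    rw [← hfx]
    exact image_closure_subset_closure_image hf ⟨x, h3, rfl⟩
  have h4 : y ∈ f '' (B ∩ U) := by
    by_contra h5
    have hO : IsOpen (f '' (B ∩ U)) := ho _ ((h𝓑.isOpen hB).inter hU)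
    exact hy B hB (by rw [hO.frontier_eq]; exact ⟨h2, h5⟩)
  obtain ⟨w, ⟨hwB, hwU⟩, hw⟩ := h4
  exact ⟨⟨w, hw⟩, hBW hwB, hwU⟩

end FibrewiseDensity

section OpenMap

variable {E M V : Type*} [NormedAddCommGroup E] [NormedSpace ℝ E]
  [TopologicalSpace M] [ChartedSpace E M]
  [NormedAddCommGroup V] [NormedSpace ℝ V] [FiniteDimensional ℝ V]

theorem contMDiff_dual_of_forall_apply {f : M → V →L[ℝ] ℝ}
    (h : ∀ v, ContMDiff 𝓘(ℝ, E) 𝓘(ℝ, ℝ) ∞ fun x => f x v) :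
    ContMDiff 𝓘(ℝ, E) 𝓘(ℝ, V →L[ℝ] ℝ) ∞ f := by
  let b := Module.finBasis ℝ V
  let L : (Fin (Module.finrank ℝ V) → ℝ) →L[ℝ] (V →L[ℝ] ℝ) :=
    ∑ i, (ContinuousLinearMap.proj (R := ℝ) (φ := fun _ => ℝ) i).smulRight
      (b.coord i).toContinuousLinearMap
  have h1 : f = fun x => L fun i => f x (b i) := by
    ext x v
    conv_lhs => rw [← b.sum_repr v, map_sum]
    simp [L, mul_comm]
  rw [h1]
  exact L.contDiff.contMDiff.comp (contMDiff_pi_space.2 fun i => h (b i))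

/-- In a straightening chart the map is a linear projection. -/
theorem isOpenMap_of_surjective_mfderiv [FiniteDimensional ℝ E] [IsManifold 𝓘(ℝ, E) ∞ M]
    {f : M → V} (hf : ContMDiff 𝓘(ℝ, E) 𝓘(ℝ, V) ∞ f)
    (hs : ∀ x, Function.Surjective (mfderiv 𝓘(ℝ, E) 𝓘(ℝ, V) f x)) : IsOpenMap f := by
  rw [isOpenMap_iff_nhds_le]
  intro x
  let A : E →L[ℝ] V := mfderiv 𝓘(ℝ, E) 𝓘(ℝ, V) f x
  have h1 := LinearMap.finrank_range_add_finrank_ker A.toLinearMap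
  have h0 : Function.Surjective A := hs x
  rw [LinearMap.range_eq_top.2 h0, finrank_top] at h1
  obtain ⟨e, hx, he, -, -⟩ := exists_straightening
    (F := LinearMap.ker A.toLinearMap) hf (by omega) (hs x)
  have h2 : 𝓝 (f x) = map (fun y => (e y).1) (𝓝 x) := by
    rw [← he x hx, ← map_fst_nhds (e x), ← e.map_nhds_eq hx, Filter.map_map]
    rfl
  have h3 : map f (𝓝 x) = map (fun y => (e y).1) (𝓝 x) := by
    refine map_congr ?_
    filter_upwards [e.open_source.mem_nhds hx] with y hy using (he y hy).symm
  rw [h2, h3]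

/-- If A were not onto, a nonzero functional would kill its image; by finite-dimensionality that
functional is evaluation at some a. -/
theorem surjective_of_forall_apply_eq_zero {A : E →L[ℝ] V →L[ℝ] ℝ}
    (h : ∀ a, (∀ v, A v a = 0) → a = 0) : Function.Surjective A := by
  have h1 : LinearMap.range A.toLinearMap = ⊤ := by
    by_contra hne
    obtain ⟨φ, hφ, hle⟩ := Submodule.exists_le_ker_of_lt_top _ (lt_top_iff_ne_top.2 hne)
    let ψ : Module.Dual ℝ (Module.Dual ℝ V) :=
      φ ∘ₗ (LinearMap.toContinuousLinearMap (𝕜 := ℝ) (E := V) (F' := ℝ)).toLinearMap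
    obtain ⟨a, ha⟩ := (Module.evalEquiv ℝ V).surjective ψ
    have h2 : ∀ α : V →L[ℝ] ℝ, φ α = α a := by
      intro α
      have h3 := DFunLike.congr_fun ha α.toLinearMap
      exact h3.symm
    have h4 : a = 0 := h a fun v => by
      rw [← h2]
      exact hle ⟨v, rfl⟩
    refine hφ (LinearMap.ext fun α => ?_)
    rw [h2, h4, map_zero]; rfl
  exact LinearMap.range_eq_top.1 h1

end OpenMap

/-! ### The differential of the moment map -/

section MomentDifferential

variable {EG G E M : Type*}
    [NormedAddCommGroup EG] [NormedSpace ℝ EG] [FiniteDimensional ℝ EG]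
    [TopologicalSpace G] [ChartedSpace EG G] [Group G]
    [NormedAddCommGroup E] [NormedSpace ℝ E] [FiniteDimensional ℝ E]
    [TopologicalSpace M] [ChartedSpace E M]
    [MulAction G M]
    {Ω : SymplecticForm E M} {Φ : M → (EG →L[ℝ] ℝ)}

theorem IsHamiltonianAction.contMDiff_moment
    (hΦ : IsHamiltonianAction (EG := EG) (G := G) Ω Φ) :
    ContMDiff 𝓘(ℝ, E) 𝓘(ℝ, EG →L[ℝ] ℝ) ∞ Φ :=
  contMDiff_dual_of_forall_apply hΦ.smooth_moment

/-- The defining equations of the moment map, collected over all a into one formula for dΦ. -/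
theorem IsHamiltonianAction.exists_hasMFDerivAt_moment
    (hΦ : IsHamiltonianAction (EG := EG) (G := G) Ω Φ) (x : M) :
    ∃ A : E →L[ℝ] EG →L[ℝ] ℝ, HasMFDerivAt 𝓘(ℝ, E) 𝓘(ℝ, EG →L[ℝ] ℝ) Φ x A ∧
      ∀ v a, A v a = Ω.modelForm x ![v, fundamentalMap E EG G x a] := by
  have h1 := ((hΦ.contMDiff_moment).mdifferentiableAt (x := x) (by simp)).hasMFDerivAt
  refine ⟨mfderiv 𝓘(ℝ, E) 𝓘(ℝ, EG →L[ℝ] ℝ) Φ x, h1, fun v a => ?_⟩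
  have h2 := (ContinuousLinearMap.apply ℝ ℝ a).hasFDerivAt.hasMFDerivAt.comp_of_eq' h1 rfl
  have h3 := Ω.toForm_sgrad (fun y => Φ y a) x v
  have h4 : Ω.sgrad (fun y => Φ y a) x = fundamentalMap E EG G x a := hΦ.sgrad_moment a x
  rw [h4] at h3
  refine Eq.trans ?_ h3.symm
  exact (DFunLike.congr_fun h2.mfderiv v).symm

/-- By nondegeneracy of Ω, the annihilator of the image of dΦ at x consists of the a whose field
vanishes at x. For a free action only a = 0 remains. -/
theorem IsHamiltonianAction.surjective_mfderiv_moment [LieGroup 𝓘(ℝ, EG) ∞ G] [T2Space G]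
    [IsManifold 𝓘(ℝ, E) ∞ M] [T2Space M]
    (hΦ : IsHamiltonianAction (EG := EG) (G := G) Ω Φ)
    (hfree : ∀ (g : G) (x : M), g • x = x → g = 1) (x : M) :
    Function.Surjective (mfderiv 𝓘(ℝ, E) 𝓘(ℝ, EG →L[ℝ] ℝ) Φ x) := by
  have := hΦ.smooth_action
  have : CompleteSpace EG := FiniteDimensional.complete ℝ EG
  obtain ⟨A, hA, hAa⟩ := hΦ.exists_hasMFDerivAt_moment x
  have h0 : Function.Surjective A := by
    refine surjective_of_forall_apply_eq_zero fun a ha => ?_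
    have h1 : fundamentalMap E EG G x a = 0 :=
      Ω.nondegenerate x _ fun w => (hAa w a).symm.trans (ha w)
    exact fundamentalMap_injective_of_free hfree x (h1.trans (map_zero _).symm)
  rw [hA.mfderiv]
  exact h0

end MomentDifferential

/-! ### Linear algebra of Poisson reduction -/

section PoissonReduction

/-- The effect of a surjection compatible with bilinear forms on the dimensions of a subspace and
of the kernel of the form on it. -/
theorem finrank_map_and_ker_restrict {W W' K : Type*} [AddCommGroup W] [Module ℝ W]
    [FiniteDimensional ℝ W] [AddCommGroup W'] [Module ℝ W'] [AddCommGroup K] [Module ℝ K]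
    (R : W →ₗ[ℝ] W') (b : LinearMap.BilinForm ℝ W) (b' : LinearMap.BilinForm ℝ W')
    (S : Submodule ℝ W) (S' : Submodule ℝ W') (hS : S.map R = S')
    {κ : K →ₗ[ℝ] W} (hκ : Function.Injective κ)
    (hκS : ∀ α, α ∈ LinearMap.range κ ↔ α ∈ S ∧ R α = 0)
    (hb : ∀ α ∈ S, ∀ β ∈ S, b' (R α) (R β) = b α β) :
    Module.finrank ℝ S' + Module.finrank ℝ K = Module.finrank ℝ S ∧
      Module.finrank ℝ (LinearMap.ker (b'.restrict S')) + Module.finrank ℝ K =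
        Module.finrank ℝ (LinearMap.ker (b.restrict S)) := by
  subst hS
  -- Rank-nullity for R on any N between its kernel in S and S. It is applied to S itself and to the
  -- radical of b on S, whose image under R is the radical of b' on S'.
  have general : ∀ N : Submodule ℝ W, LinearMap.range κ ≤ N → N ≤ S →
      Module.finrank ℝ (N.map R) + Module.finrank ℝ K = Module.finrank ℝ N := by
    intro N hN hNS
    have h1 := LinearMap.finrank_range_add_finrank_ker (R.domRestrict N)
    rw [LinearMap.range_domRestrict] at h1
    have h2 : LinearMap.ker (R.domRestrict N) = (LinearMap.range κ).comap N.subtype := by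
      ext α
      rw [LinearMap.mem_ker, LinearMap.domRestrict_apply, Submodule.mem_comap, hκS]
      exact ⟨fun h => ⟨hNS α.2, h⟩, fun h => h.2⟩
    rw [h2, (Submodule.comapSubtypeEquivOfLe hN).finrank_eq,
      LinearMap.finrank_range_of_inj hκ] at h1
    exact h1
  have hκle : LinearMap.range κ ≤ S := fun α hα => ((hκS α).1 hα).1
  refine ⟨general S hκle le_rfl, ?_⟩
  let N : Submodule ℝ W := (LinearMap.ker (b.restrict S)).map S.subtype
  have hmemN : ∀ α, α ∈ N ↔ α ∈ S ∧ ∀ β ∈ S, b α β = 0 := by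
    intro α
    constructor
    · rintro ⟨k, hk, rfl⟩
      exact ⟨k.2, fun β hβ => DFunLike.congr_fun (LinearMap.mem_ker.1 hk) ⟨β, hβ⟩⟩
    · rintro ⟨h1, h2⟩
      refine ⟨⟨α, h1⟩, ?_, rfl⟩
      exact LinearMap.mem_ker.2 (LinearMap.ext fun β => h2 β β.2)
  have hN' : N.map R = (LinearMap.ker (b'.restrict (S.map R))).map (S.map R).subtype := by
    ext γ
    constructor
    · rintro ⟨α, hα, rfl⟩
      obtain ⟨h1, h2⟩ := (hmemN α).1 hα
      refine ⟨⟨R α, α, h1, rfl⟩, ?_, rfl⟩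
      refine LinearMap.mem_ker.2 (LinearMap.ext fun β => ?_)
      obtain ⟨_, β, hβ, rfl⟩ := β
      exact (hb α h1 β hβ).trans (h2 β hβ)
    · rintro ⟨⟨_, α, h1, rfl⟩, hk, rfl⟩
      refine ⟨α, (hmemN α).2 ⟨h1, fun β hβ => ?_⟩, rfl⟩
      rw [← hb α h1 β hβ]
      exact DFunLike.congr_fun (LinearMap.mem_ker.1 hk) ⟨R β, β, hβ, rfl⟩
  have h3 := general N (fun α hα => by
    obtain ⟨h1, h2⟩ := (hκS α).1 hα
    refine (hmemN α).2 ⟨h1, fun β hβ => ?_⟩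
    rw [← hb α h1 β hβ, h2, map_zero]; rfl) fun α hα => ((hmemN α).1 hα).1
  rw [hN', Submodule.finrank_map_subtype_eq, Submodule.finrank_map_subtype_eq] at h3
  exact h3

end PoissonReduction

section ModelForm

variable {E M : Type*} [NormedAddCommGroup E] [NormedSpace ℝ E]
  [TopologicalSpace M] [ChartedSpace E M]

namespace SymplecticForm

theorem modelForm_add_left (Ω : SymplecticForm E M) (x : M) (u u' v : E) :
    Ω.modelForm x ![u + u', v] = Ω.modelForm x ![u, v] + Ω.modelForm x ![u', v] :=
  LinearMap.map_add₂ (Ω.bilin x) u u' v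

theorem modelForm_add_right (Ω : SymplecticForm E M) (x : M) (u v v' : E) :
    Ω.modelForm x ![u, v + v'] = Ω.modelForm x ![u, v] + Ω.modelForm x ![u, v'] :=
  (Ω.bilin x u).map_add v v'

theorem modelForm_swap (Ω : SymplecticForm E M) (x : M) (u v : E) :
    Ω.modelForm x ![u, v] = - Ω.modelForm x ![v, u] := Ω.toForm_swap x u v

theorem eq_of_forall_modelForm_eq (Ω : SymplecticForm E M) (x : M) {u v : E}
    (h : ∀ w, Ω.modelForm x ![w, u] = Ω.modelForm x ![w, v]) : u = v := by
  rw [← sub_eq_zero]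
  refine Ω.nondegenerate x _ fun (w : E) => ?_
  have h1 := (Ω.bilin x w).map_sub u v
  exact h1.trans (sub_eq_zero.2 (h w))

end SymplecticForm

end ModelForm

section DualLemmas

variable {E V : Type*} [NormedAddCommGroup E] [NormedSpace ℝ E]
  [NormedAddCommGroup V] [NormedSpace ℝ V] [FiniteDimensional ℝ V]

theorem finrank_continuousDual : Module.finrank ℝ (V →L[ℝ] ℝ) = Module.finrank ℝ V := by
  rw [← (LinearMap.toContinuousLinearMap (𝕜 := ℝ) (E := V) (F' := ℝ)).finrank_eq]
  exact Subspace.dual_finrank_eq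

/-- Such an α factors through D as a functional on the dual of V, that is, as an evaluation. -/
theorem exists_eq_apply_of_ker_le {D : E →L[ℝ] V →L[ℝ] ℝ} (hD : Function.Surjective D)
    {α : E →ₗ[ℝ] ℝ} (h : ∀ v, D v = 0 → α v = 0) : ∃ a, ∀ v, α v = D v a := by
  obtain ⟨s, hs⟩ := D.toLinearMap.exists_rightInverse_of_surjective (LinearMap.range_eq_top.2 hD)
  have hs' : ∀ β, D (s β) = β := fun β => DFunLike.congr_fun hs β
  let ψ : Module.Dual ℝ (Module.Dual ℝ V) :=
    α ∘ₗ s ∘ₗ (LinearMap.toContinuousLinearMap (𝕜 := ℝ) (E := V) (F' := ℝ)).toLinearMap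
  obtain ⟨a, ha⟩ := (Module.evalEquiv ℝ V).surjective ψ
  refine ⟨a, fun v => ?_⟩
  have h1 : D v a = α (s (D v)) := DFunLike.congr_fun ha (D v).toLinearMap
  rw [h1, ← sub_eq_zero, ← map_sub]
  exact h _ (by rw [map_sub, hs', sub_self])

end DualLemmas

/-! ### Tangent spaces of levels and orbits; the reduced form -/

section ReductionDifferential

variable {EG G E M EP P F X : Type*}
    [NormedAddCommGroup EG] [NormedSpace ℝ EG] [FiniteDimensional ℝ EG]
    [TopologicalSpace G] [ChartedSpace EG G] [Group G] [LieGroup 𝓘(ℝ, EG) ∞ G] [T2Space G]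
    [NormedAddCommGroup E] [NormedSpace ℝ E] [FiniteDimensional ℝ E]
    [TopologicalSpace M] [ChartedSpace E M] [IsManifold 𝓘(ℝ, E) ∞ M] [T2Space M]
    [MulAction G M]
    [NormedAddCommGroup EP] [NormedSpace ℝ EP] [FiniteDimensional ℝ EP]
    [TopologicalSpace P] [ChartedSpace EP P]
    [MulAction G P] [ContMDiffSMul 𝓘(ℝ, EG) 𝓘(ℝ, EP) ∞ G P]
    [NormedAddCommGroup F] [NormedSpace ℝ F] [FiniteDimensional ℝ F]
    [TopologicalSpace X] [ChartedSpace F X]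
    {Ω : SymplecticForm E M} {Φ : M → (EG →L[ℝ] ℝ)}
    {ι : P → M} {π : P → X} {A : P → EP →L[ℝ] E} {B : P → EP →L[ℝ] F}

omit [FiniteDimensional ℝ EP] [MulAction G P] [ContMDiffSMul 𝓘(ℝ, EG) 𝓘(ℝ, EP) ∞ G P] in
/-- The tangent space of a level set is the orthogonal complement of the tangent space of the
orbit. -/
theorem IsHamiltonianAction.exists_eq_incl_iff
    (hΦ : IsHamiltonianAction (EG := EG) (G := G) Ω Φ)
    (hfree : ∀ (g : G) (x : M), g • x = x → g = 1)
    (hA : ∀ z, HasMFDerivAt 𝓘(ℝ, EP) 𝓘(ℝ, E) ι z (A z)) (hAi : ∀ z, Function.Injective (A z))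
    {η : EG →L[ℝ] ℝ} (hη : ∀ z, Φ (ι z) = η)
    (hd : Module.finrank ℝ EP + Module.finrank ℝ EG = Module.finrank ℝ E) (z : P) (v : E) :
    (∃ u, A z u = v) ↔ ∀ a, Ω.modelForm (ι z) ![v, fundamentalMap E EG G (ι z) a] = 0 := by
  obtain ⟨D, hD, hDa⟩ := hΦ.exists_hasMFDerivAt_moment (ι z)
  have hDs : Function.Surjective D := by
    have := hΦ.surjective_mfderiv_moment hfree (ι z)
    rwa [hD.mfderiv] at this
  have h1 : D.comp (A z) = 0 := by
    have h2 : HasMFDerivAt 𝓘(ℝ, EP) 𝓘(ℝ, EG →L[ℝ] ℝ) (fun z => Φ (ι z)) z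
        (0 : EP →L[ℝ] EG →L[ℝ] ℝ) := by
      rw [show (fun z => Φ (ι z)) = fun _ => η from funext hη]
      exact hasMFDerivAt_const _ _
    exact hasMFDerivAt_unique (hD.comp_of_eq' (hA z) rfl) h2
  -- One inclusion holds because Φ is constant on the level; equality follows by counting
  -- dimensions.
  have h3 : LinearMap.range (A z).toLinearMap = LinearMap.ker D.toLinearMap := by
    refine Submodule.eq_of_le_of_finrank_eq ?_ ?_
    · rintro _ ⟨u, rfl⟩
      exact DFunLike.congr_fun h1 u
    · rw [LinearMap.finrank_range_of_inj (hAi z), finrank_ker_of_surjective (F := EP) hDs]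
      rw [finrank_continuousDual, hd]
  have h4 : (∃ u, A z u = v) ↔ v ∈ LinearMap.ker D.toLinearMap := by
    rw [← h3]; rfl
  rw [h4, LinearMap.mem_ker]
  constructor
  · intro h a
    rw [← hDa]
    exact DFunLike.congr_fun h a
  · intro h
    refine ContinuousLinearMap.ext fun a => ?_
    exact (hDa v a).trans (h a)

/-- A tangent vector orthogonal to the level set is tangent to the orbit. -/
theorem IsHamiltonianAction.exists_fundamentalMap_eq
    (hΦ : IsHamiltonianAction (EG := EG) (G := G) Ω Φ)
    (hfree : ∀ (g : G) (x : M), g • x = x → g = 1) {x : M} {w : E}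
    (h : ∀ v, (∀ a, Ω.modelForm x ![v, fundamentalMap E EG G x a] = 0) →
      Ω.modelForm x ![v, w] = 0) : ∃ a, fundamentalMap E EG G x a = w := by
  obtain ⟨D, hD, hDa⟩ := hΦ.exists_hasMFDerivAt_moment x
  have hDs : Function.Surjective D := by
    have := hΦ.surjective_mfderiv_moment hfree x
    rwa [hD.mfderiv] at this
  obtain ⟨a, ha⟩ := exists_eq_apply_of_ker_le hDs (α := (Ω.bilin x).flip w) fun v hv =>
    h v fun a => by rw [← hDa, hv]; rfl
  refine ⟨a, Ω.eq_of_forall_modelForm_eq x fun v => ?_⟩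
  rw [← hDa, ← ha]
  rfl

omit [FiniteDimensional ℝ EG] [LieGroup 𝓘(ℝ, EG) ∞ G] [T2Space G] [FiniteDimensional ℝ E]
  [IsManifold 𝓘(ℝ, E) ∞ M] [T2Space M] [FiniteDimensional ℝ EP] in
theorem fundamentalMap_of_equivariant [ContMDiffSMul 𝓘(ℝ, EG) 𝓘(ℝ, E) ∞ G M]
    (hA : ∀ z, HasMFDerivAt 𝓘(ℝ, EP) 𝓘(ℝ, E) ι z (A z))
    (hι : ∀ (g : G) z, ι (g • z) = g • ι z) (z : P) (a : EG) :
    A z (fundamentalMap EP EG G z a) = fundamentalMap E EG G (ι z) a := by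
  have h1 := (hA z).comp_of_eq' (hasMFDerivAt_orbitMap (EG := EG) (E := EP) (G := G) z)
    (one_smul G z)
  have h2 := hasMFDerivAt_orbitMap (EG := EG) (E := E) (G := G) (ι z)
  have h3 : HasMFDerivAt 𝓘(ℝ, EG) 𝓘(ℝ, E) (fun g : G => ι (g • z)) 1
      (fundamentalMap E EG G (ι z)) := h2.congr_of_eventuallyEq (.of_forall fun g => hι g z)
  exact DFunLike.congr_fun (hasMFDerivAt_unique h1 h3) a

omit [T2Space M] [FiniteDimensional ℝ F] in
/-- The kernel of the differential of the projection to the orbit space is the tangent space of the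
orbit. -/
theorem IsHamiltonianAction.proj_eq_zero_iff
    (hΦ : IsHamiltonianAction (EG := EG) (G := G) Ω Φ)
    (hfree : ∀ (g : G) (x : M), g • x = x → g = 1)
    (hA : ∀ z, HasMFDerivAt 𝓘(ℝ, EP) 𝓘(ℝ, E) ι z (A z))
    (hB : ∀ z, HasMFDerivAt 𝓘(ℝ, EP) 𝓘(ℝ, F) π z (B z)) (hBs : ∀ z, Function.Surjective (B z))
    (hι : ∀ (g : G) z, ι (g • z) = g • ι z) (hπ : ∀ (g : G) z, π (g • z) = π z)
    (hd : Module.finrank ℝ F + Module.finrank ℝ EG = Module.finrank ℝ EP) (z : P) (u : EP) :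
    B z u = 0 ↔ ∃ a, fundamentalMap EP EG G z a = u := by
  have := hΦ.smooth_action
  have : CompleteSpace EG := FiniteDimensional.complete ℝ EG
  have hf := fundamentalMap_of_equivariant (EG := EG) hA hι z
  have hinj : Function.Injective (fundamentalMap EP EG G z) := fun a b hab =>
    fundamentalMap_injective_of_free hfree (ι z) (by rw [← hf, ← hf, hab])
  have h1 : (B z).comp (fundamentalMap EP EG G z) = 0 := by
    have h2 := (hB z).comp_of_eq' (hasMFDerivAt_orbitMap (EG := EG) (E := EP) (G := G) z)
      (one_smul G z)
    have h3 : HasMFDerivAt 𝓘(ℝ, EG) 𝓘(ℝ, F) (fun g : G => π (g • z)) 1 (0 : EG →L[ℝ] F) := by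
      rw [show (fun g : G => π (g • z)) = fun _ => π z from funext fun g => hπ g z]
      exact hasMFDerivAt_const _ _
    exact hasMFDerivAt_unique h2 h3
  have h4 : LinearMap.range (fundamentalMap EP EG G z).toLinearMap =
      LinearMap.ker (B z).toLinearMap := by
    refine Submodule.eq_of_le_of_finrank_eq ?_ ?_
    · rintro _ ⟨u, rfl⟩
      exact DFunLike.congr_fun h1 u
    · rw [LinearMap.finrank_range_of_inj hinj, finrank_ker_of_surjective (F := EG) (hBs z)]
      omega
  have h5 : B z u = 0 ↔ u ∈ LinearMap.ker (B z).toLinearMap := Iff.rfl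
  rw [h5, ← h4]
  rfl

/-- The reduced symplectic form. -/
theorem IsHamiltonianAction.exists_reducedForm [IsManifold 𝓘(ℝ, F) ∞ X]
    (hΦ : IsHamiltonianAction (EG := EG) (G := G) Ω Φ)
    (hfree : ∀ (g : G) (x : M), g • x = x → g = 1)
    (hιs : ContMDiff 𝓘(ℝ, EP) 𝓘(ℝ, E) ∞ ι)
    (hA : ∀ z, HasMFDerivAt 𝓘(ℝ, EP) 𝓘(ℝ, E) ι z (A z)) (hAi : ∀ z, Function.Injective (A z))
    (hB : ∀ z, HasMFDerivAt 𝓘(ℝ, EP) 𝓘(ℝ, F) π z (B z)) (hBs : ∀ z, Function.Surjective (B z))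
    (hι : ∀ (g : G) z, ι (g • z) = g • ι z)
    (hfib : ∀ z w, π z = π w ↔ ∃ g : G, g • z = w) (hπs : Function.Surjective π)
    {η : EG →L[ℝ] ℝ} (hη : ∀ z, Φ (ι z) = η)
    (hd : Module.finrank ℝ EP + Module.finrank ℝ EG = Module.finrank ℝ E)
    (hd' : Module.finrank ℝ F + Module.finrank ℝ EG = Module.finrank ℝ EP)
    (hsec : ∀ z : P, ∃ (τ : X → P) (W : Set X), IsOpen W ∧ π z ∈ W ∧
        ContMDiffOn 𝓘(ℝ, F) 𝓘(ℝ, EP) ∞ τ W ∧ τ (π z) = z ∧ ∀ x ∈ W, π (τ x) = x) :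
    ∃ ζ : SymplecticForm F X, ∀ z u v,
      ζ.modelForm (π z) ![B z u, B z v] = Ω.modelForm (ι z) ![A z u, A z v] := by
  have := hΦ.smooth_action
  have hπ : ∀ (g : G) z, π (g • z) = π z := fun g z => ((hfib _ _).2 ⟨g, rfl⟩).symm
  have hf := fundamentalMap_of_equivariant (EG := EG) hA hι
  have hort := hΦ.exists_eq_incl_iff hfree hA hAi hη hd
  have hker := hΦ.proj_eq_zero_iff hfree hA hB hBs hι hπ hd'
  refine Ω.exists_descent hιs hA hB hπs hsec ?_ ?_
  · intro z w hzw u u' v v' huv huv'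
    obtain ⟨g, rfl⟩ := (hfib _ _).1 hzw
    obtain ⟨S, hS⟩ : ∃ S : EP →L[ℝ] EP, HasMFDerivAt 𝓘(ℝ, EP) 𝓘(ℝ, EP) (fun z : P => g • z) z S :=
      ⟨_, ((ContMDiffSMul.contMDiff_const_smul (I := 𝓘(ℝ, EG)) (I' := 𝓘(ℝ, EP)) (n := ∞)
        g).mdifferentiableAt (by simp)).hasMFDerivAt⟩
    let T : E →L[ℝ] E := mfderiv 𝓘(ℝ, E) 𝓘(ℝ, E) (fun x : M => g • x) (ι z)
    have hT : HasMFDerivAt 𝓘(ℝ, E) 𝓘(ℝ, E) (fun x : M => g • x) (ι z) T :=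
      ((ContMDiffSMul.contMDiff_const_smul (I := 𝓘(ℝ, EG)) (I' := 𝓘(ℝ, E)) (n := ∞)
        g).mdifferentiableAt (by simp)).hasMFDerivAt
    have h1 : ∀ u, A (g • z) (S u) = T (A z u) := by
      have h2 := (hA (g • z)).comp_of_eq' hS rfl
      have h3 := hT.comp_of_eq' (hA z) rfl
      have h4 : HasMFDerivAt 𝓘(ℝ, EP) 𝓘(ℝ, E) (fun z : P => ι (g • z)) z (T.comp (A z)) :=
        h3.congr_of_eventuallyEq (.of_forall fun z => hι g z)
      exact fun u => DFunLike.congr_fun (hasMFDerivAt_unique h2 h4) u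
    have h4 : ∀ u, B (g • z) (S u) = B z u := by
      have h2 := (hB (g • z)).comp_of_eq' hS rfl
      have h3 : HasMFDerivAt 𝓘(ℝ, EP) 𝓘(ℝ, F) (fun z : P => π (g • z)) z (B z) :=
        (hB z).congr_of_eventuallyEq (.of_forall fun z => hπ g z)
      exact fun u => DFunLike.congr_fun (hasMFDerivAt_unique h2 h3) u
    -- Lifts of the same vector at z and at g • z agree, after translation by g, up to an orbit
    -- direction. Such directions are Ω-orthogonal to the level and do not affect the form.
    have h5 : ∀ u v, B z u = B (g • z) v →
        ∃ a, A (g • z) v = T (A z u) + fundamentalMap E EG G (ι (g • z)) a := by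
      intro u v huv
      obtain ⟨a, ha⟩ := (hker (g • z) (v - S u)).1 (by rw [map_sub, h4, huv, sub_self])
      refine ⟨a, ?_⟩
      rw [← hf, ha, ← h1, map_sub]
      abel
    have h6 : ∀ v a, Ω.modelForm (ι (g • z)) ![A (g • z) v,
        fundamentalMap E EG G (ι (g • z)) a] = 0 := fun v => (hort (g • z) _).1 ⟨v, rfl⟩
    obtain ⟨a, ha⟩ := h5 u v huv
    obtain ⟨a', ha'⟩ := h5 u' v' huv'
    have h7 : Ω.modelForm (ι (g • z)) ![T (A z u), T (A z u')] =
        Ω.modelForm (ι z) ![A z u, A z u'] := by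
      rw [hι]
      exact hΦ.symplectic g (ι z) _ _
    rw [ha, Ω.modelForm_add_left, Ω.modelForm_swap _ (fundamentalMap E EG G _ a), h6, neg_zero,
      add_zero, ha', Ω.modelForm_add_right, ← h1 u, h6, add_zero, h1, h7]
  · intro z u hu
    obtain ⟨a, ha⟩ := hΦ.exists_fundamentalMap_eq hfree (x := ι z) (w := A z u) fun v hv => by
      obtain ⟨v, rfl⟩ := (hort z v).2 hv
      exact hu v
    rw [hker]
    exact ⟨a, hAi z (by rw [hf, ha])⟩

end ReductionDifferential

/-! ### The induced algebra and its dimensions -/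

section ReducedAlgebra

variable {EG G E M EP P F X : Type*}
    [NormedAddCommGroup EG] [NormedSpace ℝ EG] [FiniteDimensional ℝ EG]
    [TopologicalSpace G] [ChartedSpace EG G] [Group G] [LieGroup 𝓘(ℝ, EG) ∞ G] [T2Space G]
    [NormedAddCommGroup E] [NormedSpace ℝ E] [FiniteDimensional ℝ E]
    [TopologicalSpace M] [ChartedSpace E M]
    [MulAction G M]
    [NormedAddCommGroup EP] [NormedSpace ℝ EP]
    [TopologicalSpace P] [ChartedSpace EP P]
    [NormedAddCommGroup F] [NormedSpace ℝ F] [FiniteDimensional ℝ F]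
    [TopologicalSpace X] [ChartedSpace F X]
    {Ω : SymplecticForm E M} {Φ : M → (EG →L[ℝ] ℝ)}
    {ι : P → M} {π : P → X} {A : P → EP →L[ℝ] E} {B : P → EP →L[ℝ] F} {ζ : SymplecticForm F X}

/-- The functions on `X` that are induced by functions of a subalgebra on `M`. -/
def inducedSubalgebra (𝓕 : Subalgebra ℝ C^∞⟮𝓘(ℝ, E), M; ℝ⟯) (ι : P → M) (π : P → X) :
    Subalgebra ℝ C^∞⟮𝓘(ℝ, F), X; ℝ⟯ where
  carrier := {h | ∃ f ∈ 𝓕, ∀ z, h (π z) = f (ι z)}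
  mul_mem' := by
    rintro h h' ⟨f, hf, e⟩ ⟨f', hf', e'⟩
    exact ⟨f * f', 𝓕.mul_mem hf hf', fun z => by
      rw [ContMDiffMap.coe_mul, ContMDiffMap.coe_mul, Pi.mul_apply, Pi.mul_apply, e, e']⟩
  add_mem' := by
    rintro h h' ⟨f, hf, e⟩ ⟨f', hf', e'⟩
    exact ⟨f + f', 𝓕.add_mem hf hf', fun z => by
      rw [ContMDiffMap.coe_add, ContMDiffMap.coe_add, Pi.add_apply, Pi.add_apply, e, e']⟩
  algebraMap_mem' c := ⟨algebraMap ℝ _ c, 𝓕.algebraMap_mem c, fun z => rfl⟩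

omit [FiniteDimensional ℝ E] [FiniteDimensional ℝ F] in
/-- Smooth functions that are constant on the fibres of a submersion descend. -/
theorem exists_contMDiffMap_descent (hιs : ContMDiff 𝓘(ℝ, EP) 𝓘(ℝ, E) ∞ ι)
    (hπs : Function.Surjective π)
    (hsec : ∀ z : P, ∃ (τ : X → P) (W : Set X), IsOpen W ∧ π z ∈ W ∧
        ContMDiffOn 𝓘(ℝ, F) 𝓘(ℝ, EP) ∞ τ W ∧ τ (π z) = z ∧ ∀ x ∈ W, π (τ x) = x)
    (f : C^∞⟮𝓘(ℝ, E), M; ℝ⟯) (hf : ∀ z w, π z = π w → f (ι z) = f (ι w)) :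
    ∃ h : C^∞⟮𝓘(ℝ, F), X; ℝ⟯, ∀ z, h (π z) = f (ι z) := by
  choose p hp using hπs
  refine ⟨⟨fun x => f (ι (p x)), fun x => ?_⟩, fun z => hf _ _ (hp _)⟩
  obtain ⟨τ, W, hWo, hW, hτ, -, hπτ⟩ := hsec (p x)
  rw [hp] at hW
  have h1 : ContMDiffAt 𝓘(ℝ, F) 𝓘(ℝ, ℝ) ∞ (fun y => f (ι (τ y))) x :=
    (f.contMDiff.comp hιs).contMDiffAt.comp x (hτ.contMDiffAt (hWo.mem_nhds hW))
  refine h1.congr_of_eventuallyEq ?_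
  filter_upwards [hWo.mem_nhds hW] with y hy
  exact hf _ _ ((hp y).trans (hπτ y hy).symm)

omit [FiniteDimensional ℝ E] [FiniteDimensional ℝ F] in
theorem differential_descent
    (hA : ∀ z, HasMFDerivAt 𝓘(ℝ, EP) 𝓘(ℝ, E) ι z (A z))
    (hB : ∀ z, HasMFDerivAt 𝓘(ℝ, EP) 𝓘(ℝ, F) π z (B z))
    {f : C^∞⟮𝓘(ℝ, E), M; ℝ⟯} {h : C^∞⟮𝓘(ℝ, F), X; ℝ⟯} (hf : ∀ z, h (π z) = f (ι z)) (z : P)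
    (u : EP) :
    (differential (E := F) h (π z) : F →L[ℝ] ℝ) (B z u) =
      (differential (E := E) f (ι z) : E →L[ℝ] ℝ) (A z u) := by
  have h1 : HasMFDerivAt 𝓘(ℝ, F) 𝓘(ℝ, ℝ) h (π z) (differential (E := F) h (π z) : F →L[ℝ] ℝ) :=
    (h.contMDiff.mdifferentiableAt (by simp)).hasMFDerivAt
  have h2 : HasMFDerivAt 𝓘(ℝ, E) 𝓘(ℝ, ℝ) f (ι z) (differential (E := E) f (ι z) : E →L[ℝ] ℝ) :=
    (f.contMDiff.mdifferentiableAt (by simp)).hasMFDerivAt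
  have h3 := h1.comp_of_eq' (hB z) rfl
  have h4 := h2.comp_of_eq' (hA z) rfl
  have h5 : HasMFDerivAt 𝓘(ℝ, EP) 𝓘(ℝ, ℝ) (fun z => h (π z)) z
      ((differential (E := E) f (ι z) : E →L[ℝ] ℝ).comp (A z)) :=
    h4.congr_of_eventuallyEq (.of_forall hf)
  exact DFunLike.congr_fun (hasMFDerivAt_unique h3 h5) u

/-- The Poisson tensor of a symplectic form, on covectors of the model space. -/
def SymplecticForm.modelPoisson (Ω : SymplecticForm E M) (x : M) :
    LinearMap.BilinForm ℝ (E →L[ℝ] ℝ) := Ω.poissonTensor x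

/-- The linear map `v ↦ Ω(·, v)` on the model space. -/
def SymplecticForm.modelFlat (Ω : SymplecticForm E M) (x : M) : E →ₗ[ℝ] (E →L[ℝ] ℝ) := Ω.flat x

theorem SymplecticForm.modelFlat_apply (Ω : SymplecticForm E M) (x : M) (v w : E) :
    Ω.modelFlat x v w = Ω.modelForm x ![w, v] := rfl

theorem SymplecticForm.modelFlat_injective (Ω : SymplecticForm E M) (x : M) :
    Function.Injective (Ω.modelFlat x) := (Ω.flat_bijective x).1

theorem SymplecticForm.modelFlat_surjective (Ω : SymplecticForm E M) (x : M) :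
    Function.Surjective (Ω.modelFlat x) := (Ω.flat_bijective x).2

theorem SymplecticForm.modelPoisson_modelFlat (Ω : SymplecticForm E M) (x : M) (v : E)
    (β : E →L[ℝ] ℝ) : Ω.modelPoisson x (Ω.modelFlat x v) β = β v := by
  refine (Ω.poissonTensor_eq x _ _).trans ?_
  have h : Ω.sharp x (Ω.flat x v) = v :=
    (LinearEquiv.ofBijective (Ω.flat x) (Ω.flat_bijective x)).symm_apply_apply v
  exact congrArg β h

omit [FiniteDimensional ℝ EG] [LieGroup 𝓘(ℝ, EG) ∞ G] [T2Space G] [TopologicalSpace P]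
  [ChartedSpace EP P] in
/-- The Poisson tensor of the reduced form. -/
theorem modelPoisson_descent
    (hBs : ∀ z, Function.Surjective (B z))
    (hort : ∀ z v, (∃ u, A z u = v) ↔
      ∀ a, Ω.modelForm (ι z) ![v, fundamentalMap E EG G (ι z) a] = 0)
    (hζ : ∀ z u v, ζ.modelForm (π z) ![B z u, B z v] = Ω.modelForm (ι z) ![A z u, A z v])
    {z : P} {α α' : E →L[ℝ] ℝ} {β β' : F →L[ℝ] ℝ}
    (hα : ∀ a, α (fundamentalMap E EG G (ι z) a) = 0) (hβ : ∀ u, β (B z u) = α (A z u))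
    (hβ' : ∀ u, β' (B z u) = α' (A z u)) :
    ζ.modelPoisson (π z) β β' = Ω.modelPoisson (ι z) α α' := by
  obtain ⟨v, rfl⟩ := Ω.modelFlat_surjective (ι z) α
  -- The vector dual to α is orthogonal to the orbit, hence tangent to the level; its projection is
  -- the vector dual to β.
  obtain ⟨u, rfl⟩ := (hort z v).2 fun a => by
    rw [Ω.modelForm_swap, ← Ω.modelFlat_apply, hα, neg_zero]
  have h1 : β = ζ.modelFlat (π z) (B z u) := by
    ext w
    obtain ⟨w, rfl⟩ := hBs z w
    rw [hβ, ζ.modelFlat_apply, hζ, Ω.modelFlat_apply]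
  rw [h1, ζ.modelPoisson_modelFlat, Ω.modelPoisson_modelFlat, hβ']

/-- The dimensions that enter the completeness condition drop by the dimension of the group. -/
theorem IsHamiltonianAction.finrank_inducedSubalgebra [IsManifold 𝓘(ℝ, E) ∞ M] [T2Space M]
    (hΦ : IsHamiltonianAction (EG := EG) (G := G) Ω Φ)
    (hfree : ∀ (g : G) (x : M), g • x = x → g = 1)
    (hA : ∀ z, HasMFDerivAt 𝓘(ℝ, EP) 𝓘(ℝ, E) ι z (A z))
    (hB : ∀ z, HasMFDerivAt 𝓘(ℝ, EP) 𝓘(ℝ, F) π z (B z)) (hBs : ∀ z, Function.Surjective (B z))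
    (hort : ∀ z v, (∃ u, A z u = v) ↔
      ∀ a, Ω.modelForm (ι z) ![v, fundamentalMap E EG G (ι z) a] = 0)
    (hker : ∀ z u, B z u = 0 → ∃ a, A z u = fundamentalMap E EG G (ι z) a)
    (hζ : ∀ z u v, ζ.modelForm (π z) ![B z u, B z v] = Ω.modelForm (ι z) ![A z u, A z v])
    {𝓕 : Subalgebra ℝ C^∞⟮𝓘(ℝ, E), M; ℝ⟯}
    (hF : ∀ f ∈ 𝓕, ∀ (g : G) (x : M), f (g • x) = f x)
    (hdesc : ∀ f ∈ 𝓕, ∃ h : C^∞⟮𝓘(ℝ, F), X; ℝ⟯, ∀ z, h (π z) = f (ι z)) (z : P)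
    (hx : Module.finrank ℝ (differentialSpan 𝓕 (ι z)) + Module.finrank ℝ
        (LinearMap.ker ((Ω.poissonTensor (ι z)).restrict (differentialSpan 𝓕 (ι z)))) =
      Module.finrank ℝ E) :
    Module.finrank ℝ (differentialSpan (inducedSubalgebra (F := F) 𝓕 ι π) (π z)) +
        Module.finrank ℝ EG = Module.finrank ℝ (differentialSpan 𝓕 (ι z)) ∧
      Module.finrank ℝ (LinearMap.ker ((ζ.poissonTensor (π z)).restrict
        (differentialSpan (inducedSubalgebra 𝓕 ι π) (π z)))) + Module.finrank ℝ EG =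
      Module.finrank ℝ
        (LinearMap.ker ((Ω.poissonTensor (ι z)).restrict (differentialSpan 𝓕 (ι z)))) := by
  have := hΦ.smooth_action
  have : CompleteSpace EG := FiniteDimensional.complete ℝ EG
  obtain ⟨s, hs⟩ := (B z).toLinearMap.exists_rightInverse_of_surjective
    (LinearMap.range_eq_top.2 (hBs z))
  have hBs' : ∀ v, B z (s v) = v := fun v => DFunLike.congr_fun hs v
  let C : F →L[ℝ] E := ((A z).toLinearMap ∘ₗ s).toContinuousLinearMap
  -- Restriction to the level, then descent through the linear section s of B. The choice of s is
  -- immaterial on S, whose covectors vanish on orbit directions.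
  let R : (E →L[ℝ] ℝ) →ₗ[ℝ] (F →L[ℝ] ℝ) := (ContinuousLinearMap.compL ℝ F E ℝ).flip C
  have hR : ∀ α v, R α v = α (A z (s v)) := fun α v => rfl
  let S : Submodule ℝ (E →L[ℝ] ℝ) := Submodule.span ℝ
    ((fun f : C^∞⟮𝓘(ℝ, E), M; ℝ⟯ => (differential (⇑f) (ι z) : E →L[ℝ] ℝ)) '' 𝓕)
  let S' : Submodule ℝ (F →L[ℝ] ℝ) := Submodule.span ℝ
    ((fun f : C^∞⟮𝓘(ℝ, F), X; ℝ⟯ => (differential (⇑f) (π z) : F →L[ℝ] ℝ)) ''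
      ((inducedSubalgebra 𝓕 ι π : Subalgebra ℝ C^∞⟮𝓘(ℝ, F), X; ℝ⟯) : Set C^∞⟮𝓘(ℝ, F), X; ℝ⟯))
  -- The map a ↦ dφ_a at ι z. Its range is the kernel of R on S, and membership in S is where
  -- completeness at ι z is used.
  let κ : EG →ₗ[ℝ] (E →L[ℝ] ℝ) :=
    Ω.modelFlat (ι z) ∘ₗ (fundamentalMap E EG G (ι z)).toLinearMap
  have hSf : ∀ α ∈ S, ∀ a, α (fundamentalMap E EG G (ι z) a) = 0 := fun α hα a =>
    differentialSpan_fundamentalField (EG := EG) hF a (ι z) α hα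
  have hRB : ∀ α ∈ S, ∀ u, R α (B z u) = α (A z u) := by
    intro α hα u
    obtain ⟨a, ha⟩ := hker z (s (B z u) - u) (by rw [map_sub, hBs', sub_self])
    rw [hR, ← sub_eq_zero, ← map_sub, ← map_sub, ha]
    exact hSf α hα a
  have hRd : ∀ f ∈ 𝓕, ∀ h : C^∞⟮𝓘(ℝ, F), X; ℝ⟯, (∀ z, h (π z) = f (ι z)) →
      R (differential (E := E) f (ι z)) = differential (E := F) h (π z) := by
    intro f hf h hh
    refine ContinuousLinearMap.ext fun (v : F) => ?_
    obtain ⟨u, rfl⟩ := hBs z v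
    exact (hRB _ (Submodule.subset_span ⟨f, hf, rfl⟩) u).trans
      (differential_descent hA hB hh z u).symm
  have hSS' : S.map R = S' := by
    simp only [S, S']
    rw [Submodule.map_span]
    congr 1
    ext β
    constructor
    · rintro ⟨_, ⟨f, hf, rfl⟩, rfl⟩
      obtain ⟨h, hh⟩ := hdesc f hf
      exact ⟨h, ⟨f, hf, hh⟩, (hRd f hf h hh).symm⟩
    · rintro ⟨h, ⟨f, hf, hh⟩, rfl⟩
      exact ⟨_, ⟨f, hf, rfl⟩, hRd f hf h hh⟩
  refine finrank_map_and_ker_restrict R (Ω.modelPoisson (ι z)) (ζ.modelPoisson (π z)) S S' hSS'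
    (κ := κ) ?_ ?_ ?_
  · exact (Ω.modelFlat_injective _).comp (fundamentalMap_injective_of_free hfree _)
  · intro α
    constructor
    · rintro ⟨a, rfl⟩
      refine ⟨?_, ContinuousLinearMap.ext fun v => ?_⟩
      · have h1 := hΦ.differential_moment_mem hF hx a
        have h2 : differential (E := E) (fun y => Φ y a) (ι z) = κ a := by
          refine ContinuousLinearMap.ext fun (v : E) => ?_
          refine (Ω.toForm_sgrad _ (ι z) v).symm.trans ?_
          have h3 : Ω.sgrad (fun y => Φ y a) (ι z) = fundamentalMap E EG G (ι z) a :=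
            hΦ.sgrad_moment a (ι z)
          exact congrArg (fun w : E => Ω.modelForm (ι z) ![v, w]) h3
        exact h2 ▸ h1
      · rw [hR]
        exact (hort z _).1 ⟨_, rfl⟩ a
    · rintro ⟨hα, hα0⟩
      obtain ⟨w, rfl⟩ := Ω.modelFlat_surjective (ι z) α
      obtain ⟨a, ha⟩ := hΦ.exists_fundamentalMap_eq hfree (x := ι z) (w := w) fun v hv => by
        obtain ⟨u, rfl⟩ := (hort z v).2 hv
        rw [← Ω.modelFlat_apply, ← hRB _ hα, hα0]
        rfl
      exact ⟨a, congrArg (Ω.modelFlat (ι z)) ha⟩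
  · intro α hα β hβ
    exact modelPoisson_descent hBs hort hζ (hSf α hα) (hRB α hα) (hRB β hβ)

end ReducedAlgebra

/-! ### Descent of complete integrability -/

section Integrability

variable {EG G E M EP P F X : Type*}
    [NormedAddCommGroup EG] [NormedSpace ℝ EG] [FiniteDimensional ℝ EG]
    [TopologicalSpace G] [ChartedSpace EG G] [Group G] [LieGroup 𝓘(ℝ, EG) ∞ G] [T2Space G]
    [NormedAddCommGroup E] [NormedSpace ℝ E] [FiniteDimensional ℝ E]
    [TopologicalSpace M] [ChartedSpace E M] [IsManifold 𝓘(ℝ, E) ∞ M] [T2Space M]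
    [MulAction G M]
    [NormedAddCommGroup EP] [NormedSpace ℝ EP]
    [TopologicalSpace P] [ChartedSpace EP P] [Nonempty P]
    [NormedAddCommGroup F] [NormedSpace ℝ F] [FiniteDimensional ℝ F]
    [TopologicalSpace X] [ChartedSpace F X]
    {Ω : SymplecticForm E M} {Φ : M → (EG →L[ℝ] ℝ)}
    {ι : P → M} {π : P → X} {A : P → EP →L[ℝ] E} {B : P → EP →L[ℝ] F} {ζ : SymplecticForm F X}

/-- A complete algebra of invariant first integrals induces a complete algebra of first integrals of
the reduced system. -/
theorem IsHamiltonianAction.completelyIntegrable_descent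
    (hΦ : IsHamiltonianAction (EG := EG) (G := G) Ω Φ)
    (hfree : ∀ (g : G) (x : M), g • x = x → g = 1)
    (hιs : ContMDiff 𝓘(ℝ, EP) 𝓘(ℝ, E) ∞ ι)
    (hA : ∀ z, HasMFDerivAt 𝓘(ℝ, EP) 𝓘(ℝ, E) ι z (A z))
    (hB : ∀ z, HasMFDerivAt 𝓘(ℝ, EP) 𝓘(ℝ, F) π z (B z)) (hBs : ∀ z, Function.Surjective (B z))
    (hort : ∀ z v, (∃ u, A z u = v) ↔
      ∀ a, Ω.modelForm (ι z) ![v, fundamentalMap E EG G (ι z) a] = 0)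
    (hker : ∀ z u, B z u = 0 → ∃ a, A z u = fundamentalMap E EG G (ι z) a)
    (hζ : ∀ z u v, ζ.modelForm (π z) ![B z u, B z v] = Ω.modelForm (ι z) ![A z u, A z v])
    (hπ : IsOpenQuotientMap π)
    (hsec : ∀ z : P, ∃ (τ : X → P) (W : Set X), IsOpen W ∧ π z ∈ W ∧
        ContMDiffOn 𝓘(ℝ, F) 𝓘(ℝ, EP) ∞ τ W ∧ τ (π z) = z ∧ ∀ x ∈ W, π (τ x) = x)
    (hfib : ∀ z w, π z = π w → ∃ g : G, g • ι z = ι w)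
    (hd : Module.finrank ℝ F + 2 * Module.finrank ℝ EG = Module.finrank ℝ E)
    {H : C^∞⟮𝓘(ℝ, E), M; ℝ⟯} {Hη : C^∞⟮𝓘(ℝ, F), X; ℝ⟯} (hHη : ∀ z, Hη (π z) = H (ι z))
    (hH : ∀ (g : G) (x : M), H (g • x) = H x)
    {𝓕 : Subalgebra ℝ C^∞⟮𝓘(ℝ, E), M; ℝ⟯} (hpoi : Ω.IsPoissonSubalgebra 𝓕)
    (hint : ∀ f ∈ 𝓕, ∀ x : M, differential (E := E) (⇑f) x (Ω.sgrad H x) = 0)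
    (hF : ∀ f ∈ 𝓕, ∀ (g : G) (x : M), f (g • x) = f x)
    {l r : ℕ} (hlr : l + r = Module.finrank ℝ E) {U : Set M} (hUo : IsOpen U)
    (hUd : Dense (ι ⁻¹' U)) (hU : ∀ x ∈ U, Module.finrank ℝ (differentialSpan 𝓕 x) = l ∧
      Module.finrank ℝ
        (LinearMap.ker ((Ω.poissonTensor x).restrict (differentialSpan 𝓕 x))) = r) :
    ζ.CompletelyIntegrable Hη := by
  have := hΦ.smooth_action
  have hinvf : ∀ f ∈ 𝓕, ∀ z w, π z = π w → f (ι z) = f (ι w) := by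
    intro f hf z w hzw
    obtain ⟨g, hg⟩ := hfib z w hzw
    rw [← hg, hF f hf]
  have hdesc : ∀ f ∈ 𝓕, ∃ h : C^∞⟮𝓘(ℝ, F), X; ℝ⟯, ∀ z, h (π z) = f (ι z) := fun f hf =>
    exists_contMDiffMap_descent hιs hπ.surjective hsec f (hinvf f hf)
  have hbr : ∀ (f f' : C^∞⟮𝓘(ℝ, E), M; ℝ⟯) (h h' : C^∞⟮𝓘(ℝ, F), X; ℝ⟯),
      (∀ z, h (π z) = f (ι z)) → (∀ z, h' (π z) = f' (ι z)) →
      (∀ (g : G) (x : M), f (g • x) = f x) → ∀ z,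
      ζ.poissonBracket h h' (π z) = Ω.poissonBracket f f' (ι z) := by
    intro f f' h h' e e' hf z
    exact modelPoisson_descent hBs hort hζ
      (differential_fundamentalField_of_invariant (EG := EG) f.contMDiff hf · (ι z))
      (differential_descent hA hB e z) (differential_descent hA hB e' z)
  refine ⟨inducedSubalgebra 𝓕 ι π, ?_, ?_, ?_⟩
  · rintro h ⟨f, hf, e⟩ h' ⟨f', hf', e'⟩
    obtain ⟨k, hk, hke⟩ := hpoi f hf f' hf'
    obtain ⟨k', hk'⟩ := hdesc k hk
    refine ⟨k', ⟨k, hk, hk'⟩, fun x => ?_⟩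
    obtain ⟨z, rfl⟩ := hπ.surjective x
    rw [hk', hke, hbr f f' h h' e e' (hF f hf)]
  · rintro h ⟨f, hf, e⟩ x
    obtain ⟨z, rfl⟩ := hπ.surjective x
    have h1 := hbr H f Hη h hHη e hH z
    rw [SymplecticForm.poissonBracket, ζ.poissonTensor_eq, SymplecticForm.poissonBracket,
      Ω.poissonTensor_eq] at h1
    exact h1.trans (hint f hf (ι z))
  · have hdim : ∀ z, ι z ∈ U →
        Module.finrank ℝ (differentialSpan (inducedSubalgebra (F := F) 𝓕 ι π) (π z)) +
          Module.finrank ℝ EG = l ∧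
        Module.finrank ℝ (LinearMap.ker ((ζ.poissonTensor (π z)).restrict
          (differentialSpan (inducedSubalgebra 𝓕 ι π) (π z)))) + Module.finrank ℝ EG = r := by
      intro z hz
      obtain ⟨h1, h2⟩ := hU _ hz
      have h3 := hΦ.finrank_inducedSubalgebra hfree hA hB hBs hort hker hζ hF hdesc z
        (by rw [h1, h2, hlr])
      rwa [h1, h2] at h3
    -- A regular point of the level shows that l and r are at least dim G, so the natural-number
    -- subtractions below are exact.
    obtain ⟨z₀, hz₀⟩ := hUd.nonempty
    obtain ⟨h1, h2⟩ := hdim z₀ hz₀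
    refine ⟨l - Module.finrank ℝ EG, r - Module.finrank ℝ EG, by omega, π '' (ι ⁻¹' U),
      hπ.isOpenMap _ (hUo.preimage hιs.continuous),
      hπ.surjective.denseRange.dense_image hπ.continuous hUd, ?_⟩
    rintro _ ⟨z, hz, rfl⟩
    obtain ⟨h3, h4⟩ := hdim z hz
    exact ⟨by omega, by omega⟩

end Integrability

/-! ### The group action on a level set and its orbit projection -/

section LevelSetAction

variable {EG G E M F : Type*}
    [NormedAddCommGroup EG] [NormedSpace ℝ EG]
    [TopologicalSpace G] [ChartedSpace EG G] [Group G]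
    [NormedAddCommGroup E] [NormedSpace ℝ E]
    [TopologicalSpace M] [ChartedSpace E M] [MulAction G M]
    [NormedAddCommGroup F] [NormedSpace ℝ F] {s : Set M}

/-- The action on an invariant subset. -/
@[reducible]
def mulActionOfInvariant (h : ∀ (g : G), ∀ x ∈ s, g • x ∈ s) : MulAction G s where
  smul g z := ⟨g • (z : M), h g z z.2⟩
  one_smul z := Subtype.ext (one_smul G (z : M))
  mul_smul g k z := Subtype.ext (mul_smul g k (z : M))

variable [ChartedSpace F s]

/-- Near each point f is a local smooth retraction composed with the inclusion after f. -/
theorem contMDiff_of_comp_val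
    (hr : ∀ z : s, ∃ r : M → s, ContMDiffAt 𝓘(ℝ, E) 𝓘(ℝ, F) ∞ r z ∧ ∀ᶠ w : s in 𝓝 z, r (w : M) = w)
    {EN HN N : Type*} [NormedAddCommGroup EN] [NormedSpace ℝ EN] [TopologicalSpace HN]
    {J : ModelWithCorners ℝ EN HN} [TopologicalSpace N] [ChartedSpace HN N] {f : N → s}
    (hf : ContMDiff J 𝓘(ℝ, E) ∞ fun x => (f x : M)) : ContMDiff J 𝓘(ℝ, F) ∞ f := by
  intro x
  obtain ⟨r, hr1, hr2⟩ := hr (f x)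
  have hc : Continuous f := continuous_induced_rng.2 hf.continuous
  refine (hr1.comp x hf.contMDiffAt).congr_of_eventuallyEq ?_
  filter_upwards [hc.continuousAt.eventually hr2] with y hy using hy.symm

/-- A local retraction provides a left inverse of the differential. -/
theorem injective_mfderiv_val
    (hι : ContMDiff 𝓘(ℝ, F) 𝓘(ℝ, E) ∞ (Subtype.val : s → M))
    (hr : ∀ z : s, ∃ r : M → s, ContMDiffAt 𝓘(ℝ, E) 𝓘(ℝ, F) ∞ r z ∧ ∀ᶠ w : s in 𝓝 z, r (w : M) = w)
    (z : s) : Function.Injective (mfderiv 𝓘(ℝ, F) 𝓘(ℝ, E) (Subtype.val : s → M) z) := by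
  obtain ⟨r, hr1, hr2⟩ := hr z
  have h1 := (hι.mdifferentiableAt (x := z) (by simp)).hasMFDerivAt
  have h2 := (hr1.mdifferentiableAt (by simp)).hasMFDerivAt.comp_of_eq' h1 rfl
  have h3 : HasMFDerivAt 𝓘(ℝ, F) 𝓘(ℝ, F) (fun w : s => r w) z (ContinuousLinearMap.id ℝ F) :=
    (hasMFDerivAt_id z).congr_of_eventuallyEq hr2
  have h4 := hasMFDerivAt_unique h2 h3
  exact fun u v huv => (DFunLike.congr_fun h4 u).symm.trans
    ((congrArg _ huv).trans (DFunLike.congr_fun h4 v))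

theorem contMDiffSMul_of_invariant [ContMDiffSMul 𝓘(ℝ, EG) 𝓘(ℝ, E) ∞ G M]
    (h : ∀ (g : G), ∀ x ∈ s, g • x ∈ s)
    (hι : ContMDiff 𝓘(ℝ, F) 𝓘(ℝ, E) ∞ (Subtype.val : s → M))
    (hr : ∀ z : s, ∃ r : M → s, ContMDiffAt 𝓘(ℝ, E) 𝓘(ℝ, F) ∞ r z ∧
      ∀ᶠ w : s in 𝓝 z, r (w : M) = w) :
    letI : MulAction G s := mulActionOfInvariant h
    ContMDiffSMul 𝓘(ℝ, EG) 𝓘(ℝ, F) ∞ G s := by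
  let : MulAction G s := mulActionOfInvariant h
  refine ⟨contMDiff_of_comp_val hr ?_⟩
  exact contMDiff_fst.smul (I := 𝓘(ℝ, EG)) (hι.comp contMDiff_snd)

end LevelSetAction

section OrbitProjection

variable {EG G M : Type*}
    [NormedAddCommGroup EG] [NormedSpace ℝ EG]
    [TopologicalSpace G] [ChartedSpace EG G] [Group G] [LieGroup 𝓘(ℝ, EG) ∞ G]
    [TopologicalSpace M] [MulAction G M]
    {Φ : M → (GroupLieAlgebra 𝓘(ℝ, EG) G →L[ℝ] ℝ)}
    {η : GroupLieAlgebra 𝓘(ℝ, EG) G →L[ℝ] ℝ}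

omit [TopologicalSpace M] in
-- When the coadjoint action fixes η the isotropy group is all of G, so the fibres are full
-- G-orbits.
theorem reducedProj_eq_iff (hη : ∀ g : G, coadjointMap (EG := EG) g η = η) (z w : Φ ⁻¹' {η}) :
    reducedProj Φ η z = reducedProj Φ η w ↔ ∃ g : G, g • (z : M) = w := by
  have h1 : reducedProj Φ η z = reducedProj Φ η w ↔
      ∃ g : coadjointIsotropy (EG := EG) η, g • (w : M) = z := Quotient.eq
  rw [h1]
  constructor
  · rintro ⟨g, hg⟩
    exact ⟨(g : G)⁻¹, by rw [inv_smul_eq_iff]; exact hg.symm⟩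
  · rintro ⟨g, hg⟩
    exact ⟨⟨g⁻¹, hη _⟩, by rw [← hg]; exact inv_smul_smul g (z : M)⟩

/-- The saturation of an open set is the union of its translates by G. -/
theorem isOpenQuotientMap_reducedProj [ContinuousConstSMul G M]
    (hη : ∀ g : G, coadjointMap (EG := EG) g η = η)
    (hΦ : ∀ (g : G) (x : M), Φ (g • x) = Φ x) : IsOpenQuotientMap (reducedProj Φ η) := by
  refine ⟨Quotient.mk_surjective, continuous_quot_mk, fun V hV => ?_⟩
  refine isOpen_coinduced.2 ?_
  have h : ∀ (g : G), ∀ x ∈ Φ ⁻¹' {η}, g • x ∈ Φ ⁻¹' {η} := fun g x hx => (hΦ g x).trans hx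
  have h1 : reducedProj Φ η ⁻¹' (reducedProj Φ η '' V) =
      ⋃ g : G, (fun z : Φ ⁻¹' {η} => (⟨g • (z : M), h g z z.2⟩ : Φ ⁻¹' {η})) ⁻¹' V := by
    ext z
    simp only [mem_preimage, mem_image, mem_iUnion]
    constructor
    · rintro ⟨w, hw, hwz⟩
      obtain ⟨g, hg⟩ := (reducedProj_eq_iff hη _ _).1 hwz.symm
      refine ⟨g, ?_⟩
      convert hw
    · rintro ⟨g, hg⟩
      exact ⟨_, hg, ((reducedProj_eq_iff hη _ _).2 ⟨g, rfl⟩).symm⟩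
  change IsOpen (reducedProj Φ η ⁻¹' (reducedProj Φ η '' V))
  rw [h1]
  refine isOpen_iUnion fun g => hV.preimage ?_
  exact Continuous.subtype_mk (continuous_subtype_val.const_smul g) _

end OrbitProjection

/-! ### Assembly of the reduced system -/

section Reduction

variable {EG G E M : Type*}
    [NormedAddCommGroup EG] [NormedSpace ℝ EG] [FiniteDimensional ℝ EG]
    [TopologicalSpace G] [ChartedSpace EG G] [Group G] [LieGroup 𝓘(ℝ, EG) ∞ G]
    [CompactSpace G] [T2Space G]
    [NormedAddCommGroup E] [NormedSpace ℝ E] [FiniteDimensional ℝ E]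
    [TopologicalSpace M] [ChartedSpace E M] [IsManifold 𝓘(ℝ, E) ∞ M]
    [T2Space M] [SecondCountableTopology M] [MulAction G M]
    {Ω : SymplecticForm E M} {Φ : M → (EG →L[ℝ] ℝ)}

omit [CompactSpace G] [SecondCountableTopology M] in
/-- The dimension of the group is at most half the dimension of the manifold. -/
theorem IsHamiltonianAction.two_mul_finrank_le
    (hΦ : IsHamiltonianAction (EG := EG) (G := G) Ω Φ)
    (hinv : ∀ (g : G) (x : M), Φ (g • x) = Φ x)
    (hfree : ∀ (g : G) (x : M), g • x = x → g = 1) (x : M) :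
    2 * Module.finrank ℝ EG ≤ Module.finrank ℝ E := by
  have := hΦ.smooth_action
  have : CompleteSpace EG := FiniteDimensional.complete ℝ EG
  obtain ⟨D, hD, -⟩ := hΦ.exists_hasMFDerivAt_moment x
  have hDs : Function.Surjective D := by
    have := hΦ.surjective_mfderiv_moment hfree x
    rwa [hD.mfderiv] at this
  have h1 : D.comp (fundamentalMap E EG G x) = 0 := by
    have h2 := hD.comp_of_eq' (hasMFDerivAt_orbitMap (EG := EG) (E := E) (G := G) x)
      (one_smul G x)
    have h3 : HasMFDerivAt 𝓘(ℝ, EG) 𝓘(ℝ, EG →L[ℝ] ℝ) (fun g : G => Φ (g • x)) 1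
        (0 : EG →L[ℝ] EG →L[ℝ] ℝ) := by
      rw [show (fun g : G => Φ (g • x)) = fun _ => Φ x from funext fun g => hinv g x]
      exact hasMFDerivAt_const _ _
    exact hasMFDerivAt_unique h2 h3
  have h2 := LinearMap.finrank_range_add_finrank_ker D.toLinearMap
  rw [LinearMap.range_eq_top.2 hDs, finrank_top, finrank_continuousDual] at h2
  -- The orbit directions form an n-dimensional subspace of ker dΦ, which has dimension m - n.
  have h3 : LinearMap.range (fundamentalMap E EG G x).toLinearMap ≤ LinearMap.ker D.toLinearMap := by
    rintro _ ⟨a, rfl⟩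
    exact DFunLike.congr_fun h1 a
  have h4 := Submodule.finrank_mono h3
  rw [LinearMap.finrank_range_of_inj (fundamentalMap_injective_of_free hfree x)] at h4
  omega

/-- Complete integrability of the reduced system, for a value of the moment map in whose fibre the
regular set of the algebra of integrals is dense. -/
theorem IsHamiltonianAction.reducedSystemCompletelyIntegrable
    {Φ : M → (GroupLieAlgebra 𝓘(ℝ, EG) G →L[ℝ] ℝ)} (hΦ : IsHamiltonianAction Ω Φ)
    (hinv : ∀ (g : G) (x : M), Φ (g • x) = Φ x)
    (hfree : ∀ (g : G) (x : M), g • x = x → g = 1)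
    {H : C^∞⟮𝓘(ℝ, E), M; ℝ⟯} (hH : ∀ (g : G) (x : M), H (g • x) = H x)
    {𝓕 : Subalgebra ℝ C^∞⟮𝓘(ℝ, E), M; ℝ⟯} (hpoi : Ω.IsPoissonSubalgebra 𝓕)
    (hint : ∀ f ∈ 𝓕, ∀ x : M, differential (E := E) (⇑f) x (Ω.sgrad H x) = 0)
    (hF : ∀ f ∈ 𝓕, ∀ (g : G) (x : M), f (g • x) = f x)
    {l r : ℕ} (hlr : l + r = Module.finrank ℝ E) {U : Set M} (hUo : IsOpen U)
    (hU : ∀ x ∈ U, Module.finrank ℝ (differentialSpan 𝓕 x) = l ∧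
      Module.finrank ℝ
        (LinearMap.ker ((Ω.poissonTensor x).restrict (differentialSpan 𝓕 x))) = r)
    {η : GroupLieAlgebra 𝓘(ℝ, EG) G →L[ℝ] ℝ} (hne : Nonempty (Φ ⁻¹' {η}))
    (hUd : Dense ((Subtype.val : Φ ⁻¹' {η} → M) ⁻¹' U)) :
    ReducedSystemCompletelyIntegrable Ω Φ H η := by
  have := hΦ.smooth_action
  have : ContinuousSMul G M := ContMDiffSMul.continuousSMul (I := 𝓘(ℝ, EG)) (I' := 𝓘(ℝ, E)) ∞
  obtain ⟨z₀⟩ := id hne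
  -- The Lie algebra is EG by definition; these copies have types stated on the model space.
  let Φ' : M → EG →L[ℝ] ℝ := Φ
  let η' : EG →L[ℝ] ℝ := η
  have hΦ' : IsHamiltonianAction (EG := EG) (G := G) Ω Φ' := hΦ
  have hdim := hΦ'.two_mul_finrank_le hinv hfree z₀
  let n := Module.finrank ℝ EG
  let m := Module.finrank ℝ E
  -- The bound 2n ≤ m in `hdim` makes both subtractions exact.
  let EP := EuclideanSpace ℝ (Fin (m - n))
  let F := EuclideanSpace ℝ (Fin (m - 2 * n))
  have hd : Module.finrank ℝ EP + Module.finrank ℝ EG = Module.finrank ℝ E := by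
    rw [finrank_euclideanSpace_fin]; omega
  have hd' : Module.finrank ℝ F + Module.finrank ℝ EG = Module.finrank ℝ EP := by
    rw [finrank_euclideanSpace_fin, finrank_euclideanSpace_fin]; omega
  -- the level set
  obtain ⟨csP, hmP, hι, hr⟩ : ∃ _ : ChartedSpace EP (Φ ⁻¹' {η}),
      IsManifold 𝓘(ℝ, EP) ∞ (Φ ⁻¹' {η}) ∧
      ContMDiff 𝓘(ℝ, EP) 𝓘(ℝ, E) ∞ (Subtype.val : Φ ⁻¹' {η} → M) ∧
      (∀ z : Φ ⁻¹' {η}, ∃ r : M → Φ ⁻¹' {η}, ContMDiffAt 𝓘(ℝ, E) 𝓘(ℝ, EP) ∞ r z ∧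
        ∀ᶠ w : Φ ⁻¹' {η} in 𝓝 z, r (w : M) = w) :=
    exists_levelSet_manifold (Φ := Φ') (F := EP) (η := η') hΦ'.contMDiff_moment
      (by rw [finrank_continuousDual, hd]) fun x _ => hΦ'.surjective_mfderiv_moment hfree x
  have hs : ∀ (g : G), ∀ x ∈ Φ ⁻¹' {η}, g • x ∈ Φ ⁻¹' {η} := fun g x hx => (hinv g x).trans hx
  let act : MulAction G (Φ ⁻¹' {η}) := mulActionOfInvariant hs
  have hact : ContMDiffSMul 𝓘(ℝ, EG) 𝓘(ℝ, EP) ∞ G (Φ ⁻¹' {η}) :=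
    contMDiffSMul_of_invariant hs hι hr
  have : ContinuousSMul G (Φ ⁻¹' {η}) :=
    ContMDiffSMul.continuousSMul (I := 𝓘(ℝ, EG)) (I' := 𝓘(ℝ, EP)) ∞
  have hfreeP : ∀ (g : G) (z : Φ ⁻¹' {η}), g • z = z → g = 1 := fun g z hz =>
    hfree g z (congrArg Subtype.val hz)
  have hincl : ∀ (g : G) (z : Φ ⁻¹' {η}), ((g • z : Φ ⁻¹' {η}) : M) = g • (z : M) :=
    fun g z => rfl
  -- the reduced space
  have hη : ∀ g : G, coadjointMap (EG := EG) g η = η := by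
    intro g
    have h1 := hΦ.equivariant g z₀
    rw [hinv, show Φ z₀ = η from z₀.2] at h1
    exact h1.symm
  let X := ReducedSpace Φ η
  let π : Φ ⁻¹' {η} → X := reducedProj Φ η
  have hπ : IsOpenQuotientMap π := isOpenQuotientMap_reducedProj hη hinv
  have hfib : ∀ z w, π z = π w ↔ ∃ g : G, g • z = w := fun z w =>
    (reducedProj_eq_iff hη z w).trans (exists_congr fun g => ⟨fun h => Subtype.ext h, fun h => congrArg Subtype.val h⟩)
  obtain ⟨csX, hmX, hπs, hsec⟩ := exists_quotient_manifold (EG := EG) (F := F) hfreeP hd' hπ hfib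
  -- differentials
  let A : Φ ⁻¹' {η} → EP →L[ℝ] E := fun z => mfderiv 𝓘(ℝ, EP) 𝓘(ℝ, E) Subtype.val z
  let B : Φ ⁻¹' {η} → EP →L[ℝ] F := fun z => mfderiv 𝓘(ℝ, EP) 𝓘(ℝ, F) π z
  have hA : ∀ z, HasMFDerivAt 𝓘(ℝ, EP) 𝓘(ℝ, E) Subtype.val z (A z) := fun z =>
    (hι.mdifferentiableAt (by simp)).hasMFDerivAt
  have hB : ∀ z, HasMFDerivAt 𝓘(ℝ, EP) 𝓘(ℝ, F) π z (B z) := fun z =>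
    (hπs.mdifferentiableAt (by simp)).hasMFDerivAt
  have hAi : ∀ z, Function.Injective (A z) := injective_mfderiv_val hι hr
  have hBs : ∀ z, Function.Surjective (B z) := by
    intro z v
    obtain ⟨τ, W, hWo, hW, hτ, hτz, hπτ⟩ := hsec z
    have h1 := ((hτ.contMDiffAt (hWo.mem_nhds hW)).mdifferentiableAt (by simp)).hasMFDerivAt
    have h2 := (hB z).comp_of_eq' h1 hτz
    have h3 : HasMFDerivAt 𝓘(ℝ, F) 𝓘(ℝ, F) (fun x => π (τ x)) (π z)
        (ContinuousLinearMap.id ℝ F) := by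
      refine (hasMFDerivAt_id (π z)).congr_of_eventuallyEq ?_
      filter_upwards [hWo.mem_nhds hW] with x hx using hπτ x hx
    exact ⟨_, DFunLike.congr_fun (hasMFDerivAt_unique h2 h3) v⟩
  have hηz : ∀ z : Φ ⁻¹' {η}, Φ' z = η' := fun z => z.2
  have hort := hΦ'.exists_eq_incl_iff hfree hA hAi hηz hd
  have hπg : ∀ (g : G) z, π (g • z) = π z := fun g z => ((hfib _ _).2 ⟨g, rfl⟩).symm
  have hker : ∀ z u, B z u = 0 → ∃ a, A z u = fundamentalMap E EG G (z : M) a := by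
    intro z u hu
    obtain ⟨a, rfl⟩ := (hΦ'.proj_eq_zero_iff hfree hA hB hBs hincl hπg hd' z u).1 hu
    exact ⟨a, fundamentalMap_of_equivariant (EG := EG) hA hincl z a⟩
  obtain ⟨ζ, hζ⟩ := hΦ'.exists_reducedForm hfree hι hA hAi hB hBs hincl hfib hπ.surjective hηz hd hd'
    hsec
  let R : ReducedSymplecticManifold Ω Φ η :=
    { dimLevel := m - n
      chartedLevel := csP
      manifoldLevel := hmP
      smooth_incl := hι
      immersion_incl := hAi
      dim := m - 2 * n
      charted := csX
      manifold := hmX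
      hausdorff := t2Space_of_isOpenQuotientMap_orbits (G := G) hπ hfib
      secondCountable := hπ.isQuotientMap.secondCountableTopology hπ.isOpenMap
      smooth_proj := hπs
      submersion_proj := hBs
      form := ζ
      form_proj := hζ }
  obtain ⟨Hη, hHη⟩ := exists_contMDiffMap_descent hι hπ.surjective hsec H fun z w hzw => by
    obtain ⟨g, rfl⟩ := (hfib z w).1 hzw
    exact (hH g z).symm
  refine ⟨R, Hη, hHη, ?_⟩
  exact hΦ'.completelyIntegrable_descent hfree hι hA hB hBs hort hker hζ hπ hsec
    (fun z w hzw => by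
      obtain ⟨g, rfl⟩ := (hfib z w).1 hzw
      exact ⟨g, rfl⟩) (by omega) hHη hH hpoi hint hF hlr hUo hUd hU

end Reduction

end
theorem lemma3 {EG G E M : Type*}
    [NormedAddCommGroup EG] [NormedSpace ℝ EG] [FiniteDimensional ℝ EG]
    [TopologicalSpace G] [ChartedSpace EG G] [Group G] [LieGroup 𝓘(ℝ, EG) ∞ G]
    [CompactSpace G] [ConnectedSpace G] [T2Space G]
    [NormedAddCommGroup E] [NormedSpace ℝ E] [FiniteDimensional ℝ E]
    [TopologicalSpace M] [ChartedSpace E M] [IsManifold 𝓘(ℝ, E) ∞ M]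
    [T2Space M] [SecondCountableTopology M]
    [MulAction G M] [FaithfulSMul G M]
    (Ω : SymplecticForm E M) (Φ : M → (GroupLieAlgebra 𝓘(ℝ, EG) G →L[ℝ] ℝ))
    (hΦ : IsHamiltonianAction Ω Φ)
    (H : C^∞⟮𝓘(ℝ, E), M; ℝ⟯) (hH : ∀ (g : G) (x : M), H (g • x) = H x)
    (hint : ∃ F : Subalgebra ℝ C^∞⟮𝓘(ℝ, E), M; ℝ⟯, Ω.IsCompleteAlgebraOfIntegrals H F ∧
      ∀ f ∈ F, ∀ (g : G) (x : M), f (g • x) = f x) :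
    IsTorus EG G ∧
      ((∀ (g : G) (x : M), g • x = x → g = 1) →
        ∀ᶠ η : range Φ in residual (range Φ),
          ReducedSystemCompletelyIntegrable Ω Φ H (η : GroupLieAlgebra 𝓘(ℝ, EG) G →L[ℝ] ℝ)) := by
  have : CompleteSpace EG := FiniteDimensional.complete ℝ EG
  obtain ⟨F, ⟨hpoi, hfi, hc⟩, hF⟩ := hint
  have hinv := hΦ.moment_smul hc hF
  refine ⟨isTorus_of_mul_comm (mul_comm_of_adjointMap_eq_id (hΦ.adjointMap_eq_id hinv)), ?_⟩
  intro hfree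
  obtain ⟨l, r, hlr, U, hUo, hUd, hU⟩ := hc
  let Φ' : M → EG →L[ℝ] ℝ := Φ
  have hsm : ContMDiff 𝓘(ℝ, E) 𝓘(ℝ, EG →L[ℝ] ℝ) ∞ Φ' :=
    IsHamiltonianAction.contMDiff_moment (G := G) hΦ
  have hcont : Continuous Φ := hsm.continuous
  have hopen : IsOpenMap Φ := isOpenMap_of_surjective_mfderiv (f := Φ') hsm
    (IsHamiltonianAction.surjective_mfderiv_moment (G := G) hΦ hfree)
  -- Residual is meant inside the image of Φ, so the density statement is applied to Φ as an open
  -- map onto its range.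
  have h1 := eventually_residual_dense_preimage (f := rangeFactorization Φ)
    hcont.rangeFactorization (hopen.subtype_mk mem_range_self) hUo hUd
  refine Filter.Eventually.mono h1 fun η hη => ?_
  have h2 : rangeFactorization Φ ⁻¹' {η} = Φ ⁻¹' {(η : GroupLieAlgebra 𝓘(ℝ, EG) G →L[ℝ] ℝ)} := by
    ext x
    exact Subtype.ext_iff
  rw [h2] at hη
  obtain ⟨x, hx⟩ := η.2
  exact hΦ.reducedSystemCompletelyIntegrable hinv hfree hH hpoi hfi hF hlr hUo hU ⟨⟨x, hx⟩⟩ hη
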